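/- **Setting.** Let $(X,\mathscr F,\mu,T)$ be an ergodic system ($\mu$ a probability measure, $T:X\to X$ measure preserving and ergodic). For $A:X\to \mathrm{Mat}_m(\mathbb R)$ put $A^{(n)}(x)=A(T^{n-1}x)\cdots A(Tx)A(x)$, let $\|\cdot\|$ be the Euclidean operator norm, $s_1(g)\ge\dots\ge s_m(g)\ge 0$ the singular values of a matrix $g$, and $s_k(g)=0$ for $k>m$. With $\log 0=-\infty$, put $L^{(n)}_1(A)=\int_X\frac1n\log\|A^{(n)}\|\,d\mu$, and let $L_k(A)=\lim_{n\to\infty}\int_X \frac1n\log s_k(A^{(n)})\,d\mu$ be the Lyapunov exponents (so $L_k(A)=-\infty$ for $k>m$). *Cocycles.* A space of measurable cocycles $\mathcal C=\bigcup_{m}\mathcal C_m$ consists of sets $\mathcal C_m$ of measurable functions $A:X\to\mathrm{Mat}_m(\mathbb R)$ with $\|A\|\in L^\infty(\mu)$, such that $A\in\mathcal C_m$ implies $\wedge_kA\in\mathcal C_{\binom mk}$ for $1\le k\le m$ (where $\wedge_k A(x)$ is the matrix of $k\times k$ minors of $A(x)$, index sets ordered lexicographically). Each $\mathcal C_m$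 carries a distance (possibly $0$ for different cocycles that agree almost everywhere) with $\mathrm{dist}(B,A)\ge\|B-A\|_{L^\infty}$, and the maps $A\mapsto\wedge_kA$ are locally Lipschitz. *Compatibility.* Let $\Xi$ be a set of measurable functions $\xi:X\to\mathbb R$ (observables). Let $\mathscr F_N(A)$ be the algebra of sets generated by $\{\|A^{(n)}\|\le c\}$ and $\{\|A^{(n)}\|\ge c\}$, $c\ge0$, $0\le n\le N$. $\Xi$ and $A$ are compatible if for all $N$, $F\in\mathscr F_N(A)$, $\epsilon>0$ there is an integrable $\xi\in\Xi$ with $\mathbf 1_F\le\xi$ and $\int\xi\,d\mu\le\mu(F)+\epsilon$. *LDT parameters.* Let $\mathscr E$ be a set of non-increasing functions $\varepsilon:(0,\infty)\to(0,\infty)$. Let $\mathscr I$ be a set of continuous functions $\iota:(0,\infty)\to(0,\infty)$, strictly decreasing to $0$, with $\log t\lesssim\log\frac1{\iota(t)}\lesssim t$ as $t\to\infty$ and $\limsup_{t\to\infty}\phi_\iota(2t)/\phi_\iota(t)<2$, where $\phi_\iota$ is the inverse of $t\mapsto t\,\iota(t)^{-1/2}$; $\mathscr I$ is closed under sums and under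 multiplication by positive constants. Let $\mathscr P$ be a set of triplets $(n_0,\varepsilon,\iota)$ with $n_0\ge1$ an integer, $\varepsilon\in\mathscr E$, $\iota\in\mathscr I$, such that for all $\epsilon>0$ some $(n_0,\varepsilon,\iota)\in\mathscr P$ has $\varepsilon(n_0)\le\epsilon$. *LDT estimates.* An observable $\xi$ satisfies a base-LDT if it is integrable and for all $\epsilon>0$ there is $(n_0,\varepsilon,\iota)\in\mathscr P$ such that for all $n\ge n_0$: $\varepsilon(n)\le\epsilon$ and $\mu\{|\frac1n\sum_{j<n}\xi\circ T^j-\int\xi\,d\mu|>\varepsilon(n)\}<\iota(n)$. A cocycle $A\in\mathcal C_m$ satisfies a uniform fiber-LDT if for all $\epsilon>0$ there are $\delta>0$ and $(n_0,\varepsilon,\iota)\in\mathscr P$ such that for all $B\in\mathcal C_m$ with $\mathrm{dist}(B,A)<\delta$ and all $n\ge n_0$: $\varepsilon(n)\le\epsilon$ and $\mu\{|\frac1n\log\|B^{(n)}\|-L_1^{(n)}(B)|>\varepsilon(n)\}<\iota(n)$. $A\in\mathcal C_m$ is uniformly $L^p$-bounded if there are $\delta>0$ and $K<\infty$ with $\|\frac1n\log\|B^{(n)}\|\|_{L^p(\mu)}<K$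 for all $B\in\mathcal C_m$ with $\mathrm{dist}(B,A)<\delta$ and all $n\ge1$. **Theorem.** Let $1<p\le\infty$ and assume: 1. $\Xi$ is compatible with every $A\in\mathcal C_m$, $m\ge1$; 2. every $\xi\in\Xi$ satisfies a base-LDT; 3. every $A\in\mathcal C_m$, $m\ge1$, with $L_1(A)>-\infty$ is uniformly $L^p$-bounded; 4. every $A\in\mathcal C_m$, $m\ge2$, with $L_1(A)>L_2(A)$ satisfies a uniform fiber-LDT. Then for all $1\le k\le m$ the Lyapunov exponent $L_k$ takes values in $[-\infty,\infty)$ on $\mathcal C_m$ and $L_k:\mathcal C_m\to[-\infty,\infty)$ is continuous. Moreover, let $A\in\mathcal C_m$ and $1\le k\le m$ with $L_k(A)>L_{k+1}(A)$; if $k=m$, assume that condition 4 holds also for $m=1$ (where $L_2=-\infty$). Then there are $\delta>0$, $\iota\in\mathscr I$ and $c>0$ such that, with $\omega(h)=[\iota(c\log\frac1h)]^{1-1/p}$ for $h>0$ and $\omega(0)=0$, all $B_1,B_2\in\mathcal C_m$ with $\mathrm{dist}(B_i,A)<\delta$ have finite $\Lambda_k(B_i)=(L_1+\dots+L_k)(B_i)$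 and $$|\Lambda_k(B_1)-\Lambda_k(B_2)|\le\omega(\mathrm{dist}(B_1,B_2)).$$ -/

import Mathlib

open MeasureTheory Filter Topology Set
open scoped ENNReal NNReal Matrix.Norms.L2Operator

noncomputable section

namespace ACT

/-! ### Extended integrals, exterior powers, singular values -/

/-- The integral in `[-∞, ∞]` of an extended real valued function, `∫ f⁺ - ∫ f⁻`. All functions it
is applied to below have an essentially bounded positive part, so `∞ - ∞` does not occur. -/
def eintegral {X : Type*} [MeasurableSpace X] (μ : Measure X) (f : X → EReal) : EReal :=
  ((∫⁻ x, (f x).toENNReal ∂μ : ℝ≥0∞) : EReal) - ((∫⁻ x, (-f x).toENNReal ∂μ : ℝ≥0∞) : EReal)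

/-- The strictly increasing `k`-tuples in `Fin m`, with the lexicographic order. -/
def wedgeIndices (m k : ℕ) : Finset (Lex (Fin k → Fin m)) :=
  Finset.univ.filter fun f => StrictMono (ofLex f)

theorem card_wedgeIndices (m k : ℕ) : (wedgeIndices m k).card = m.choose k := by
  have e : (Fin k ↪o Fin m) ≃ {f : Lex (Fin k → Fin m) // StrictMono (ofLex f)} :=
    { toFun := fun f => ⟨toLex f, f.strictMono⟩
      invFun := fun f => OrderEmbedding.ofStrictMono (ofLex f.1) f.2
      left_inv := fun f => by ext; rfl
      right_inv := fun f => rfl }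
  have h1 : (wedgeIndices m k).card = Nat.card {f : Lex (Fin k → Fin m) // StrictMono (ofLex f)} := by
    rw [Nat.card_eq_fintype_card, Fintype.card_subtype]; rfl
  rw [h1, ← Nat.card_congr e, Nat.card_congr Set.powersetCard.ofFinEmbEquiv,
    Set.powersetCard.card, Nat.card_eq_fintype_card, Fintype.card_fin]

/-- The lexicographic enumeration of the increasing `k`-tuples in `Fin m`. -/
def wedgeIndex (m k : ℕ) (i : Fin (m.choose k)) : Fin k → Fin m :=
  ofLex ((wedgeIndices m k).orderEmbOfFin (card_wedgeIndices m k) i)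

/-- The exterior power `∧_k g` as a matrix of size `m.choose k`, with respect to the basis
`e_{i₁} ∧ ⋯ ∧ e_{i_k}`, `i₁ < ⋯ < i_k`: its entries are the `k × k` minors of `g`. -/
def wedge {m : ℕ} (k : ℕ) (g : Matrix (Fin m) (Fin m) ℝ) :
    Matrix (Fin (m.choose k)) (Fin (m.choose k)) ℝ :=
  Matrix.of fun i j => (g.submatrix (wedgeIndex m k i) (wedgeIndex m k j)).det

/-- The `k`-th singular value `s_k(g)`, for `k ≥ 1`: `s_1(g) ≥ ⋯ ≥ s_m(g) ≥ 0`, and `s_k(g) = 0` for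
`k > m`. -/
def sv {m : ℕ} (g : Matrix (Fin m) (Fin m) ℝ) (k : ℕ) : ℝ :=
  (Matrix.toEuclideanLin g).singularValues (k - 1)

/-- The logarithm `[0, ∞) → [-∞, ∞)`, with `log 0 = -∞`. -/
def elog (r : ℝ) : EReal := ENNReal.log (ENNReal.ofReal r)

/-! ### Iterates and Lyapunov exponents -/

section Cocycles

variable {X : Type*} [MeasurableSpace X] (μ : Measure X) (T : X → X) {m : ℕ}

/-- `A^{(n)}(x) = A(T^{n-1} x) ⋯ A(T x) A(x)`. -/
def iter (A : X → Matrix (Fin m) (Fin m) ℝ) : ℕ → X → Matrix (Fin m) (Fin m) ℝ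
  | 0, _ => 1
  | n + 1, x => A (T^[n] x) * iter A n x

/-- `(1/n) log ‖A^{(n)}(x)‖`, where `‖·‖` is the operator norm for the Euclidean norm. -/
def logNorm (A : X → Matrix (Fin m) (Fin m) ℝ) (n : ℕ) (x : X) : EReal :=
  elog ‖iter T A n x‖ / (n : EReal)

/-- The finite scale exponent `L_1^{(n)}(A) = ∫ (1/n) log ‖A^{(n)}(x)‖ dμ(x)`. -/
def finiteLyap (A : X → Matrix (Fin m) (Fin m) ℝ) (n : ℕ) : EReal :=
  eintegral μ (logNorm T A n)

/-- The Lyapunov exponent `L_k(A) = lim ∫ (1/n) log s_k(A^{(n)}(x)) dμ(x)`, for `k ≥ 1`. (For an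
ergodic system and a bounded measurable `A` the limit exists, so that it is the `limsup`.)
For `k > m` this is `-∞`. -/
def lyap (A : X → Matrix (Fin m) (Fin m) ℝ) (k : ℕ) : EReal :=
  limsup (fun n : ℕ => eintegral μ fun x => elog (sv (iter T A n x) k) / (n : EReal)) atTop

/-- The block `L_1 + ⋯ + L_k`. -/
def lyapBlock (A : X → Matrix (Fin m) (Fin m) ℝ) (k : ℕ) : EReal :=
  ∑ j ∈ Finset.Icc 1 k, lyap μ T A j

/-- The algebra `𝓕_N(A)` generated by the sets `{‖A^{(n)}‖ ≤ c}` and `{‖A^{(n)}‖ ≥ c}` with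
`c ≥ 0` and `0 ≤ n ≤ N`. -/
def cocycleAlgebra (A : X → Matrix (Fin m) (Fin m) ℝ) (N : ℕ) : Set (Set X) :=
  generateSetAlgebra {F | ∃ n ≤ N, ∃ c : ℝ, 0 ≤ c ∧
    (F = {x | ‖iter T A n x‖ ≤ c} ∨ F = {x | c ≤ ‖iter T A n x‖})}

/-- Compatibility of a set of observables `Ξ` with a cocycle `A`. -/
def Compatible (Ξ : Set (X → ℝ)) (A : X → Matrix (Fin m) (Fin m) ℝ) : Prop :=
  ∀ N : ℕ, ∀ F ∈ cocycleAlgebra T A N, ∀ ε : ℝ, 0 < ε →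
    ∃ ξ ∈ Ξ, (∀ x, F.indicator (fun _ => (1 : ℝ)) x ≤ ξ x) ∧
      Integrable ξ μ ∧ ∫ x, ξ x ∂μ ≤ μ.real F + ε

end Cocycles

/-- A space of measurable cocycles over `(X, μ)`: `carrier m` is the set `𝒞_m` of its `m`-dimensional
members. The distance may vanish on cocycles that agree almost everywhere. -/
structure CocycleSpace {X : Type*} [MeasurableSpace X] (μ : Measure X) where
  carrier : (m : ℕ) → Set (X → Matrix (Fin m) (Fin m) ℝ)
  measurable : ∀ m, ∀ A ∈ carrier m, ∀ i j, Measurable fun x => A x i j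
  bounded : ∀ m, ∀ A ∈ carrier m, eLpNorm (fun x => ‖A x‖) ∞ μ < ∞
  wedge_mem : ∀ m k, 1 ≤ k → k ≤ m → ∀ A ∈ carrier m,
    (fun x => wedge k (A x)) ∈ carrier (m.choose k)
  [metric : ∀ m, PseudoMetricSpace (carrier m)]
  le_dist : ∀ m, ∀ A B : carrier m,
    eLpNorm (fun x => ‖B.1 x - A.1 x‖) ∞ μ ≤ ENNReal.ofReal (dist B A)
  wedge_locallyLipschitz : ∀ m k (hk : 1 ≤ k) (hkm : k ≤ m),
    LocallyLipschitz fun A : carrier m =>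
      (⟨fun x => wedge k (A.1 x), wedge_mem m k hk hkm A.1 A.2⟩ : carrier (m.choose k))

attribute [instance] CocycleSpace.metric

/-- The set `𝒞_m` as a type of its own, with the topology of the given distance (and not with the
topology of pointwise convergence that a set of functions inherits). -/
def CocycleSpace.Space {X : Type*} [MeasurableSpace X] {μ : Measure X} (C : CocycleSpace μ) (m : ℕ) :
    Type _ :=
  C.carrier m

instance {X : Type*} [MeasurableSpace X] {μ : Measure X} (C : CocycleSpace μ) (m : ℕ) :
    PseudoMetricSpace (C.Space m) :=
  C.metric m

/-! ### Large deviation parameters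

Functions on `(0, ∞)` are represented by functions on `ℝ` whose values on `(-∞, 0]` play no role. -/

/-- Deviation size functions: positive and non-increasing on `(0, ∞)`. -/
structure IsDevSize (ε : ℝ → ℝ) : Prop where
  pos : ∀ t, 0 < t → 0 < ε t
  antitone : AntitoneOn ε (Ioi 0)

/-- `ψ_ι(t) = t ι(t)^{-1/2}`, an increasing bijection of `(0, ∞)` for the functions `ι` below. -/
def psi (ι : ℝ → ℝ) (t : ℝ) : ℝ := t * ι t ^ (-(1 / 2) : ℝ)

/-- `φ_ι`, the inverse of `ψ_ι` on `(0, ∞)`. -/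
def phi (ι : ℝ → ℝ) : ℝ → ℝ := Function.invFunOn (psi ι) (Ioi 0)

/-- Deviation set measure functions: positive, continuous, strictly decreasing to `0`, with
`log t ≲ log (1/ι(t)) ≲ t` and `limsup φ_ι(2t)/φ_ι(t) < 2` as `t → ∞`. -/
structure IsDevMeasure (ι : ℝ → ℝ) : Prop where
  pos : ∀ t, 0 < t → 0 < ι t
  continuousOn : ContinuousOn ι (Ioi 0)
  strictAntiOn : StrictAntiOn ι (Ioi 0)
  tendsto : Tendsto ι atTop (𝓝 0)
  log_isBigO : Real.log =O[atTop] fun t => Real.log (1 / ι t)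
  isBigO_id : (fun t => Real.log (1 / ι t)) =O[atTop] fun t : ℝ => t
  limsup_phi : limsup (fun t : ℝ => ((phi ι (2 * t) / phi ι t : ℝ) : EReal)) atTop < 2

/-- Spaces `𝓔` and `𝓘` of deviation functions, `𝓘` a convex cone, together with a set `𝓟` of LDT
parameters `(n₀, ε, ι)`, containing parameters with arbitrarily small deviation size. -/
structure LDTParameters where
  devSizes : Set (ℝ → ℝ)
  devMeasures : Set (ℝ → ℝ)
  params : Set (ℕ × (ℝ → ℝ) × (ℝ → ℝ))
  isDevSize : ∀ ε ∈ devSizes, IsDevSize ε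
  isDevMeasure : ∀ ι ∈ devMeasures, IsDevMeasure ι
  smul_mem : ∀ ι ∈ devMeasures, ∀ a : ℝ, 0 < a → (fun t => a * ι t) ∈ devMeasures
  add_mem : ∀ ι₁ ∈ devMeasures, ∀ ι₂ ∈ devMeasures, (fun t => ι₁ t + ι₂ t) ∈ devMeasures
  mem_params : ∀ q ∈ params, 1 ≤ q.1 ∧ q.2.1 ∈ devSizes ∧ q.2.2 ∈ devMeasures
  exists_small : ∀ η : ℝ, 0 < η → ∃ q ∈ params, q.2.1 (q.1 : ℝ) ≤ η

section Estimates

variable {X : Type*} [MeasurableSpace X] {μ : Measure X} (T : X → X)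

/-- The base-LDT estimate for an observable `ξ`, which is to have a mean. -/
def BaseLDT (μ : Measure X) (P : LDTParameters) (ξ : X → ℝ) : Prop :=
  Integrable ξ μ ∧ ∀ η : ℝ, 0 < η → ∃ n₀ ε ι, (n₀, ε, ι) ∈ P.params ∧ ∀ n : ℕ, n₀ ≤ n →
    ε n ≤ η ∧
    μ {x | ε n < |(1 / (n : ℝ)) * ∑ j ∈ Finset.range n, ξ (T^[j] x) - ∫ y, ξ y ∂μ|}
      < ENNReal.ofReal (ι n)

variable (C : CocycleSpace μ) {m : ℕ}

/-- Uniform `L^p`-boundedness of `A ∈ 𝒞_m`; the value `log 0 = -∞` has absolute value `∞`. -/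
def UniformlyLpBounded (p : ℝ≥0∞) (A : C.Space m) : Prop :=
  ∃ δ : ℝ, 0 < δ ∧ ∃ K : ℝ≥0, ∀ B : C.Space m, dist B A < δ → ∀ n : ℕ, 1 ≤ n →
    eLpNorm (fun x => (logNorm T B.1 n x).abs) p μ < K

/-- The uniform fiber-LDT at `A ∈ 𝒞_m`. -/
def UniformFiberLDT (P : LDTParameters) (A : C.Space m) : Prop :=
  ∀ η : ℝ, 0 < η → ∃ δ : ℝ, 0 < δ ∧ ∃ n₀ ε ι, (n₀, ε, ι) ∈ P.params ∧
    ∀ B : C.Space m, dist B A < δ → ∀ n : ℕ, n₀ ≤ n →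
      ε n ≤ η ∧
      μ {x | ENNReal.ofReal (ε n) < (logNorm T B.1 n x - finiteLyap μ T B.1 n).abs}
        < ENNReal.ofReal (ι n)

end Estimates

/-- The modulus of continuity `ω(h) = [ι(c log (1/h))]^{1 - 1/p}`, with `ω(0) = 0`. -/
def modulus (ι : ℝ → ℝ) (c : ℝ) (p : ℝ≥0∞) (h : ℝ) : ℝ :=
  if h = 0 then 0 else ι (c * Real.log (1 / h)) ^ (1 - (1 / p).toReal)

end ACT

end

/-!
The Lyapunov exponents are recovered from top exponents of exterior powers: `‖∧_k g‖` is the product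
of the `k` largest singular values of `g`, so the block `L_1 + ⋯ + L_k` of `A` is `L_1(∧_k A)`, and
`L_k` is a difference of two such blocks whenever this makes sense (`lyap_succ_eq_sub`). A gap
`L_k > L_{k+1}` of `A` becomes a gap `L_1 > L_2` of `∧_k A`, or dimension one if `k = m`. Everything
is thereby reduced to the top exponent near a cocycle with `L_1 > L_2`.

The top exponent is the infimum of the finite scale exponents `L_1^{(n)}`, by subadditivity, and hence
upper semicontinuous. The same subadditive argument along orbits, with the truncated logarithm of
`‖A^{(q)}‖` dominated by observables that satisfy base large deviation estimates, gives a large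
deviation estimate from above for `‖B^{(n)}‖`, uniform in `B` near `A` (`exists_upper_ldt`). Applied to
`∧_2 A`, whose top exponent is `L_1 + L_2 < 2 L_1`, it says that the iterates `B^{(n)}` have a large
ratio of their first two singular values outside a set of measure at most `ι(n)`.

A matrix with such a ratio is close to rank one, and if the middle factor `g` has rank one, then
`‖g‖ ‖a g b‖ = ‖a g‖ ‖g b‖`. With the fiber large deviation estimates this gives
`log ‖g₃ g₂ g₁ g₀‖ ≈ log ‖g₁ g₀‖ + log ‖g₂ g₁‖ + log ‖g₃ g₂‖ - log ‖g₁‖ - log ‖g₂‖` for the four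
blocks `g_i` of length `n` of `B^{(4n)}`, off a small set (`log_norm_four_blocks`). On the small set
the `L^p` bound and Hölder's inequality are used, so that after integration
`4 L_1^{(4n)} + 2 L_1^{(n)} - 6 L_1^{(2n)}` is of the order of `ι(n)^{1 - 1/p}`
(`abs_realLyap_four_le`). Iterating over the scales `2^k N` (`dyadic_recursion`), where the errors
are summable by the growth condition on `φ_ι`, shows that `2 L_1^{(2n)}(B) - L_1^{(n)}(B)` differs from
`L_1(B)` by an error of the order of `ι(a n)^{1 - 1/p}`, for some constant `a > 0`, uniformly in `B`
near `A` (`uniformRate_of_two_le`).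

At a fixed scale `n` the exponent `L_1^{(n)}` is continuous in the cocycle, which gives lower
semicontinuity of `L_1` at a gap. The continuity of all `L_k`, with or without gaps, follows from the
semicontinuity of the blocks and `L_1 ≥ L_2 ≥ ⋯` (`eventually_lyap_lt`, `eventually_lt_lyap`). For the
modulus of continuity, two cocycles at distance `h` are compared at a scale `n` proportional to
`log (1/h)`, chosen such that `L_1^{(n)}` changes by at most about `√h + ι(n)^{1 - 1/p}`
(`exists_abs_sub_le_of_hasRate`).
-/

namespace ACT

/-! ### Compound matrices -/

theorem wedgeIndex_strictMono (m k : ℕ) (i : Fin (m.choose k)) : StrictMono (wedgeIndex m k i) := by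
  have h := Finset.orderEmbOfFin_mem (wedgeIndices m k) (card_wedgeIndices m k) i
  exact (Finset.mem_filter.mp h).2

theorem wedgeIndex_injective (m k : ℕ) : Function.Injective (wedgeIndex m k) := fun _ _ h =>
  ((wedgeIndices m k).orderEmbOfFin (card_wedgeIndices m k)).injective (ofLex.injective h)

theorem exists_wedgeIndex_eq {m k : ℕ} {f : Fin k → Fin m} (hf : StrictMono f) :
    ∃ i, wedgeIndex m k i = f := by
  have h1 : toLex f ∈ (wedgeIndices m k : Set (Lex (Fin k → Fin m))) := by
    simpa [wedgeIndices] using hf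
  rw [← Finset.range_orderEmbOfFin (wedgeIndices m k) (card_wedgeIndices m k)] at h1
  obtain ⟨i, hi⟩ := h1
  exact ⟨i, by rw [wedgeIndex, hi]; rfl⟩

/-- The Cauchy–Binet formula. -/
theorem wedge_mul {m : ℕ} (k : ℕ) (g h : Matrix (Fin m) (Fin m) ℝ) :
    wedge k (g * h) = wedge k g * wedge k h := by
  ext i j
  set I := wedgeIndex m k i
  set J := wedgeIndex m k j
  have expand : wedge k (g * h) i j
      = ∑ f : Fin k → Fin m, (∏ a, g (I a) (f a)) * (h.submatrix f J).det := by
    have h1 : wedge k (g * h) i j = Matrix.detRowAlternating.toMultilinearMap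
        (fun a => ∑ c, g (I a) c • fun b => h c (J b)) := by
      change Matrix.det _ = Matrix.det _
      congr 1
      ext a b
      simp [I, J, Matrix.mul_apply, Finset.sum_apply]
    rw [h1, MultilinearMap.map_sum]
    refine Finset.sum_congr rfl fun f _ => ?_
    rw [MultilinearMap.map_smul_univ]
    rfl
  have inj : Function.Injective fun q : Fin (m.choose k) × Equiv.Perm (Fin k) =>
      wedgeIndex m k q.1 ∘ q.2 := by
    rintro ⟨a, σ⟩ ⟨b, τ⟩ hab
    have hab : wedgeIndex m k a ∘ σ = wedgeIndex m k b ∘ τ := hab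
    have hr : range (wedgeIndex m k a) = range (wedgeIndex m k b) := by
      rw [← σ.surjective.range_comp, hab, τ.surjective.range_comp]
    have hK := ((wedgeIndex_strictMono m k a).range_inj (wedgeIndex_strictMono m k b)).1 hr
    obtain rfl := wedgeIndex_injective m k hK
    have : σ = τ := by
      ext x
      exact congrArg _ ((wedgeIndex_strictMono m k a).injective (congrFun hab x))
    rw [this]
  rw [expand, Matrix.mul_apply, ← Fintype.sum_of_injective _ inj
    (fun q => (∏ a, g (I a) (wedgeIndex m k q.1 (q.2 a))) *
      (h.submatrix (wedgeIndex m k q.1 ∘ q.2) J).det) _ ?_ (fun q => rfl), Fintype.sum_prod_type]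
  · refine Finset.sum_congr rfl fun K _ => ?_
    have hdet : ∀ σ : Equiv.Perm (Fin k), (h.submatrix (wedgeIndex m k K ∘ σ) J).det
        = (Equiv.Perm.sign σ : ℝ) * wedge k h K j := fun σ => by
      have := Matrix.det_permute σ (h.submatrix (wedgeIndex m k K) J)
      rw [Matrix.submatrix_submatrix] at this
      exact this
    have hg : wedge k g i K = ∑ σ : Equiv.Perm (Fin k),
        (Equiv.Perm.sign σ : ℝ) * ∏ a, g (I a) (wedgeIndex m k K (σ a)) := by
      rw [wedge, Matrix.of_apply, ← Matrix.det_transpose, Matrix.det_apply']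
      rfl
    rw [hg, Finset.sum_mul]
    refine Finset.sum_congr rfl fun σ _ => ?_
    dsimp only
    rw [hdet]
    ring
  · -- a tuple that is not a rearrangement of an increasing one repeats an index
    intro f hf
    have hni : ¬ Function.Injective f := fun hinj => hf <| by
      have hs : StrictMono (f ∘ Tuple.sort f) :=
        (Tuple.monotone_sort f).strictMono_of_injective (hinj.comp (Tuple.sort f).injective)
      obtain ⟨K, hK⟩ := exists_wedgeIndex_eq hs
      refine ⟨(K, (Tuple.sort f)⁻¹), ?_⟩
      ext x
      simp [hK]
    simp only [Function.Injective, not_forall] at hni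
    obtain ⟨a, b, hab, hne⟩ := hni
    rw [Matrix.det_zero_of_row_eq hne (by ext c; simp [hab]), mul_zero]

theorem wedge_transpose {m : ℕ} (k : ℕ) (g : Matrix (Fin m) (Fin m) ℝ) :
    wedge k g.transpose = (wedge k g).transpose := by
  ext i j
  simp only [wedge, Matrix.of_apply, Matrix.transpose_apply]
  rw [← Matrix.det_transpose]
  rfl

theorem wedge_diagonal {m : ℕ} (k : ℕ) (d : Fin m → ℝ) :
    wedge k (Matrix.diagonal d) = Matrix.diagonal fun i => ∏ a, d (wedgeIndex m k i a) := by
  ext i j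
  by_cases hij : i = j
  · subst hij
    rw [Matrix.diagonal_apply_eq, wedge, Matrix.of_apply, ← Matrix.det_diagonal]
    congr 1
    ext a b
    simp [Matrix.diagonal_apply, (wedgeIndex_strictMono m k i).injective.eq_iff]
  · rw [Matrix.diagonal_apply_ne _ hij]
    have : ∃ a, ∀ b, wedgeIndex m k i a ≠ wedgeIndex m k j b := by
      by_contra! hc
      refine hij (wedgeIndex_injective m k ?_)
      have hsub : range (wedgeIndex m k i) ⊆ range (wedgeIndex m k j) := by
        rintro _ ⟨a, rfl⟩
        obtain ⟨b, hb⟩ := hc a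
        exact ⟨b, hb.symm⟩
      rw [← (wedgeIndex_strictMono m k i).range_inj (wedgeIndex_strictMono m k j)]
      refine Set.eq_of_subset_of_ncard_le hsub ?_
      rw [← Set.image_univ, ← Set.image_univ,
        Set.ncard_image_of_injective _ (wedgeIndex_strictMono m k i).injective,
        Set.ncard_image_of_injective _ (wedgeIndex_strictMono m k j).injective]
    obtain ⟨a, ha⟩ := this
    exact Matrix.det_eq_zero_of_row_eq_zero a fun b => by simp [ha b]

theorem wedge_one {m : ℕ} (k : ℕ) : wedge k (1 : Matrix (Fin m) (Fin m) ℝ) = 1 := by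
  rw [← Matrix.diagonal_one, wedge_diagonal]
  simp

theorem wedge_mem_unitary {m : ℕ} (k : ℕ) {V : Matrix (Fin m) (Fin m) ℝ}
    (hV : V ∈ unitary (Matrix (Fin m) (Fin m) ℝ)) :
    wedge k V ∈ unitary (Matrix (Fin (m.choose k)) (Fin (m.choose k)) ℝ) := by
  rw [Unitary.mem_iff] at hV ⊢
  simp only [Matrix.star_eq_conjTranspose, Matrix.conjTranspose_eq_transpose_of_trivial] at hV ⊢
  rw [← wedge_transpose, ← wedge_mul, ← wedge_mul, hV.1, hV.2, wedge_one]
  exact ⟨rfl, rfl⟩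

/-! ### Singular values and norms of compound matrices -/

theorem norm_eq_of_conj {m : ℕ} {V M D : Matrix (Fin m) (Fin m) ℝ}
    (hV : V ∈ unitary (Matrix (Fin m) (Fin m) ℝ)) (h : M * V = V * D) : ‖M‖ = ‖D‖ := by
  rw [← CStarRing.norm_mul_mem_unitary M hV, h, CStarRing.norm_mem_unitary_mul D hV]

theorem norm_transpose_mul_self {m : ℕ} (g : Matrix (Fin m) (Fin m) ℝ) :
    ‖g.transpose * g‖ = ‖g‖ ^ 2 := by
  rw [sq, ← Matrix.l2_opNorm_conjTranspose_mul_self, Matrix.conjTranspose_eq_transpose_of_trivial]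

theorem sv_nonneg {m : ℕ} (g : Matrix (Fin m) (Fin m) ℝ) (k : ℕ) : 0 ≤ sv g k :=
  LinearMap.singularValues_nonneg _ _

theorem sv_antitone {m : ℕ} (g : Matrix (Fin m) (Fin m) ℝ) : Antitone (sv g) := fun _ _ h =>
  LinearMap.singularValues_antitone _ (Nat.sub_le_sub_right h 1)

theorem sv_eq_zero {m : ℕ} (g : Matrix (Fin m) (Fin m) ℝ) {k : ℕ} (h : m < k) : sv g k = 0 :=
  LinearMap.singularValues_of_finrank_le _ (by simp; omega)

/-- The spectral theorem for `gᵀ g`, with eigenvalues the squares of the singular values of `g`. -/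
theorem exists_unitary_diagonal {m : ℕ} (g : Matrix (Fin m) (Fin m) ℝ) :
    ∃ V ∈ unitary (Matrix (Fin m) (Fin m) ℝ),
      g.transpose * g * V = V * Matrix.diagonal fun i : Fin m => sv g (i + 1) ^ 2 := by
  set L := Matrix.toEuclideanLin g
  have hS := L.isSymmetric_adjoint_comp_self
  have hn : Module.finrank ℝ (EuclideanSpace ℝ (Fin m)) = m := by simp
  set b := hS.eigenvectorBasis hn
  refine ⟨(EuclideanSpace.basisFun (Fin m) ℝ).toBasis.toMatrix b,
    OrthonormalBasis.toMatrix_orthonormalBasis_mem_unitary _ _, ?_⟩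
  ext i j
  have hb : (L.adjoint ∘ₗ L) (b j) = (sv g (j + 1) ^ 2) • b j := by
    have h1 := hS.apply_eigenvectorBasis hn j
    have h2 : sv g (j + 1) ^ 2 = hS.eigenvalues hn j := by
      simp only [sv, Nat.add_sub_cancel]
      exact L.sq_singularValues_fin hn j
    rw [h2]
    exact h1
  rw [← Matrix.toEuclideanLin_conjTranspose_eq_adjoint,
    Matrix.conjTranspose_eq_transpose_of_trivial] at hb
  have hb' := congrArg (fun v : EuclideanSpace ℝ (Fin m) => v i) hb
  have e1 : (g.transpose * g * (EuclideanSpace.basisFun (Fin m) ℝ).toBasis.toMatrix b) i j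
      = (g.transpose.mulVec (g.mulVec (b j))) i := by
    rw [Matrix.mulVec_mulVec]
    simp [Matrix.mul_apply, Matrix.mulVec, dotProduct, Module.Basis.toMatrix_apply]
  rw [e1, Matrix.mul_diagonal]
  simp only [Module.Basis.toMatrix_apply, OrthonormalBasis.coe_toBasis_repr_apply,
    EuclideanSpace.basisFun_repr]
  rw [mul_comm]
  exact hb'

theorem norm_diagonal_le {n : ℕ} {d : Fin n → ℝ} {c : ℝ} (hc : 0 ≤ c) (h : ∀ i, |d i| ≤ c) :
    ‖Matrix.diagonal d‖ ≤ c := by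
  rw [Matrix.l2_opNorm_diagonal]
  exact (pi_norm_le_iff_of_nonneg hc).2 h

theorem le_norm_diagonal {n : ℕ} (d : Fin n → ℝ) (i : Fin n) : |d i| ≤ ‖Matrix.diagonal d‖ := by
  rw [Matrix.l2_opNorm_diagonal]
  exact norm_le_pi_norm d i

/-- The product of the `k` largest singular values. -/
noncomputable def svProd {m : ℕ} (g : Matrix (Fin m) (Fin m) ℝ) (k : ℕ) : ℝ :=
  ∏ i ∈ Finset.range k, sv g (i + 1)

theorem svProd_zero {m : ℕ} (g : Matrix (Fin m) (Fin m) ℝ) : svProd g 0 = 1 := rfl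

theorem svProd_succ {m : ℕ} (g : Matrix (Fin m) (Fin m) ℝ) (k : ℕ) :
    svProd g (k + 1) = svProd g k * sv g (k + 1) := Finset.prod_range_succ _ _

theorem svProd_nonneg {m : ℕ} (g : Matrix (Fin m) (Fin m) ℝ) (k : ℕ) : 0 ≤ svProd g k :=
  Finset.prod_nonneg fun _ _ => sv_nonneg _ _

theorem wedge_conj {m : ℕ} (k : ℕ) {g V D : Matrix (Fin m) (Fin m) ℝ}
    (h : g.transpose * g * V = V * D) :
    (wedge k g).transpose * wedge k g * wedge k V = wedge k V * wedge k D := by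
  rw [← wedge_transpose, ← wedge_mul, ← wedge_mul, h, wedge_mul]

theorem le_of_strictMono {m k : ℕ} {f : Fin k → Fin m} (hf : StrictMono f) (a : Fin k) :
    (a : ℕ) ≤ f a := by
  obtain ⟨a, ha⟩ := a
  induction a with
  | zero => exact Nat.zero_le _
  | succ n ih =>
    have h1 := ih (by omega)
    have h2 : f ⟨n, by omega⟩ < f ⟨n + 1, ha⟩ := hf (by simp)
    have h3 : (f ⟨n, by omega⟩ : ℕ) < f ⟨n + 1, ha⟩ := h2
    simp only at h1 ⊢
    omega

theorem prod_sv_le_svProd {m k : ℕ} (g : Matrix (Fin m) (Fin m) ℝ) {f : Fin k → Fin m}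
    (hf : StrictMono f) : ∏ a, sv g (f a + 1) ≤ svProd g k := by
  rw [svProd, ← Fin.prod_univ_eq_prod_range (fun i => sv g (i + 1)) k]
  exact Finset.prod_le_prod (fun _ _ => sv_nonneg _ _) fun a _ =>
    sv_antitone g (by have := le_of_strictMono hf a; omega)

/-- `‖∧_k g‖ = s_1(g) ⋯ s_k(g)`. -/
theorem norm_wedge {m k : ℕ} (hk : k ≤ m) (g : Matrix (Fin m) (Fin m) ℝ) :
    ‖wedge k g‖ = svProd g k := by
  obtain ⟨V, hV, h⟩ := exists_unitary_diagonal g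
  have h1 := norm_eq_of_conj (wedge_mem_unitary k hV) (wedge_conj k h)
  rw [norm_transpose_mul_self, wedge_diagonal] at h1
  simp only [Finset.prod_pow] at h1
  refine (pow_left_inj₀ (norm_nonneg _) (svProd_nonneg _ _) two_ne_zero).1 ?_
  rw [h1]
  refine le_antisymm (norm_diagonal_le (sq_nonneg _) fun i => ?_) ?_
  · rw [abs_of_nonneg (sq_nonneg _)]
    exact pow_le_pow_left₀ (Finset.prod_nonneg fun _ _ => sv_nonneg _ _)
      (prod_sv_le_svProd g (wedgeIndex_strictMono m k i)) 2
  · obtain ⟨i, hi⟩ := exists_wedgeIndex_eq (Fin.strictMono_castLE hk)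
    have := le_norm_diagonal (fun i => (∏ a, sv g (wedgeIndex m k i a + 1)) ^ 2) i
    rw [abs_of_nonneg (sq_nonneg _)] at this
    refine le_trans (le_of_eq ?_) this
    rw [hi, svProd, ← Fin.prod_univ_eq_prod_range (fun i => sv g (i + 1)) k]
    simp

theorem norm_eq_sv_one {m : ℕ} (hm : 1 ≤ m) (g : Matrix (Fin m) (Fin m) ℝ) : ‖g‖ = sv g 1 := by
  obtain ⟨V, hV, h⟩ := exists_unitary_diagonal g
  have h1 := norm_eq_of_conj hV h
  rw [norm_transpose_mul_self] at h1
  refine (pow_left_inj₀ (norm_nonneg _) (sv_nonneg _ _) two_ne_zero).1 ?_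
  rw [h1]
  refine le_antisymm (norm_diagonal_le (sq_nonneg _) fun i => ?_) ?_
  · rw [abs_of_nonneg (sq_nonneg _)]
    exact pow_le_pow_left₀ (sv_nonneg _ _) (sv_antitone g (by omega)) 2
  · have := le_norm_diagonal (fun i : Fin m => sv g (i + 1) ^ 2) ⟨0, hm⟩
    rwa [abs_of_nonneg (sq_nonneg _)] at this

/-- Two different index sets of size `k`: one of them misses an element of `{1, …, k}`, so that the
corresponding product of singular values is at most `s_1 ⋯ s_{k-1} s_{k+1}`. -/
theorem prod_sv_le_of_ne {m k : ℕ} (g : Matrix (Fin m) (Fin m) ℝ) {f : Fin (k + 1) → Fin m}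
    (hf : StrictMono f) (hne : ∃ a, (f a : ℕ) ≠ a) :
    ∏ a, sv g (f a + 1) ≤ svProd g k * sv g (k + 2) := by
  obtain ⟨a, ha⟩ := hne
  have hlast : k + 1 ≤ f (Fin.last k) := by
    by_contra hc
    have key : ∀ j : ℕ, ∀ hj : j ≤ k, (f ⟨k - j, by omega⟩ : ℕ) ≤ k - j := by
      intro j
      induction j with
      | zero => intro _; exact Nat.lt_succ_iff.1 (not_le.1 hc)
      | succ j ih =>
        intro hj
        have h1 := ih (by omega)
        have h2 : f ⟨k - (j + 1), by omega⟩ < f ⟨k - j, by omega⟩ := hf (by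
          rw [Fin.mk_lt_mk]; omega)
        have h3 : (f ⟨k - (j + 1), by omega⟩ : ℕ) < f ⟨k - j, by omega⟩ := h2
        omega
    have h4 := key (k - a) (by omega)
    have h5 : (⟨k - (k - (a : ℕ)), by omega⟩ : Fin (k + 1)) = a := by ext; simp; omega
    rw [h5] at h4
    have := le_of_strictMono hf a
    omega
  rw [Fin.prod_univ_castSucc]
  refine mul_le_mul ?_ (sv_antitone g (by omega)) (sv_nonneg _ _) (svProd_nonneg _ _)
  exact prod_sv_le_svProd g (hf.comp Fin.strictMono_castSucc)

theorem prod_fin_two_le {x y a b : ℝ} (hx : 0 ≤ x) (hy : 0 ≤ y) (hxa : x ≤ a) (hya : y ≤ a)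
    (h : x ≤ b ∨ y ≤ b) : x * y ≤ a * b := by
  rcases h with h | h
  · rw [mul_comm]; exact mul_le_mul hya h hx (hy.trans hya)
  · exact mul_le_mul hxa h hy (hx.trans hxa)

/-- `‖∧_2 ∧_k g‖ ≤ s_1 ⋯ s_k · s_1 ⋯ s_{k-1} s_{k+1}`. -/
theorem norm_wedge_two_wedge_le {m k : ℕ} (g : Matrix (Fin m) (Fin m) ℝ) :
    ‖wedge 2 (wedge (k + 1) g)‖ ≤ svProd g (k + 1) * (svProd g k * sv g (k + 2)) := by
  obtain ⟨V, hV, h⟩ := exists_unitary_diagonal g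
  have h1 := norm_eq_of_conj (wedge_mem_unitary 2 (wedge_mem_unitary (k + 1) hV))
    (wedge_conj 2 (wedge_conj (k + 1) h))
  rw [norm_transpose_mul_self, wedge_diagonal, wedge_diagonal] at h1
  simp only [Finset.prod_pow] at h1
  have hc : 0 ≤ svProd g (k + 1) * (svProd g k * sv g (k + 2)) :=
    mul_nonneg (svProd_nonneg _ _) (mul_nonneg (svProd_nonneg _ _) (sv_nonneg _ _))
  refine (pow_le_pow_iff_left₀ (norm_nonneg _) hc two_ne_zero).1 ?_
  rw [h1]
  refine norm_diagonal_le (sq_nonneg _) fun i => ?_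
  rw [abs_of_nonneg (sq_nonneg _)]
  refine pow_le_pow_left₀
    (Finset.prod_nonneg fun _ _ => Finset.prod_nonneg fun _ _ => sv_nonneg _ _) ?_ 2
  rw [Fin.prod_univ_two]
  set p := wedgeIndex (m.choose (k + 1)) 2 i 0
  set q := wedgeIndex (m.choose (k + 1)) 2 i 1
  have hpq : p ≠ q := (wedgeIndex_strictMono _ 2 i (show (0 : Fin 2) < 1 by simp)).ne
  have h0 : ∀ r, 0 ≤ ∏ a, sv g (wedgeIndex m (k + 1) r a + 1) := fun r =>
    Finset.prod_nonneg fun _ _ => sv_nonneg _ _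
  refine prod_fin_two_le (h0 p) (h0 q) (prod_sv_le_svProd g (wedgeIndex_strictMono _ _ _))
    (prod_sv_le_svProd g (wedgeIndex_strictMono _ _ _)) ?_
  have : (∃ a, (wedgeIndex m (k + 1) p a : ℕ) ≠ a) ∨ ∃ a, (wedgeIndex m (k + 1) q a : ℕ) ≠ a := by
    by_contra! hcon
    exact hpq (wedgeIndex_injective _ _ (funext fun a => Fin.ext
      ((hcon.1 a).trans (hcon.2 a).symm)))
  exact this.imp (prod_sv_le_of_ne g (wedgeIndex_strictMono _ _ _))
    (prod_sv_le_of_ne g (wedgeIndex_strictMono _ _ _))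

/-! ### A three block avalanche principle -/

theorem norm_vecMulVec {n : ℕ} (x y : Fin n → ℝ) :
    ‖Matrix.vecMulVec x y‖ = ‖WithLp.toLp 2 x‖ * ‖WithLp.toLp 2 y‖ := by
  have h : Matrix.toEuclideanCLM (n := Fin n) (𝕜 := ℝ) (Matrix.vecMulVec x y)
      = (innerSL ℝ (WithLp.toLp 2 y)).smulRight (WithLp.toLp 2 x) := by
    ext z i
    simp [Matrix.vecMulVec_mulVec, PiLp.inner_apply, dotProduct, mul_comm]
  rw [← Matrix.l2_opNorm_toEuclideanCLM, h, ContinuousLinearMap.norm_smulRight_apply,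
    innerSL_apply_norm, mul_comm]

theorem norm_mul_norm_vecMulVec {n : ℕ} (a b : Matrix (Fin n) (Fin n) ℝ) (v w : Fin n → ℝ) :
    ‖Matrix.vecMulVec v w‖ * ‖a * Matrix.vecMulVec v w * b‖
      = ‖a * Matrix.vecMulVec v w‖ * ‖Matrix.vecMulVec v w * b‖ := by
  rw [Matrix.mul_vecMulVec, Matrix.vecMulVec_mul, Matrix.vecMulVec_mul]
  simp only [norm_vecMulVec]
  ring

/-- A matrix is, up to an error of norm `s_2(g)`, a matrix of rank one. -/
theorem exists_vecMulVec_add {m : ℕ} (hm : 1 ≤ m) (g : Matrix (Fin m) (Fin m) ℝ) :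
    ∃ (v w : Fin m → ℝ) (g' : Matrix (Fin m) (Fin m) ℝ), g = Matrix.vecMulVec v w + g' ∧
      ‖Matrix.vecMulVec v w‖ ≤ ‖g‖ ∧ ‖g'‖ ≤ sv g 2 := by
  obtain ⟨V, hV, h⟩ := exists_unitary_diagonal g
  have hV2 := (Unitary.mem_iff.1 hV)
  simp only [Matrix.star_eq_conjTranspose, Matrix.conjTranspose_eq_transpose_of_trivial] at hV2
  have hVt : V.transpose ∈ unitary (Matrix (Fin m) (Fin m) ℝ) := by
    have := Unitary.star_mem hV
    rwa [Matrix.star_eq_conjTranspose, Matrix.conjTranspose_eq_transpose_of_trivial] at this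
  set D := Matrix.diagonal fun i : Fin m => sv g (i + 1) ^ 2
  have hD : (g * V).transpose * (g * V) = D := by
    rw [Matrix.transpose_mul, Matrix.mul_assoc, ← Matrix.mul_assoc g.transpose, h,
      ← Matrix.mul_assoc, hV2.1, one_mul]
  set i0 : Fin m := ⟨0, hm⟩
  set E : Matrix (Fin m) (Fin m) ℝ := Matrix.diagonal (Pi.single i0 1)
  have hE : E = Matrix.vecMulVec (Pi.single i0 1) (Pi.single i0 1) := by
    ext i j
    simp only [E, Matrix.diagonal_apply, Matrix.vecMulVec_apply, Pi.single_apply]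
    split_ifs <;> simp_all
  have hR : g * V * E * V.transpose = Matrix.vecMulVec ((g * V).mulVec (Pi.single i0 1))
      (Matrix.vecMul (Pi.single i0 1) V.transpose) := by
    rw [hE, Matrix.mul_vecMulVec, Matrix.vecMulVec_mul]
  refine ⟨(g * V).mulVec (Pi.single i0 1), Matrix.vecMul (Pi.single i0 1) V.transpose,
    g * V * (1 - E) * V.transpose, ?_, ?_, ?_⟩
  · rw [← hR, mul_sub, sub_mul, mul_one, Matrix.mul_assoc g V V.transpose, hV2.2, mul_one]
    abel
  · rw [← hR, CStarRing.norm_mul_mem_unitary _ hVt]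
    have hE1 : ‖E‖ ≤ 1 := norm_diagonal_le zero_le_one fun i => by
      rw [Pi.single_apply]; split_ifs <;> simp
    calc ‖g * V * E‖ ≤ ‖g * V‖ * ‖E‖ := Matrix.l2_opNorm_mul _ _
      _ ≤ ‖g * V‖ * 1 := by gcongr
      _ = ‖g‖ := by rw [mul_one, CStarRing.norm_mul_mem_unitary _ hV]
  · rw [CStarRing.norm_mul_mem_unitary _ hVt]
    refine (pow_le_pow_iff_left₀ (norm_nonneg _) (sv_nonneg _ _) two_ne_zero).1 ?_
    have hE' : (1 - E) = Matrix.diagonal fun i => 1 - (Pi.single i0 1 : Fin m → ℝ) i := by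
      rw [← Matrix.diagonal_one]
      exact Matrix.diagonal_sub _ _
    rw [← norm_transpose_mul_self, Matrix.transpose_mul, Matrix.mul_assoc,
      ← Matrix.mul_assoc (g * V).transpose, hD, hE', Matrix.diagonal_transpose,
      Matrix.diagonal_mul_diagonal, Matrix.diagonal_mul_diagonal]
    refine norm_diagonal_le (sq_nonneg _) fun i => ?_
    by_cases hi : i = i0
    · subst hi
      simp [sq_nonneg]
    · have hi' : 1 ≤ (i : ℕ) := by
        by_contra hc
        exact hi (Fin.ext (by simp [i0]; omega))
      simp only [Pi.single_apply, hi, if_false, sub_zero, one_mul, mul_one]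
      rw [abs_of_nonneg (sq_nonneg _)]
      exact pow_le_pow_left₀ (sv_nonneg _ _) (sv_antitone g (by omega)) 2

/-- If the middle factor `g` is close to a matrix of rank one, then the norm is nearly
multiplicative: `‖a g b‖ ≈ ‖a g‖ ‖g b‖ / ‖g‖`. -/
theorem abs_norm_mul_sub_le {m : ℕ} (hm : 2 ≤ m) (a g b : Matrix (Fin m) (Fin m) ℝ) :
    |‖g‖ * ‖a * g * b‖ - ‖a * g‖ * ‖g * b‖| ≤ 4 * ‖wedge 2 g‖ * ‖a‖ * ‖b‖ := by
  obtain ⟨v, w, g', hg, hR, hg'⟩ := exists_vecMulVec_add (by omega : 1 ≤ m) g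
  have hw : ‖wedge 2 g‖ = ‖g‖ * sv g 2 := by
    rw [norm_wedge hm, norm_eq_sv_one (by omega)]
    simp [svProd, Finset.prod_range_succ]
  set R := Matrix.vecMulVec v w
  set s := sv g 2
  have hid := norm_mul_norm_vecMulVec a b v w
  change ‖R‖ * ‖a * R * b‖ = ‖a * R‖ * ‖R * b‖ at hid
  have near : ∀ {x y z : Matrix (Fin m) (Fin m) ℝ} {c : ℝ}, x = y + z → ‖z‖ ≤ c →
      |‖x‖ - ‖y‖| ≤ c := fun {x y z c} hx hz => by
    refine (abs_norm_sub_norm_le x y).trans ?_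
    rwa [hx, add_sub_cancel_left]
  have na := norm_nonneg a
  have nb := norm_nonneg b
  have ng := norm_nonneg g
  have ns : 0 ≤ s := sv_nonneg _ _
  have h1 : |‖g‖ - ‖R‖| ≤ s := near hg hg'
  have h2 : |‖a * g * b‖ - ‖a * R * b‖| ≤ ‖a‖ * s * ‖b‖ :=
    near (z := a * g' * b) (by conv_lhs => rw [hg, mul_add, add_mul]) ((Matrix.l2_opNorm_mul _ _).trans
      (mul_le_mul_of_nonneg_right ((Matrix.l2_opNorm_mul _ _).trans (by gcongr)) nb))
  have h3 : |‖a * g‖ - ‖a * R‖| ≤ ‖a‖ * s :=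
    near (z := a * g') (by conv_lhs => rw [hg, mul_add]) ((Matrix.l2_opNorm_mul _ _).trans (by gcongr))
  have h4 : |‖g * b‖ - ‖R * b‖| ≤ s * ‖b‖ :=
    near (z := g' * b) (by conv_lhs => rw [hg, add_mul]) ((Matrix.l2_opNorm_mul _ _).trans (by gcongr))
  have h5 : ‖a * R * b‖ ≤ ‖a‖ * ‖g‖ * ‖b‖ := (Matrix.l2_opNorm_mul _ _).trans
    (mul_le_mul_of_nonneg_right ((Matrix.l2_opNorm_mul _ _).trans (by gcongr)) nb)
  have h6 : ‖a * R‖ ≤ ‖a‖ * ‖g‖ := (Matrix.l2_opNorm_mul _ _).trans (by gcongr)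
  have h7 : ‖g * b‖ ≤ ‖g‖ * ‖b‖ := Matrix.l2_opNorm_mul _ _
  have e : ‖g‖ * ‖a * g * b‖ - ‖a * g‖ * ‖g * b‖
      = ‖g‖ * (‖a * g * b‖ - ‖a * R * b‖) + (‖g‖ - ‖R‖) * ‖a * R * b‖
        - (‖a * g‖ - ‖a * R‖) * ‖g * b‖ - ‖a * R‖ * (‖g * b‖ - ‖R * b‖) := by
    linear_combination hid
  have t1 : |‖g‖ * (‖a * g * b‖ - ‖a * R * b‖)| ≤ ‖g‖ * (‖a‖ * s * ‖b‖) := by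
    rw [abs_mul, abs_of_nonneg ng]; gcongr
  have t2 : |(‖g‖ - ‖R‖) * ‖a * R * b‖| ≤ s * (‖a‖ * ‖g‖ * ‖b‖) := by
    rw [abs_mul, abs_of_nonneg (norm_nonneg (a * R * b))]; gcongr
  have t3 : |(‖a * g‖ - ‖a * R‖) * ‖g * b‖| ≤ ‖a‖ * s * (‖g‖ * ‖b‖) := by
    rw [abs_mul, abs_of_nonneg (norm_nonneg (g * b))]; gcongr
  have t4 : |‖a * R‖ * (‖g * b‖ - ‖R * b‖)| ≤ ‖a‖ * ‖g‖ * (s * ‖b‖) := by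
    rw [abs_mul, abs_of_nonneg (norm_nonneg (a * R))]; gcongr
  rw [e, hw]
  rw [abs_le] at t1 t2 t3 t4 ⊢
  constructor <;> linarith [t1.1, t1.2, t2.1, t2.2, t3.1, t3.2, t4.1, t4.2]

/-! ### Extended integrals of logarithms -/

section LogIntegral

variable {X : Type*} [MeasurableSpace X] {μ : Measure X}

theorem eintegral_coe {f : X → ℝ} (hf : Integrable f μ) :
    eintegral μ (fun x => (f x : EReal)) = ((∫ x, f x ∂μ : ℝ) : EReal) := by
  have h2 : ∀ {g : X → ℝ}, Integrable g μ → ∫⁻ x, ENNReal.ofReal (g x) ∂μ ≠ ∞ := fun hg =>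
    ((lintegral_mono fun x => Real.ofReal_le_enorm _).trans_lt hg.2).ne
  have e : ∀ {a : ℝ≥0∞}, a ≠ ∞ → (a : EReal) = ((a.toReal : ℝ) : EReal) := fun ha =>
    (EReal.coe_ennreal_toReal ha).symm
  rw [integral_eq_lintegral_pos_part_sub_lintegral_neg_part hf, EReal.coe_sub, eintegral]
  simp only [← EReal.coe_neg, EReal.real_coe_toENNReal]
  rw [← e (h2 hf), ← e (h2 (g := fun x => -f x) hf.neg)]

theorem eintegral_congr {f g : X → EReal} (h : ∀ᵐ x ∂μ, f x = g x) :
    eintegral μ f = eintegral μ g := by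
  have h1 : ∀ᵐ x ∂μ, (f x).toENNReal = (g x).toENNReal := h.mono fun x hx => by rw [hx]
  have h2 : ∀ᵐ x ∂μ, (-f x).toENNReal = (-g x).toENNReal := h.mono fun x hx => by rw [hx]
  rw [eintegral, eintegral, lintegral_congr_ae h1, lintegral_congr_ae h2]

theorem eintegral_mono {f g : X → EReal} (h : ∀ᵐ x ∂μ, f x ≤ g x) :
    eintegral μ f ≤ eintegral μ g :=
  EReal.sub_le_sub
    (EReal.coe_ennreal_le_coe_ennreal_iff.2 (lintegral_mono_ae (h.mono fun _ hx =>
      EReal.toENNReal_le_toENNReal hx)))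
    (EReal.coe_ennreal_le_coe_ennreal_iff.2 (lintegral_mono_ae (h.mono fun _ hx =>
      EReal.toENNReal_le_toENNReal (EReal.neg_le_neg_iff.2 hx))))

/-- `log r` is an integrable real valued function; in particular `r > 0` almost everywhere. -/
structure LogIntegrable (μ : Measure X) (r : X → ℝ) : Prop where
  pos : ∀ᵐ x ∂μ, 0 < r x
  integrable : Integrable (fun x => Real.log (r x)) μ

theorem elog_of_pos {r : ℝ} (hr : 0 < r) : elog r = (Real.log r : EReal) :=
  ENNReal.log_ofReal_of_pos hr

theorem elog_of_nonpos {r : ℝ} (hr : r ≤ 0) : elog r = ⊥ := by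
  rw [elog, ENNReal.log_ofReal, if_pos hr]

theorem elog_mono {r s : ℝ} (h : r ≤ s) : elog r ≤ elog s :=
  ENNReal.log_le_log (ENNReal.ofReal_le_ofReal h)

theorem elog_div_of_pos {r : ℝ} (hr : 0 < r) (n : ℕ) :
    elog r / (n : EReal) = ((Real.log r / n : ℝ) : EReal) := by
  rw [elog_of_pos hr, EReal.coe_div, EReal.coe_natCast]

theorem elog_div_of_nonpos {r : ℝ} (hr : r ≤ 0) {n : ℕ} (hn : 1 ≤ n) :
    elog r / (n : EReal) = ⊥ := by
  rw [elog_of_nonpos hr, EReal.bot_div_of_pos_ne_top (by exact_mod_cast hn) (EReal.natCast_ne_top n)]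

theorem elog_div_mono {r s : ℝ} (h : r ≤ s) (n : ℕ) : elog r / (n : EReal) ≤ elog s / (n : EReal) :=
  EReal.div_le_div_right_of_nonneg (by positivity) (elog_mono h)

theorem LogIntegrable.eintegral_eq {r : X → ℝ} (h : LogIntegrable μ r) (n : ℕ) :
    eintegral μ (fun x => elog (r x) / (n : EReal))
      = (((∫ x, Real.log (r x) ∂μ) / n : ℝ) : EReal) := by
  rw [← integral_div, ← eintegral_coe (h.integrable.div_const _)]
  exact eintegral_congr (h.pos.mono fun x hx => elog_div_of_pos hx n)

variable [IsProbabilityMeasure μ]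

theorem eintegral_eq_bot {r : X → ℝ} {C : ℝ} (hm : Measurable r) (hC : ∀ᵐ x ∂μ, r x ≤ C)
    (h : ¬ LogIntegrable μ r) {n : ℕ} (hn : 1 ≤ n) :
    eintegral μ (fun x => elog (r x) / (n : EReal)) = ⊥ := by
  have hn' : (0 : ℝ) < n := by exact_mod_cast hn
  by_contra hc
  have hfin : ∫⁻ x, (-(elog (r x) / (n : EReal))).toENNReal ∂μ ≠ ∞ := fun hinf => hc (by
    rw [eintegral, hinf, EReal.coe_ennreal_top, EReal.sub_top])
  have hmeas : Measurable fun x => (-(elog (r x) / (n : EReal))).toENNReal := by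
    have : Measurable fun s : ℝ => (-(elog s / (n : EReal))).toENNReal := by
      refine Antitone.measurable fun s t hst => ?_
      exact EReal.toENNReal_le_toENNReal (EReal.neg_le_neg_iff.2 (elog_div_mono hst n))
    exact this.comp hm
  have hpos : ∀ᵐ x ∂μ, 0 < r x := by
    filter_upwards [ae_lt_top hmeas hfin] with x hx
    by_contra hr
    rw [elog_div_of_nonpos (not_lt.1 hr) hn] at hx
    simp at hx
  refine h ⟨hpos, ?_⟩
  have hlog : Measurable fun x => Real.log (r x) := Real.measurable_log.comp hm
  -- the negative part has a finite integral by `hfin`, the positive part is bounded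
  have hint : Integrable (fun x => max (-(Real.log (r x) / n)) 0) μ := by
    refine ⟨(((hlog.div_const _).neg).max measurable_const).aestronglyMeasurable, ?_⟩
    refine (hasFiniteIntegral_iff_ofReal (ae_of_all _ fun x =>
      (le_max_right (-(Real.log (r x) / n)) 0 : (0 : ℝ) ≤ _))).2 ?_
    refine lt_of_le_of_lt (lintegral_mono_ae ?_) hfin.lt_top
    filter_upwards [hpos] with x hx
    rw [elog_div_of_pos hx, ← EReal.coe_neg, EReal.real_coe_toENNReal, ENNReal.ofReal_max]
    simp
  have hint2 : Integrable (fun x => n * max (-(Real.log (r x) / n)) 0 + |Real.log (max C 1)|) μ :=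
    (hint.const_mul _).add (integrable_const _)
  refine hint2.mono' hlog.aestronglyMeasurable ?_
  filter_upwards [hpos, hC] with x hx hxC
  have h1 : Real.log (r x) ≤ Real.log (max C 1) := Real.log_le_log hx (hxC.trans (le_max_left _ _))
  have h2 : -(Real.log (r x)) ≤ n * max (-(Real.log (r x) / n)) 0 := by
    calc -(Real.log (r x)) = n * (-(Real.log (r x) / n)) := by field_simp
      _ ≤ _ := by gcongr; exact le_max_left _ _
  have h3 : 0 ≤ n * max (-(Real.log (r x) / n)) 0 := by positivity
  rw [Real.norm_eq_abs, abs_le]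
  constructor
  · linarith [abs_nonneg (Real.log (max C 1))]
  · linarith [le_abs_self (Real.log (max C 1))]

/-! ### Truncated logarithms -/

theorem log_max_mem {r t C : ℝ} (ht : 0 < t) (hr : r ≤ C) :
    Real.log t ≤ Real.log (max r t) ∧ Real.log (max r t) ≤ Real.log (max C t) :=
  ⟨Real.log_le_log ht (le_max_right _ _),
    Real.log_le_log (lt_max_of_lt_right ht) (max_le_max_right _ hr)⟩

theorem integrable_log_max {r : X → ℝ} {C t : ℝ} (hm : Measurable r) (hC : ∀ᵐ x ∂μ, r x ≤ C)
    (ht : 0 < t) : Integrable (fun x => Real.log (max (r x) t)) μ := by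
  refine Integrable.of_bound (C := max |Real.log t| |Real.log (max C t)|)
    (Real.measurable_log.comp (hm.max measurable_const)).aestronglyMeasurable ?_
  filter_upwards [hC] with x hx
  obtain ⟨h1, h2⟩ := log_max_mem ht hx
  exact abs_le_max_abs_abs h1 h2

theorem LogIntegrable.integral_le {r : X → ℝ} {C t : ℝ} (h : LogIntegrable μ r)
    (hm : Measurable r) (hC : ∀ᵐ x ∂μ, r x ≤ C) (ht : 0 < t) :
    ∫ x, Real.log (r x) ∂μ ≤ ∫ x, Real.log (max (r x) t) ∂μ :=
  integral_mono_ae h.integrable (integrable_log_max hm hC ht)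
    (h.pos.mono fun _ hx => Real.log_le_log hx (le_max_left _ _))

/-- Monotone convergence: if the truncated integrals `∫ log max(r, t)` are bounded below, then
`log r` is integrable. -/
theorem logIntegrable_of_le {r : X → ℝ} {C c : ℝ} (hm : Measurable r) (h0 : ∀ x, 0 ≤ r x)
    (hC : ∀ᵐ x ∂μ, r x ≤ C) (h : ∀ t, 0 < t → c ≤ ∫ x, Real.log (max (r x) t) ∂μ) :
    LogIntegrable μ r ∧ c ≤ ∫ x, Real.log (r x) ∂μ := by
  set M := Real.log (max C 1)
  set u : ℕ → ℝ := fun j => 1 / ((j : ℝ) + 1)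
  have hu : ∀ j, 0 < u j := fun j => by positivity
  have hu1 : ∀ j, u j ≤ 1 := fun j => by
    rw [div_le_one (by positivity)]; linarith [(Nat.cast_nonneg j : (0 : ℝ) ≤ j)]
  have huanti : Antitone u := fun i j hij => by
    simp only [u]; gcongr
  have hle : ∀ j, ∀ᵐ x ∂μ, Real.log (max (r x) (u j)) ≤ M := fun j => by
    filter_upwards [hC] with x hx
    exact Real.log_le_log (lt_max_of_lt_right (hu j)) (max_le_max hx (hu1 j))
  set g : ℕ → X → ℝ≥0∞ := fun j x => ENNReal.ofReal (M - Real.log (max (r x) (u j)))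
  have hgm : ∀ j, Measurable (g j) := fun j =>
    (measurable_const.sub (Real.measurable_log.comp (hm.max measurable_const))).ennreal_ofReal
  have hgmono : Monotone g := fun i j hij x => ENNReal.ofReal_le_ofReal (by
    have : Real.log (max (r x) (u j)) ≤ Real.log (max (r x) (u i)) :=
      Real.log_le_log (lt_max_of_lt_right (hu j)) (max_le_max_left _ (huanti hij))
    linarith)
  have hcM : c ≤ M := (h (u 0) (hu 0)).trans (by
    calc ∫ x, Real.log (max (r x) (u 0)) ∂μ ≤ ∫ _, M ∂μ :=
          integral_mono_ae (integrable_log_max hm hC (hu 0)) (integrable_const _) (hle 0)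
      _ = M := by simp)
  have hgint : ∀ j, ∫⁻ x, g j x ∂μ ≤ ENNReal.ofReal (M - c) := fun j => by
    have hi : Integrable (fun x => M - Real.log (max (r x) (u j))) μ :=
      (integrable_const _).sub (integrable_log_max hm hC (hu j))
    rw [← ofReal_integral_eq_lintegral_ofReal hi ((hle j).mono fun x hx => sub_nonneg.2 hx)]
    refine ENNReal.ofReal_le_ofReal ?_
    rw [integral_sub (integrable_const _) (integrable_log_max hm hC (hu j))]
    have := h (u j) (hu j)
    simp only [integral_const, probReal_univ, one_smul]
    linarith
  have hsup : ∫⁻ x, ⨆ j, g j x ∂μ ≤ ENNReal.ofReal (M - c) := by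
    rw [lintegral_iSup hgm hgmono]
    exact iSup_le hgint
  have hfin : ∀ᵐ x ∂μ, ⨆ j, g j x < ∞ :=
    ae_lt_top (Measurable.iSup hgm) (hsup.trans_lt ENNReal.ofReal_lt_top).ne
  have hpos : ∀ᵐ x ∂μ, 0 < r x := by
    filter_upwards [hfin] with x hx
    refine lt_of_le_of_ne (h0 x) fun hr => ?_
    have hunb : Tendsto (fun j => g j x) atTop (𝓝 ∞) := by
      refine ENNReal.tendsto_ofReal_atTop.comp ?_
      have h1 : ∀ j, M - Real.log (max (r x) (u j)) = M + Real.log ((j : ℝ) + 1) := fun j => by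
        rw [← hr, max_eq_right (hu j).le, Real.log_div one_ne_zero (by positivity), Real.log_one]
        ring
      simp only [h1]
      refine tendsto_atTop_add_const_left _ _ (Real.tendsto_log_atTop.comp ?_)
      exact tendsto_atTop_add_const_right _ _ tendsto_natCast_atTop_atTop
    exact absurd (le_of_tendsto' hunb fun j => le_iSup (fun j => g j x) j) (not_le.2 hx)
  have hbound : ∀ᵐ x ∂μ, ENNReal.ofReal (M - Real.log (r x)) ≤ ⨆ j, g j x := by
    filter_upwards [hpos] with x hx
    obtain ⟨j, hj⟩ := exists_nat_one_div_lt hx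
    refine le_trans ?_ (le_iSup (fun j => g j x) j)
    simp only [g]
    rw [max_eq_left hj.le]
  have hlogm : Measurable fun x => Real.log (r x) := Real.measurable_log.comp hm
  have hnn : ∀ᵐ x ∂μ, 0 ≤ M - Real.log (r x) := by
    filter_upwards [hpos, hC] with x hx hxC
    exact sub_nonneg.2 (Real.log_le_log hx (hxC.trans (le_max_left _ _)))
  have hlint : ∫⁻ x, ENNReal.ofReal (M - Real.log (r x)) ∂μ ≤ ENNReal.ofReal (M - c) :=
    (lintegral_mono_ae hbound).trans hsup
  have hint : Integrable (fun x => M - Real.log (r x)) μ :=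
    ⟨(measurable_const.sub hlogm).aestronglyMeasurable,
      (hasFiniteIntegral_iff_ofReal hnn).2 (hlint.trans_lt ENNReal.ofReal_lt_top)⟩
  have hint' : Integrable (fun x => Real.log (r x)) μ := by
    refine ((integrable_const M).sub hint).congr (ae_of_all _ fun x => ?_)
    simp
  refine ⟨⟨hpos, hint'⟩, ?_⟩
  rw [← ofReal_integral_eq_lintegral_ofReal hint hnn,
    ENNReal.ofReal_le_ofReal_iff (sub_nonneg.2 hcM), integral_sub (integrable_const _) hint'] at hlint
  simp at hlint
  linarith

theorem exists_integral_log_max_lt {r : X → ℝ} {C : ℝ} (hm : Measurable r) (h0 : ∀ x, 0 ≤ r x)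
    (hC : ∀ᵐ x ∂μ, r x ≤ C) {n : ℕ} (hn : 1 ≤ n) {c : ℝ}
    (h : eintegral μ (fun x => elog (r x) / (n : EReal)) < c) :
    ∃ t, 0 < t ∧ t ≤ 1 ∧ (∫ x, Real.log (max (r x) t) ∂μ) / n < c := by
  have hn' : (0 : ℝ) < n := by exact_mod_cast hn
  by_contra! hcon
  have key := logIntegrable_of_le (μ := μ) (c := n * c) hm h0 hC fun t ht => by
    have h1 := hcon (min t 1) (lt_min ht one_pos) (min_le_right _ _)
    rw [le_div_iff₀ hn'] at h1
    have h2 : ∫ x, Real.log (max (r x) (min t 1)) ∂μ ≤ ∫ x, Real.log (max (r x) t) ∂μ :=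
      integral_mono_ae (integrable_log_max hm hC (lt_min ht one_pos)) (integrable_log_max hm hC ht)
        (ae_of_all _ fun x => Real.log_le_log (lt_max_of_lt_right (lt_min ht one_pos))
          (max_le_max_left _ (min_le_left _ _)))
    linarith
  rw [key.1.eintegral_eq, EReal.coe_lt_coe_iff, div_lt_iff₀ hn'] at h
  linarith [key.2]

end LogIntegral

/-! ### Iterates of a bounded cocycle -/

section Iterates

variable {X : Type*} {T : X → X} {m : ℕ}

theorem norm_one_le (m : ℕ) : ‖(1 : Matrix (Fin m) (Fin m) ℝ)‖ ≤ 1 := by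
  rw [← Matrix.diagonal_one]
  exact norm_diagonal_le zero_le_one fun _ => by simp

theorem iter_add (A : X → Matrix (Fin m) (Fin m) ℝ) (k n : ℕ) (x : X) :
    iter T A (k + n) x = iter T A k (T^[n] x) * iter T A n x := by
  induction k with
  | zero => simp [iter]
  | succ k ih =>
    rw [Nat.succ_add, iter, ih, iter, ← Function.iterate_add_apply, Matrix.mul_assoc]

theorem iter_one (A : X → Matrix (Fin m) (Fin m) ℝ) (x : X) : iter T A 1 x = A x := by
  simp [iter]

theorem iter_wedge (k : ℕ) (A : X → Matrix (Fin m) (Fin m) ℝ) (n : ℕ) (x : X) :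
    iter T (fun x => wedge k (A x)) n x = wedge k (iter T A n x) := by
  induction n with
  | zero => simp [iter, wedge_one]
  | succ n ih => rw [iter, ih, iter, wedge_mul]

theorem norm_iter_add_le (A : X → Matrix (Fin m) (Fin m) ℝ) (k n : ℕ) (x : X) :
    ‖iter T A (k + n) x‖ ≤ ‖iter T A k (T^[n] x)‖ * ‖iter T A n x‖ := by
  rw [iter_add]
  exact Matrix.l2_opNorm_mul _ _

variable {A B : X → Matrix (Fin m) (Fin m) ℝ} {C : ℝ} {x : X}

theorem norm_iter_le_pow (h : ∀ j, ‖A (T^[j] x)‖ ≤ C) (n : ℕ) : ‖iter T A n x‖ ≤ C ^ n := by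
  induction n with
  | zero => simpa [iter] using norm_one_le m
  | succ n ih =>
    rw [iter, pow_succ']
    exact (Matrix.l2_opNorm_mul _ _).trans
      (mul_le_mul (h n) ih (norm_nonneg _) ((norm_nonneg _).trans (h n)))

theorem norm_iter_sub_le {e : ℝ} (hC : 1 ≤ C) (hA : ∀ j, ‖A (T^[j] x)‖ ≤ C)
    (hB : ∀ j, ‖B (T^[j] x)‖ ≤ C) (h : ∀ j, ‖B (T^[j] x) - A (T^[j] x)‖ ≤ e) (n : ℕ) :
    ‖iter T B n x - iter T A n x‖ ≤ n * C ^ n * e := by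
  have he : 0 ≤ e := (norm_nonneg _).trans (h 0)
  have hC0 : 0 ≤ C := zero_le_one.trans hC
  induction n with
  | zero => simp [iter]
  | succ n ih =>
    have e1 : iter T B (n + 1) x - iter T A (n + 1) x
        = B (T^[n] x) * (iter T B n x - iter T A n x)
          + (B (T^[n] x) - A (T^[n] x)) * iter T A n x := by
      simp only [iter]; noncomm_ring
    rw [e1]
    calc _ ≤ ‖B (T^[n] x)‖ * ‖iter T B n x - iter T A n x‖
          + ‖B (T^[n] x) - A (T^[n] x)‖ * ‖iter T A n x‖ :=
          (norm_add_le _ _).trans (add_le_add (Matrix.l2_opNorm_mul _ _) (Matrix.l2_opNorm_mul _ _))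
      _ ≤ C * (n * C ^ n * e) + e * C ^ n :=
          add_le_add (mul_le_mul (hB n) ih (norm_nonneg _) hC0)
            (mul_le_mul (h n) (norm_iter_le_pow hA n) (norm_nonneg _) he)
      _ ≤ C * (n * C ^ n * e) + e * C ^ (n + 1) := by gcongr; omega
      _ = _ := by push_cast; ring

/-- Writing the product of `n + q` factors in `q` different ways as a product of blocks of length
`q`, one for each residue class of starting points, bounds it by a geometric mean over blocks. -/
theorem norm_iter_pow_le (hC : 1 ≤ C) (hA : ∀ j, ‖A (T^[j] x)‖ ≤ C) (n : ℕ) {q : ℕ}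
    (hq : 1 ≤ q) : ‖iter T A (n + q) x‖ ^ q
      ≤ C ^ (2 * q * q) * ∏ j ∈ Finset.range n, ‖iter T A q (T^[j] x)‖ := by
  have hC0 : 0 ≤ C := zero_le_one.trans hC
  have hshift : ∀ i j, ‖A (T^[j] (T^[i] x))‖ ≤ C := fun i j => by
    rw [← Function.iterate_add_apply]; exact hA _
  have h1 : ∏ i ∈ Finset.range q, ‖iter T A (n + i) x‖
      ≤ C ^ (q * q) * ∏ j ∈ Finset.range n, ‖iter T A q (T^[j] x)‖ := by
    induction n with
    | zero =>
      simp only [Finset.range_zero, Finset.prod_empty, mul_one, zero_add]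
      calc ∏ i ∈ Finset.range q, ‖iter T A i x‖ ≤ ∏ _i ∈ Finset.range q, C ^ q :=
            Finset.prod_le_prod (fun _ _ => norm_nonneg _) fun i hi =>
              (norm_iter_le_pow hA i).trans
                (pow_le_pow_right₀ hC (Finset.mem_range.1 hi).le)
        _ = C ^ (q * q) := by simp [pow_mul]
    | succ n ih =>
      rw [Finset.prod_range_succ]
      obtain ⟨p, rfl⟩ : ∃ p, q = p + 1 := ⟨q - 1, by omega⟩
      have h2 : ∏ i ∈ Finset.range (p + 1), ‖iter T A (n + 1 + i) x‖
          ≤ ‖iter T A (p + 1) (T^[n] x)‖ * ∏ i ∈ Finset.range (p + 1), ‖iter T A (n + i) x‖ := by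
        rw [Finset.prod_range_succ, Finset.prod_range_succ']
        have h3 : ‖iter T A (n + 1 + p) x‖
            ≤ ‖iter T A (p + 1) (T^[n] x)‖ * ‖iter T A (n + 0) x‖ := by
          have := norm_iter_add_le (T := T) A (p + 1) n x
          rwa [show p + 1 + n = n + 1 + p by ring] at this
        have h4 : ∀ i, n + 1 + i = n + (i + 1) := fun i => by ring
        simp only [h4]
        simp only [h4] at h3
        calc _ ≤ (∏ i ∈ Finset.range p, ‖iter T A (n + (i + 1)) x‖) * _ :=
              mul_le_mul_of_nonneg_left h3 (Finset.prod_nonneg fun _ _ => norm_nonneg _)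
          _ = _ := by ring
      calc _ ≤ _ := h2
        _ ≤ ‖iter T A (p + 1) (T^[n] x)‖ * _ := mul_le_mul_of_nonneg_left ih (norm_nonneg _)
        _ = _ := by ring
  have h5 : ∀ i ∈ Finset.range q, ‖iter T A (n + q) x‖ ≤ C ^ q * ‖iter T A (n + i) x‖ := by
    intro i hi
    have hi' := Finset.mem_range.1 hi
    have := norm_iter_add_le (T := T) A (q - i) (n + i) x
    rw [show q - i + (n + i) = n + q by omega] at this
    refine this.trans (mul_le_mul_of_nonneg_right ?_ (norm_nonneg _))
    exact (norm_iter_le_pow (hshift (n + i)) _).trans (pow_le_pow_right₀ hC (by omega))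
  calc ‖iter T A (n + q) x‖ ^ q = ∏ _i ∈ Finset.range q, ‖iter T A (n + q) x‖ := by simp
    _ ≤ ∏ i ∈ Finset.range q, C ^ q * ‖iter T A (n + i) x‖ :=
        Finset.prod_le_prod (fun _ _ => norm_nonneg _) h5
    _ = C ^ (q * q) * ∏ i ∈ Finset.range q, ‖iter T A (n + i) x‖ := by
        rw [Finset.prod_mul_distrib]; simp [pow_mul]
    _ ≤ C ^ (q * q) * (C ^ (q * q) * ∏ j ∈ Finset.range n, ‖iter T A q (T^[j] x)‖) := by gcongr
    _ = _ := by rw [← mul_assoc, ← pow_add]; ring_nf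

/-- The bound of `norm_iter_pow_le` in logarithmic form. The truncation at `t` keeps the logarithms of
the blocks finite and makes them stable under perturbation. -/
theorem log_norm_iter_le (hC : 1 ≤ C) (hA : ∀ j, ‖A (T^[j] x)‖ ≤ C) {n q : ℕ} (hq : 1 ≤ q)
    (hqn : q ≤ n) {t : ℝ} (ht : 0 < t) (hn : 0 < ‖iter T A n x‖) :
    Real.log ‖iter T A n x‖ ≤ 2 * q * Real.log C - Real.log t
      + (∑ j ∈ Finset.range n, Real.log (max ‖iter T A q (T^[j] x)‖ t)) / q := by
  obtain ⟨k, rfl⟩ : ∃ k, n = k + q := ⟨n - q, by omega⟩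
  have hC0 : 0 < C := zero_lt_one.trans_le hC
  have hq' : (0 : ℝ) < q := by exact_mod_cast hq
  have h1 := norm_iter_pow_le hC hA k hq
  have h2 : ∏ j ∈ Finset.range k, ‖iter T A q (T^[j] x)‖
      ≤ ∏ j ∈ Finset.range k, max ‖iter T A q (T^[j] x)‖ t :=
    Finset.prod_le_prod (fun _ _ => norm_nonneg _) fun _ _ => le_max_left _ _
  have hpos : ∀ j, 0 < max ‖iter T A q (T^[j] x)‖ t := fun j => lt_max_of_lt_right ht
  have h3 := Real.log_le_log (by positivity) (h1.trans (mul_le_mul_of_nonneg_left h2 (by positivity)))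
  rw [Real.log_pow, Real.log_mul (by positivity) (Finset.prod_pos fun j _ => hpos j).ne',
    Real.log_pow, Real.log_prod fun j _ => (hpos j).ne'] at h3
  have h4 : q * Real.log t ≤ ∑ j ∈ Finset.range q,
      Real.log (max ‖iter T A q (T^[k + j] x)‖ t) := by
    calc q * Real.log t = ∑ _j ∈ Finset.range q, Real.log t := by simp
      _ ≤ _ := Finset.sum_le_sum fun j _ => Real.log_le_log ht (le_max_right _ _)
  rw [Finset.sum_range_add, add_div]
  set S := ∑ j ∈ Finset.range k, Real.log (max ‖iter T A q (T^[j] x)‖ t)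
  set S' := ∑ j ∈ Finset.range q, Real.log (max ‖iter T A q (T^[k + j] x)‖ t)
  have h5 : Real.log t ≤ S' / q := by rw [le_div_iff₀ hq']; linarith
  have h6 : Real.log ‖iter T A (k + q) x‖ ≤ 2 * q * Real.log C + S / q := by
    have : Real.log ‖iter T A (k + q) x‖ * q ≤ (2 * q * Real.log C + S / q) * q := by
      have e : (2 * q * Real.log C + S / q) * q = 2 * q * q * Real.log C + S := by
        field_simp
      rw [e]; push_cast at h3; linarith
    exact le_of_mul_le_mul_right this hq'
  linarith

end Iterates

/-! ### Finite scale exponents -/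

section Measure

variable {X : Type*} [MeasurableSpace X] {μ : Measure X} {T : X → X} {m : ℕ}

/-- A measurable and essentially bounded matrix valued function. -/
structure IsBddCocycle (μ : Measure X) (A : X → Matrix (Fin m) (Fin m) ℝ) : Prop where
  measurable : ∀ i j, Measurable fun x => A x i j
  bdd : ∃ C, 1 ≤ C ∧ ∀ᵐ x ∂μ, ‖A x‖ ≤ C

theorem measurable_norm_of_entries {A : X → Matrix (Fin m) (Fin m) ℝ}
    (h : ∀ i j, Measurable fun x => A x i j) : Measurable fun x => ‖A x‖ := by
  have hc : Continuous fun f : Fin m → Fin m → ℝ => ‖(Matrix.of f)‖ :=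
    continuous_norm.comp (continuous_id : Continuous fun f : Fin m → Fin m → ℝ => f)
  exact hc.measurable.comp (measurable_pi_lambda _ fun i => measurable_pi_lambda _ fun j => h i j)

theorem measurable_iter (hT : Measurable T) {A : X → Matrix (Fin m) (Fin m) ℝ}
    (h : ∀ i j, Measurable fun x => A x i j) (n : ℕ) :
    ∀ i j, Measurable fun x => iter T A n x i j := by
  induction n with
  | zero => exact fun i j => measurable_const
  | succ n ih =>
    intro i j
    simp only [iter, Matrix.mul_apply]
    exact Finset.measurable_sum _ fun c _ => ((h i c).comp (hT.iterate n)).mul (ih c j)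

theorem ae_forall_iterate (hT : MeasurePreserving T μ μ) {p : X → Prop} (h : ∀ᵐ x ∂μ, p x) :
    ∀ᵐ x ∂μ, ∀ j, p (T^[j] x) :=
  ae_all_iff.2 fun j => (hT.iterate j).quasiMeasurePreserving.ae h

theorem integral_comp_iterate (hT : MeasurePreserving T μ μ) {f : X → ℝ}
    (hf : AEStronglyMeasurable f μ) (j : ℕ) : ∫ x, f (T^[j] x) ∂μ = ∫ x, f x ∂μ := by
  have h := hT.iterate j
  have := integral_map (μ := μ) h.measurable.aemeasurable (f := f) (by rwa [h.map_eq])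
  rw [h.map_eq] at this
  exact this.symm

variable {A B : X → Matrix (Fin m) (Fin m) ℝ}

theorem IsBddCocycle.measurable_norm_iter (hA : IsBddCocycle μ A) (hT : MeasurePreserving T μ μ)
    (n : ℕ) : Measurable fun x => ‖iter T A n x‖ :=
  measurable_norm_of_entries (measurable_iter hT.measurable hA.measurable n)

theorem IsBddCocycle.norm_iter_le (hA : IsBddCocycle μ A) (hT : MeasurePreserving T μ μ) (n : ℕ) :
    ∃ C, ∀ᵐ x ∂μ, ‖iter T A n x‖ ≤ C := by
  obtain ⟨C, -, h⟩ := hA.bdd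
  exact ⟨C ^ n, (ae_forall_iterate hT h).mono fun x hx => norm_iter_le_pow hx n⟩

theorem finiteLyap_eq {n : ℕ} (h : LogIntegrable μ fun x => ‖iter T A n x‖) :
    finiteLyap μ T A n = (((∫ x, Real.log ‖iter T A n x‖ ∂μ) / n : ℝ) : EReal) :=
  h.eintegral_eq n

theorem lyap_one_eq_limsup (hm : 1 ≤ m) (A : X → Matrix (Fin m) (Fin m) ℝ) :
    lyap μ T A 1 = limsup (finiteLyap μ T A) atTop := by
  simp only [lyap, ← norm_eq_sv_one hm]
  rfl

/-- The bound `‖A‖ ≤ C` together with the closeness of `B` to `A`, along almost every orbit. -/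
theorem ae_orbit_bounds (hT : MeasurePreserving T μ μ) {C e : ℝ} (he : e ≤ 1)
    (hA : ∀ᵐ x ∂μ, ‖A x‖ ≤ C) (hAB : ∀ᵐ x ∂μ, ‖B x - A x‖ ≤ e) :
    ∀ᵐ x ∂μ, ∀ j, ‖A (T^[j] x)‖ ≤ C + 1 ∧ ‖B (T^[j] x)‖ ≤ C + 1 ∧
      ‖B (T^[j] x) - A (T^[j] x)‖ ≤ e := by
  refine ae_forall_iterate hT (p := fun x => ‖A x‖ ≤ C + 1 ∧ ‖B x‖ ≤ C + 1 ∧ ‖B x - A x‖ ≤ e) ?_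
  filter_upwards [hA, hAB] with x h1 h2
  refine ⟨by linarith, ?_, h2⟩
  calc ‖B x‖ = ‖A x + (B x - A x)‖ := by rw [add_sub_cancel]
    _ ≤ ‖A x‖ + ‖B x - A x‖ := norm_add_le _ _
    _ ≤ C + 1 := by linarith

theorem ae_norm_iter_sub_le (hT : MeasurePreserving T μ μ) {C e : ℝ} (hC : 1 ≤ C) (he : e ≤ 1)
    (hA : ∀ᵐ x ∂μ, ‖A x‖ ≤ C) (hAB : ∀ᵐ x ∂μ, ‖B x - A x‖ ≤ e) (n : ℕ) :
    ∀ᵐ x ∂μ, |‖iter T B n x‖ - ‖iter T A n x‖| ≤ n * (C + 1) ^ n * e := by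
  filter_upwards [ae_orbit_bounds hT he hA hAB] with x hx
  exact (abs_norm_sub_norm_le _ _).trans
    (norm_iter_sub_le (by linarith) (fun j => (hx j).1) (fun j => (hx j).2.1)
      (fun j => (hx j).2.2) n)

variable [IsProbabilityMeasure μ]

theorem IsBddCocycle.integral_log_le (hA : IsBddCocycle μ A) (hT : MeasurePreserving T μ μ) {C : ℝ}
    (hC : 1 ≤ C) (hAC : ∀ᵐ x ∂μ, ‖A x‖ ≤ C) {n q : ℕ} (hq : 1 ≤ q) (hqn : q ≤ n) {t : ℝ}
    (ht : 0 < t) (hn : LogIntegrable μ fun x => ‖iter T A n x‖) :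
    ∫ x, Real.log ‖iter T A n x‖ ∂μ ≤ 2 * q * Real.log C - Real.log t
      + n * ((∫ x, Real.log (max ‖iter T A q x‖ t) ∂μ) / q) := by
  obtain ⟨D, hD⟩ := hA.norm_iter_le hT q
  have hi := integrable_log_max (hA.measurable_norm_iter hT q) hD ht
  have hij : ∀ j, Integrable (fun x => Real.log (max ‖iter T A q (T^[j] x)‖ t)) μ := fun j =>
    (hT.iterate j).integrable_comp_of_integrable hi
  have hsum := integrable_finsetSum (Finset.range n) fun j _ => hij j
  calc ∫ x, Real.log ‖iter T A n x‖ ∂μ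
      ≤ ∫ x, (2 * q * Real.log C - Real.log t
        + (∑ j ∈ Finset.range n, Real.log (max ‖iter T A q (T^[j] x)‖ t)) / q) ∂μ := by
        refine integral_mono_ae hn.integrable ((integrable_const _).add (hsum.div_const _)) ?_
        filter_upwards [hn.pos, ae_forall_iterate hT hAC] with x hx hxC
        exact log_norm_iter_le hC hxC hq hqn ht hx
    _ = _ := by
        rw [integral_add (integrable_const _) (hsum.div_const _), integral_div,
          integral_finsetSum _ fun j _ => hij j]
        simp only [integral_comp_iterate hT hi.aestronglyMeasurable]
        simp [mul_div_assoc]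

theorem IsBddCocycle.finiteLyap_eq_bot (hA : IsBddCocycle μ A) (hT : MeasurePreserving T μ μ)
    {n : ℕ} (hn : 1 ≤ n) (h : ¬ LogIntegrable μ fun x => ‖iter T A n x‖) :
    finiteLyap μ T A n = ⊥ := by
  obtain ⟨C, hC⟩ := hA.norm_iter_le hT n
  exact eintegral_eq_bot (hA.measurable_norm_iter hT n) hC h hn

theorem IsBddCocycle.logIntegrable (hA : IsBddCocycle μ A) (hT : MeasurePreserving T μ μ)
    {n : ℕ} (hn : 1 ≤ n) (h : ⊥ < finiteLyap μ T A n) :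
    LogIntegrable μ fun x => ‖iter T A n x‖ := by
  by_contra hc
  exact h.ne' (hA.finiteLyap_eq_bot hT hn hc)

theorem IsBddCocycle.finiteLyap_lt_top (hA : IsBddCocycle μ A) (hT : MeasurePreserving T μ μ)
    {n : ℕ} (hn : 1 ≤ n) : finiteLyap μ T A n < ⊤ := by
  by_cases h : LogIntegrable μ fun x => ‖iter T A n x‖
  · rw [finiteLyap_eq h]; exact EReal.coe_lt_top _
  · rw [hA.finiteLyap_eq_bot hT hn h]; exact bot_lt_top

theorem IsBddCocycle.exists_trunc (hA : IsBddCocycle μ A) (hT : MeasurePreserving T μ μ)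
    {q : ℕ} (hq : 1 ≤ q) {c : ℝ} (h : finiteLyap μ T A q < c) :
    ∃ t, 0 < t ∧ t ≤ 1 ∧ (∫ x, Real.log (max ‖iter T A q x‖ t) ∂μ) / q < c := by
  obtain ⟨C, hC⟩ := hA.norm_iter_le hT q
  exact exists_integral_log_max_lt (hA.measurable_norm_iter hT q) (fun _ => norm_nonneg _) hC hq h

/-- The finite scale exponents at large scales do not exceed the one at a fixed scale `q` by more than
a small amount. Subadditivity is used in the quantitative form `log_norm_iter_le`, which also covers
the case that `log ‖A^{(q)}‖` is not integrable. -/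
theorem IsBddCocycle.eventually_finiteLyap_lt (hA : IsBddCocycle μ A)
    (hT : MeasurePreserving T μ μ) {q : ℕ} (hq : 1 ≤ q) {c : ℝ} (h : finiteLyap μ T A q < c) :
    ∀ᶠ n in atTop, finiteLyap μ T A n < c := by
  obtain ⟨C, hC1, hC⟩ := hA.bdd
  obtain ⟨t, ht, -, hI⟩ := hA.exists_trunc hT hq h
  set I := (∫ x, Real.log (max ‖iter T A q x‖ t) ∂μ) / q
  set D := 2 * q * Real.log C - Real.log t
  have hlim : Tendsto (fun n : ℕ => D / n + I) atTop (𝓝 (0 + I)) :=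
    (tendsto_const_div_atTop_nhds_zero_nat D).add_const I
  rw [zero_add] at hlim
  filter_upwards [hlim.eventually_lt_const hI, eventually_ge_atTop q] with n hn hqn
  have hn1 : 1 ≤ n := hq.trans hqn
  have hn' : (0 : ℝ) < n := by exact_mod_cast hn1
  by_cases hL : LogIntegrable μ fun x => ‖iter T A n x‖
  · rw [finiteLyap_eq hL, EReal.coe_lt_coe_iff]
    refine lt_of_le_of_lt ?_ hn
    rw [div_le_iff₀ hn']
    have e : (D / n + I) * n = D + n * I := by field_simp
    rw [e]
    exact hA.integral_log_le hT hC1 hC hq hqn ht hL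
  · rw [hA.finiteLyap_eq_bot hT hn1 hL]
    exact EReal.bot_lt_coe _

/-- The finite scale exponents are bounded below by their limit. -/
theorem IsBddCocycle.lyap_le_finiteLyap (hA : IsBddCocycle μ A) (hT : MeasurePreserving T μ μ)
    (hm : 1 ≤ m) {n : ℕ} (hn : 1 ≤ n) : lyap μ T A 1 ≤ finiteLyap μ T A n := by
  rw [lyap_one_eq_limsup hm]
  refine le_of_forall_gt fun c hc => ?_
  obtain ⟨r, hr1, hr2⟩ := EReal.lt_iff_exists_real_btwn.1 hc
  exact (limsup_le_of_le (by isBoundedDefault)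
    ((hA.eventually_finiteLyap_lt hT hn hr1).mono fun _ h => h.le)).trans_lt hr2

theorem IsBddCocycle.tendsto_finiteLyap (hA : IsBddCocycle μ A) (hT : MeasurePreserving T μ μ)
    (hm : 1 ≤ m) : Tendsto (finiteLyap μ T A) atTop (𝓝 (lyap μ T A 1)) := by
  refine tendsto_of_le_liminf_of_limsup_le ?_ (lyap_one_eq_limsup hm A).ge
  refine le_liminf_of_le (by isBoundedDefault) ?_
  filter_upwards [eventually_ge_atTop 1] with n hn
  exact hA.lyap_le_finiteLyap hT hm hn

theorem IsBddCocycle.lyap_one_lt_top (hA : IsBddCocycle μ A) (hT : MeasurePreserving T μ μ)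
    (hm : 1 ≤ m) : lyap μ T A 1 < ⊤ :=
  (hA.lyap_le_finiteLyap hT hm le_rfl).trans_lt (hA.finiteLyap_lt_top hT le_rfl)

theorem abs_log_max_sub_le {r s t : ℝ} (ht : 0 < t) :
    |Real.log (max r t) - Real.log (max s t)| ≤ |r - s| / t := by
  have key : ∀ {r s : ℝ}, Real.log (max r t) - Real.log (max s t) ≤ |r - s| / t := by
    intro r s
    have hs : 0 < max s t := lt_max_of_lt_right ht
    have hr : 0 < max r t := lt_max_of_lt_right ht
    rw [← Real.log_div hr.ne' hs.ne']
    refine (Real.log_le_sub_one_of_pos (by positivity)).trans ?_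
    rw [div_sub_one hs.ne']
    calc (max r t - max s t) / max s t ≤ |r - s| / max s t := by
          gcongr
          exact (le_abs_self _).trans (abs_max_sub_max_le_abs r s t)
      _ ≤ |r - s| / t := by gcongr; exact le_max_right _ _
  rw [abs_le]
  refine ⟨?_, key⟩
  have := key (r := s) (s := r)
  rw [abs_sub_comm] at this
  linarith

/-- Upper semicontinuity of the top Lyapunov exponent. -/
theorem IsBddCocycle.exists_lyap_lt (hA : IsBddCocycle μ A) (hT : MeasurePreserving T μ μ)
    (hm : 1 ≤ m) {c : ℝ} (h : lyap μ T A 1 < c) :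
    ∃ δ, 0 < δ ∧ ∀ B : X → Matrix (Fin m) (Fin m) ℝ, IsBddCocycle μ B →
      (∀ᵐ x ∂μ, ‖B x - A x‖ ≤ δ) → lyap μ T B 1 < c := by
  obtain ⟨C, hC1, hC⟩ := hA.bdd
  obtain ⟨q, hqc, hq⟩ := (((hA.tendsto_finiteLyap hT hm).eventually_lt_const h).and
    (eventually_ge_atTop 1)).exists
  obtain ⟨t, ht, -, hI⟩ := hA.exists_trunc hT hq hqc
  have hq' : (0 : ℝ) < q := by exact_mod_cast hq
  set I := (∫ x, Real.log (max ‖iter T A q x‖ t) ∂μ) / q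
  set K := (C + 1) ^ q / t
  have hK : 0 < K := by positivity
  obtain ⟨e, he0, he1, he⟩ : ∃ e, 0 < e ∧ e ≤ 1 ∧ K * e ≤ (c - I) / 2 := by
    refine ⟨min 1 ((c - I) / (2 * K)), lt_min one_pos (div_pos (sub_pos.2 hI) (by positivity)),
      min_le_left _ _, ?_⟩
    calc K * min 1 ((c - I) / (2 * K)) ≤ K * ((c - I) / (2 * K)) := by
          gcongr; exact min_le_right _ _
      _ = _ := by field_simp
  refine ⟨e, he0, fun B hB hAB => ?_⟩
  refine (hB.lyap_le_finiteLyap hT hm hq).trans_lt ?_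
  by_cases hL : LogIntegrable μ fun x => ‖iter T B q x‖
  swap
  · rw [hB.finiteLyap_eq_bot hT hq hL]
    exact EReal.bot_lt_coe _
  rw [finiteLyap_eq hL, EReal.coe_lt_coe_iff]
  obtain ⟨D, hD⟩ := hB.norm_iter_le hT q
  obtain ⟨D', hD'⟩ := hA.norm_iter_le hT q
  have h1 := hL.integral_le (hB.measurable_norm_iter hT q) hD ht
  have hiA := integrable_log_max (hA.measurable_norm_iter hT q) hD' ht
  have h2 : ∫ x, Real.log (max ‖iter T B q x‖ t) ∂μ
      ≤ ∫ x, (Real.log (max ‖iter T A q x‖ t) + q * (K * e)) ∂μ := by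
    refine integral_mono_ae (integrable_log_max (hB.measurable_norm_iter hT q) hD ht)
      (hiA.add (integrable_const _)) ?_
    filter_upwards [ae_norm_iter_sub_le hT hC1 he1 hC hAB q] with x hx
    have h3 := (le_abs_self _).trans
      (abs_log_max_sub_le (r := ‖iter T B q x‖) (s := ‖iter T A q x‖) ht)
    have h4 : |‖iter T B q x‖ - ‖iter T A q x‖| / t ≤ q * (K * e) := by
      rw [div_le_iff₀ ht]
      refine hx.trans_eq ?_
      simp only [K]; field_simp
    linarith
  rw [integral_add hiA (integrable_const _)] at h2
  simp only [integral_const, probReal_univ, one_smul] at h2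
  have h5 : (∫ x, Real.log ‖iter T B q x‖ ∂μ) / q ≤ I + K * e := by
    rw [div_le_iff₀ hq']
    refine (h1.trans h2).trans_eq ?_
    simp only [I]; field_simp
  linarith

end Measure

/-! ### Lyapunov exponents of exterior powers -/

section LogProduct

variable {X : Type*} [MeasurableSpace X] {μ : Measure X}

theorem LogIntegrable.congr {f g : X → ℝ} (hf : LogIntegrable μ f) (h : ∀ x, f x = g x) :
    LogIntegrable μ g := by
  rwa [show g = f from funext fun x => (h x).symm]

theorem LogIntegrable.mul {f g : X → ℝ} (hf : LogIntegrable μ f) (hg : LogIntegrable μ g) :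
    LogIntegrable μ (fun x => f x * g x) ∧
      ∫ x, Real.log (f x * g x) ∂μ = ∫ x, Real.log (f x) ∂μ + ∫ x, Real.log (g x) ∂μ := by
  have e : ∀ᵐ x ∂μ, Real.log (f x) + Real.log (g x) = Real.log (f x * g x) := by
    filter_upwards [hf.pos, hg.pos] with x h1 h2
    rw [Real.log_mul h1.ne' h2.ne']
  refine ⟨⟨?_, (hf.integrable.add hg.integrable).congr e⟩, ?_⟩
  · filter_upwards [hf.pos, hg.pos] with x h1 h2 using mul_pos h1 h2
  · rw [← integral_congr_ae e, integral_add hf.integrable hg.integrable]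

theorem LogIntegrable.left_of_mul [IsFiniteMeasure μ] {f g : X → ℝ} {D : ℝ} (hf : Measurable f)
    (hf0 : ∀ x, 0 ≤ f x) (hg0 : ∀ x, 0 ≤ g x) (hfD : ∀ᵐ x ∂μ, f x ≤ D) (hgD : ∀ᵐ x ∂μ, g x ≤ D)
    (h : LogIntegrable μ fun x => f x * g x) : LogIntegrable μ f := by
  have hpos : ∀ᵐ x ∂μ, 0 < f x ∧ 0 < g x := by
    filter_upwards [h.pos] with x hx
    have h1 : f x ≠ 0 := fun h1 => by simp [h1] at hx
    have h2 : g x ≠ 0 := fun h2 => by simp [h2] at hx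
    exact ⟨lt_of_le_of_ne (hf0 x) h1.symm, lt_of_le_of_ne (hg0 x) h2.symm⟩
  refine ⟨hpos.mono fun _ hx => hx.1, ?_⟩
  refine Integrable.mono' (g := fun x => |Real.log (f x * g x)| + |Real.log D|)
    (h.integrable.abs.add (integrable_const _)) (Real.measurable_log.comp hf).aestronglyMeasurable ?_
  filter_upwards [hpos, hfD, hgD] with x hx hxf hxg
  have h1 : Real.log (f x) ≤ Real.log D := Real.log_le_log hx.1 hxf
  have h2 : Real.log (g x) ≤ Real.log D := Real.log_le_log hx.2 hxg
  have h3 := Real.log_mul hx.1.ne' hx.2.ne'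
  have h4 := abs_le.1 (le_refl |Real.log (f x * g x)|)
  have h5 := le_abs_self (Real.log D)
  rw [Real.norm_eq_abs, abs_le]
  constructor <;> linarith [abs_nonneg (Real.log (f x * g x))]

end LogProduct

theorem tendsto_ereal_sub {u : ℕ → EReal} {v : ℕ → ℝ} {U : EReal} {V : ℝ}
    (hu : Tendsto u atTop (𝓝 U)) (hv : Tendsto v atTop (𝓝 V)) :
    Tendsto (fun n => u n - (v n : EReal)) atTop (𝓝 (U - V)) := by
  have h1 : Tendsto (fun n => ((-v n : ℝ) : EReal)) atTop (𝓝 ((-V : ℝ) : EReal)) :=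
    EReal.tendsto_coe.2 hv.neg
  have := (EReal.continuousAt_add (p := (U, ((-V : ℝ) : EReal)))
    (Or.inr (EReal.coe_ne_bot _)) (Or.inr (EReal.coe_ne_top _))).tendsto.comp (hu.prodMk_nhds h1)
  simpa [sub_eq_add_neg, Function.comp_def] using this

theorem EReal_exists_coe {a : EReal} (h1 : ⊥ < a) (h2 : a < ⊤) : ∃ r : ℝ, a = r :=
  ⟨a.toReal, (EReal.coe_toReal h2.ne h1.ne').symm⟩

theorem norm_iter_wedge {X : Type*} {T : X → X} {m k : ℕ} (hk : k ≤ m)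
    (A : X → Matrix (Fin m) (Fin m) ℝ) (n : ℕ) (x : X) :
    ‖iter T (fun x => wedge k (A x)) n x‖ = svProd (iter T A n x) k := by
  rw [iter_wedge, norm_wedge hk]

section Ext

variable {X : Type*} [MeasurableSpace X] {μ : Measure X} {T : X → X} {m : ℕ}

/-- The top Lyapunov exponent of the exterior power `∧_k A`, which equals `L_1 + ⋯ + L_k`. -/
noncomputable def extLyap (μ : Measure X) (T : X → X) (A : X → Matrix (Fin m) (Fin m) ℝ) (k : ℕ) :
    EReal := lyap μ T (fun x => wedge k (A x)) 1

theorem svProd_le_pow (hm : 1 ≤ m) (g : Matrix (Fin m) (Fin m) ℝ) (k : ℕ) :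
    svProd g k ≤ ‖g‖ ^ k := by
  rw [norm_eq_sv_one hm]
  calc svProd g k ≤ ∏ _i ∈ Finset.range k, sv g 1 :=
        Finset.prod_le_prod (fun _ _ => sv_nonneg _ _) fun i _ => sv_antitone g (by omega)
    _ = _ := by simp

variable {A B : X → Matrix (Fin m) (Fin m) ℝ}

theorem IsBddCocycle.wedge (hA : IsBddCocycle μ A) (hm : 1 ≤ m) {k : ℕ} (hk : k ≤ m) :
    IsBddCocycle μ (fun x => wedge k (A x)) := by
  refine ⟨fun i j => ?_, ?_⟩
  · simp only [ACT.wedge, Matrix.of_apply, Matrix.det_apply]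
    exact Finset.measurable_sum _ fun σ _ =>
      (Finset.measurable_prod _ fun a _ => hA.measurable _ _).const_smul _
  · obtain ⟨C, hC1, hC⟩ := hA.bdd
    refine ⟨C ^ k, one_le_pow₀ hC1, hC.mono fun x hx => ?_⟩
    rw [norm_wedge hk]
    exact (svProd_le_pow hm _ _).trans (pow_le_pow_left₀ (norm_nonneg _) hx k)

theorem measurable_svProd (hA : IsBddCocycle μ A) (hT : MeasurePreserving T μ μ) (hm : 1 ≤ m)
    {k : ℕ} (hk : k ≤ m) (n : ℕ) : Measurable fun x => svProd (iter T A n x) k := by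
  simp only [← norm_iter_wedge hk]
  exact (hA.wedge hm hk).measurable_norm_iter hT n

theorem measurable_sv (hA : IsBddCocycle μ A) (hT : MeasurePreserving T μ μ) (hm : 1 ≤ m)
    {k : ℕ} (hk : k + 1 ≤ m) (n : ℕ) : Measurable fun x => sv (iter T A n x) (k + 1) := by
  have e : ∀ g : Matrix (Fin m) (Fin m) ℝ, sv g (k + 1) = svProd g (k + 1) / svProd g k := fun g => by
    rcases eq_or_ne (svProd g k) 0 with h | h
    · obtain ⟨i, hi, h0⟩ := Finset.prod_eq_zero_iff.1 h
      have h1 : sv g (k + 1) ≤ sv g (i + 1) := sv_antitone g (by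
        have := Finset.mem_range.1 hi; omega)
      rw [h, div_zero]
      exact le_antisymm (h1.trans_eq h0) (sv_nonneg _ _)
    · rw [svProd_succ]; field_simp
  simp only [e]
  exact (measurable_svProd hA hT hm hk n).div (measurable_svProd hA hT hm (by omega) n)

theorem ae_svProd_le (hA : IsBddCocycle μ A) (hT : MeasurePreserving T μ μ) (hm : 1 ≤ m)
    (k n : ℕ) : ∃ D, ∀ᵐ x ∂μ, svProd (iter T A n x) k ≤ D ∧ sv (iter T A n x) (k + 1) ≤ D := by
  obtain ⟨C, hC⟩ := hA.norm_iter_le hT n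
  refine ⟨max (C ^ k) C, hC.mono fun x hx => ⟨le_max_of_le_left ?_, le_max_of_le_right ?_⟩⟩
  · exact (svProd_le_pow hm _ _).trans (pow_le_pow_left₀ (norm_nonneg _) hx k)
  · exact (sv_antitone _ (by omega)).trans ((norm_eq_sv_one hm _).symm.le.trans hx)

theorem lyap_antitone (A : X → Matrix (Fin m) (Fin m) ℝ) : Antitone (lyap μ T A) := fun j k hjk =>
  limsup_le_limsup (Eventually.of_forall fun n => eintegral_mono (ae_of_all _ fun x =>
    elog_div_mono (sv_antitone _ hjk) n)) (by isBoundedDefault) (by isBoundedDefault)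

theorem finiteLyap_wedge {k : ℕ} (hk : k ≤ m) (A : X → Matrix (Fin m) (Fin m) ℝ) (n : ℕ) :
    finiteLyap μ T (fun x => wedge k (A x)) n
      = eintegral μ fun x => elog (svProd (iter T A n x) k) / (n : EReal) := by
  refine eintegral_congr (ae_of_all _ fun x => ?_)
  rw [logNorm, norm_iter_wedge hk]

theorem extLyap_one (hm : 1 ≤ m) (A : X → Matrix (Fin m) (Fin m) ℝ) :
    extLyap μ T A 1 = lyap μ T A 1 := by
  rw [extLyap, lyap_one_eq_limsup (by simpa using hm), lyap_one_eq_limsup hm]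
  congr 1
  ext n
  rw [finiteLyap_wedge hm]
  refine eintegral_congr (ae_of_all _ fun x => ?_)
  simp [svProd, logNorm, norm_eq_sv_one hm]

variable [IsProbabilityMeasure μ]

theorem logIntegrable_sv_of_svProd (hA : IsBddCocycle μ A) (hT : MeasurePreserving T μ μ)
    (hm : 1 ≤ m) {k : ℕ} (hk : k + 1 ≤ m) {n : ℕ}
    (h : LogIntegrable μ fun x => svProd (iter T A n x) (k + 1)) :
    LogIntegrable μ (fun x => svProd (iter T A n x) k) ∧
      LogIntegrable μ (fun x => sv (iter T A n x) (k + 1)) := by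
  obtain ⟨D, hD⟩ := ae_svProd_le hA hT hm k n
  have h1 := h.congr fun x => svProd_succ (iter T A n x) k
  have h2 := h1.congr fun x => mul_comm _ _
  exact ⟨h1.left_of_mul (measurable_svProd hA hT hm (by omega) n) (fun _ => svProd_nonneg _ _)
      (fun _ => sv_nonneg _ _) (hD.mono fun _ h => h.1) (hD.mono fun _ h => h.2),
    h2.left_of_mul (measurable_sv hA hT hm hk n) (fun _ => sv_nonneg _ _)
      (fun _ => svProd_nonneg _ _) (hD.mono fun _ h => h.2) (hD.mono fun _ h => h.1)⟩

theorem extLyap_lt_top (hA : IsBddCocycle μ A) (hT : MeasurePreserving T μ μ) (hm : 1 ≤ m) {k : ℕ}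
    (hk : k ≤ m) : extLyap μ T A k < ⊤ :=
  (hA.wedge hm hk).lyap_one_lt_top hT (Nat.choose_pos hk)

theorem extLyap_zero (A : X → Matrix (Fin m) (Fin m) ℝ) : extLyap μ T A 0 = 0 := by
  rw [extLyap, lyap_one_eq_limsup (by simp)]
  have : finiteLyap μ T (fun x => wedge 0 (A x)) = fun _ => 0 := by
    ext n
    rw [finiteLyap_wedge (Nat.zero_le _)]
    simp [svProd_zero, elog, eintegral]
  rw [this, limsup_const]

/-- If `L_1 + ⋯ + L_k > -∞`, the finite scale versions of this sum are integrals of integrable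
functions. -/
theorem logIntegrable_svProd (hA : IsBddCocycle μ A) (hT : MeasurePreserving T μ μ) (hm : 1 ≤ m)
    {k : ℕ} (hk : k ≤ m) (h : ⊥ < extLyap μ T A k) {n : ℕ} (hn : 1 ≤ n) :
    LogIntegrable μ fun x => svProd (iter T A n x) k :=
  ((hA.wedge hm hk).logIntegrable hT hn (h.trans_le
    ((hA.wedge hm hk).lyap_le_finiteLyap hT (Nat.choose_pos hk) hn))).congr
      fun x => norm_iter_wedge hk A n x

theorem tendsto_integral_svProd (hA : IsBddCocycle μ A) (hT : MeasurePreserving T μ μ)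
    (hm : 1 ≤ m) {k : ℕ} (hk : k ≤ m) {a : ℝ} (h : extLyap μ T A k = a) :
    Tendsto (fun n : ℕ => (∫ x, Real.log (svProd (iter T A n x) k) ∂μ) / n) atTop (𝓝 a) := by
  have h1 := (hA.wedge hm hk).tendsto_finiteLyap hT (Nat.choose_pos hk)
  rw [← extLyap, h] at h1
  rw [← EReal.tendsto_coe]
  refine h1.congr' ?_
  filter_upwards [eventually_ge_atTop 1] with n hn
  rw [finiteLyap_wedge hk, (logIntegrable_svProd hA hT hm hk (h ▸ EReal.bot_lt_coe a) hn).eintegral_eq]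

/-- The finite scale version of `L_{k+1}` is a difference of integrals of `log ‖∧_j A^{(n)}‖`. -/
theorem eintegral_sv_eq_sub (hA : IsBddCocycle μ A) (hT : MeasurePreserving T μ μ) (hm : 1 ≤ m)
    {k : ℕ} (hk : k + 1 ≤ m) (h : ⊥ < extLyap μ T A k) {n : ℕ} (hn : 1 ≤ n) :
    eintegral μ (fun x => elog (sv (iter T A n x) (k + 1)) / (n : EReal))
      = finiteLyap μ T (fun x => wedge (k + 1) (A x)) n
        - (((∫ x, Real.log (svProd (iter T A n x) k) ∂μ) / n : ℝ) : EReal) := by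
  have hP := logIntegrable_svProd hA hT hm (by omega) h hn
  obtain ⟨D, hD⟩ := ae_svProd_le hA hT hm k n
  obtain ⟨D', hD'⟩ := ae_svProd_le hA hT hm (k + 1) n
  rw [finiteLyap_wedge hk]
  by_cases hL : LogIntegrable μ fun x => svProd (iter T A n x) (k + 1)
  · have hs := (logIntegrable_sv_of_svProd hA hT hm hk hL).2
    rw [hL.eintegral_eq, hs.eintegral_eq, ← EReal.coe_sub, ← sub_div]
    simp only [svProd_succ]
    rw [(hP.mul hs).2, add_sub_cancel_left]
  · have hs : ¬ LogIntegrable μ fun x => sv (iter T A n x) (k + 1) := fun hs =>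
      hL ((hP.mul hs).1.congr fun x => (svProd_succ _ _).symm)
    rw [eintegral_eq_bot (measurable_svProd hA hT hm hk n) (hD'.mono fun _ h => h.1) hL hn,
      eintegral_eq_bot (measurable_sv hA hT hm hk n) (hD.mono fun _ h => h.2) hs hn, EReal.bot_sub]

theorem tendsto_eintegral_sv (hA : IsBddCocycle μ A) (hT : MeasurePreserving T μ μ) (hm : 1 ≤ m)
    {k : ℕ} (hk : k + 1 ≤ m) (h : ⊥ < extLyap μ T A k) :
    Tendsto (fun n : ℕ => eintegral μ fun x => elog (sv (iter T A n x) (k + 1)) / (n : EReal)) atTop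
      (𝓝 (extLyap μ T A (k + 1) - extLyap μ T A k)) := by
  obtain ⟨a, ha⟩ := EReal_exists_coe h (extLyap_lt_top hA hT hm (by omega))
  have h1 := tendsto_ereal_sub ((hA.wedge hm hk).tendsto_finiteLyap hT (Nat.choose_pos hk))
    (tendsto_integral_svProd hA hT hm (by omega) ha)
  rw [← extLyap] at h1
  rw [ha]
  refine h1.congr' ?_
  filter_upwards [eventually_ge_atTop 1] with n hn
  exact (eintegral_sv_eq_sub hA hT hm hk h hn).symm

/-- The exponent `L_{k+1}` as a difference of top exponents of exterior powers. The value
`extLyap (k + 1) = ⊥` is allowed. -/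
theorem lyap_succ_eq_sub (hA : IsBddCocycle μ A) (hT : MeasurePreserving T μ μ) (hm : 1 ≤ m)
    {k : ℕ} (hk : k + 1 ≤ m) (h : ⊥ < extLyap μ T A k) :
    lyap μ T A (k + 1) = extLyap μ T A (k + 1) - extLyap μ T A k :=
  (tendsto_eintegral_sv hA hT hm hk h).limsup_eq

/-- If `L_1 + ⋯ + L_{k+1} > -∞` then `L_1 + ⋯ + L_k > -∞`, since `s_{k+1}` is bounded above along
orbits by powers of the bound of `A`. -/
theorem bot_lt_extLyap_of_succ (hA : IsBddCocycle μ A) (hT : MeasurePreserving T μ μ) (hm : 1 ≤ m)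
    {k : ℕ} (hk : k + 1 ≤ m) (h : ⊥ < extLyap μ T A (k + 1)) : ⊥ < extLyap μ T A k := by
  obtain ⟨C, hC1, hC⟩ := hA.bdd
  obtain ⟨a, ha⟩ := EReal_exists_coe h (extLyap_lt_top hA hT hm hk)
  have h1 := tendsto_integral_svProd hA hT hm hk ha
  have h2 := (hA.wedge hm (by omega : k ≤ m)).tendsto_finiteLyap hT (Nat.choose_pos (by omega))
  refine (EReal.bot_lt_coe (a - Real.log C)).trans_le
    (le_of_tendsto_of_tendsto (EReal.tendsto_coe.2 (h1.sub_const (Real.log C))) h2 ?_)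
  filter_upwards [eventually_ge_atTop 1] with n hn
  have hn' : (0 : ℝ) < n := by exact_mod_cast hn
  have hL := logIntegrable_svProd hA hT hm hk h hn
  obtain ⟨hL1, hL2⟩ := logIntegrable_sv_of_svProd hA hT hm hk hL
  rw [finiteLyap_wedge (by omega), hL1.eintegral_eq, EReal.coe_le_coe_iff]
  simp only [svProd_succ]
  rw [(hL1.mul hL2).2, add_div]
  have h3 : ∫ x, Real.log (sv (iter T A n x) (k + 1)) ∂μ ≤ ∫ _, n * Real.log C ∂μ := by
    refine integral_mono_ae hL2.integrable (integrable_const _) ?_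
    filter_upwards [hL2.pos, ae_forall_iterate hT hC] with x hx hxC
    rw [← Real.log_pow]
    exact Real.log_le_log hx ((sv_antitone _ (by omega)).trans
      ((norm_eq_sv_one hm _).symm.le.trans (norm_iter_le_pow hxC n)))
  simp only [integral_const, probReal_univ, one_smul] at h3
  have h4 : (∫ x, Real.log (sv (iter T A n x) (k + 1)) ∂μ) / n ≤ Real.log C := by
    rw [div_le_iff₀ hn']; linarith
  linarith

/-- `L_k > -∞` implies `L_1 + ⋯ + L_k > -∞`. -/
theorem bot_lt_extLyap (hA : IsBddCocycle μ A) (hT : MeasurePreserving T μ μ) (hm : 1 ≤ m)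
    {k : ℕ} (hk : k ≤ m) (h : ⊥ < lyap μ T A k) : ⊥ < extLyap μ T A k := by
  induction k with
  | zero => rw [extLyap_zero]; exact EReal.bot_lt_zero
  | succ k ih =>
    have h1 := ih (by omega) (h.trans_le (lyap_antitone A (Nat.le_succ k)))
    rw [lyap_succ_eq_sub hA hT hm hk h1] at h
    by_contra hc
    rw [not_bot_lt_iff] at hc
    simp [hc] at h

theorem lyap_lt_top (hA : IsBddCocycle μ A) (hT : MeasurePreserving T μ μ) (hm : 1 ≤ m)
    {k : ℕ} (hk : 1 ≤ k) : lyap μ T A k < ⊤ :=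
  (lyap_antitone A hk).trans_lt (hA.lyap_one_lt_top hT hm)

theorem lyapBlock_eq_extLyap (hA : IsBddCocycle μ A) (hT : MeasurePreserving T μ μ) (hm : 1 ≤ m)
    {k : ℕ} (hk : k ≤ m) : lyapBlock μ T A k = extLyap μ T A k := by
  induction k with
  | zero => simp [lyapBlock, extLyap_zero]
  | succ k ih =>
    have h1 : lyapBlock μ T A (k + 1) = extLyap μ T A k + lyap μ T A (k + 1) := by
      rw [← ih (by omega), lyapBlock, lyapBlock, Finset.sum_Icc_succ_top (by omega)]
    rw [h1]
    by_cases hb : ⊥ < extLyap μ T A k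
    · rw [lyap_succ_eq_sub hA hT hm hk hb]
      obtain ⟨a, ha⟩ := EReal_exists_coe hb (extLyap_lt_top hA hT hm (by omega))
      rw [ha, add_comm, EReal.sub_add_cancel]
    · have h2 : ¬ ⊥ < extLyap μ T A (k + 1) := fun h => hb (bot_lt_extLyap_of_succ hA hT hm hk h)
      rw [not_bot_lt_iff] at hb h2
      rw [hb, h2, EReal.bot_add]

theorem lyap_eq_bot_of_lt (A : X → Matrix (Fin m) (Fin m) ℝ) {k : ℕ} (hk : m < k) :
    lyap μ T A k = ⊥ := by
  have : ∀ᶠ n : ℕ in atTop,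
      (eintegral μ fun x => elog (sv (iter T A n x) k) / (n : EReal)) = ⊥ := by
    filter_upwards [eventually_ge_atTop 1] with n hn
    simp only [sv_eq_zero _ hk]
    refine eintegral_eq_bot (C := 0) measurable_const (ae_of_all _ fun _ => le_rfl) (fun h => ?_) hn
    obtain ⟨x, hx⟩ := h.pos.exists
    exact lt_irrefl _ hx
  rw [lyap, limsup_congr this, limsup_const]

/-- A gap `L_k > L_{k+1}` of `A` is a gap `L_1 > L_2` of `∧_k A`. -/
theorem lyap_two_wedge_lt (hA : IsBddCocycle μ A) (hT : MeasurePreserving T μ μ) {k : ℕ}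
    (hk : 1 ≤ k) (hkm : k < m) (h : lyap μ T A (k + 1) < lyap μ T A k) :
    lyap μ T (fun x => wedge k (A x)) 2 < lyap μ T (fun x => wedge k (A x)) 1 := by
  have hm : 1 ≤ m := by omega
  obtain ⟨j, rfl⟩ : ∃ j, k = j + 1 := ⟨k - 1, by omega⟩
  set D := fun x => wedge (j + 1) (A x)
  have hD : IsBddCocycle μ D := hA.wedge hm hkm.le
  have hch : 2 ≤ m.choose (j + 1) := by
    have h1 := Nat.choose_le_choose (j + 1) (show j + 2 ≤ m by omega)
    rw [Nat.choose_succ_self_right] at h1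
    omega
  have hb1 : ⊥ < extLyap μ T A (j + 1) := bot_lt_extLyap hA hT hm hkm.le (bot_le.trans_lt h)
  have hb0 := bot_lt_extLyap_of_succ hA hT hm hkm.le hb1
  obtain ⟨a1, ha1⟩ := EReal_exists_coe hb1 (extLyap_lt_top hA hT hm hkm.le)
  obtain ⟨a0, ha0⟩ := EReal_exists_coe hb0 (extLyap_lt_top hA hT hm (by omega))
  have hD1 : extLyap μ T D 1 = a1 := by rw [extLyap_one (by omega)]; exact ha1
  have hDb : ⊥ < extLyap μ T D 1 := hD1 ▸ EReal.bot_lt_coe _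
  change _ < extLyap μ T A (j + 1)
  rw [lyap_succ_eq_sub hD hT (by omega) (k := 1) hch hDb, hD1, ha1]
  rw [lyap_succ_eq_sub hA hT hm hkm.le hb0, ha1, ha0, ← EReal.coe_sub] at h
  -- compare `‖∧_2 ∧_k A^{(n)}‖` with `s_1 ⋯ s_k · s_1 ⋯ s_{k-1} s_{k+1}`
  by_cases hbot : ⊥ < extLyap μ T D 2
  swap
  · rw [not_bot_lt_iff.1 hbot, EReal.bot_sub]; exact EReal.bot_lt_coe _
  obtain ⟨b, hb⟩ := EReal_exists_coe hbot (extLyap_lt_top hD hT (by omega) hch)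
  have t1 := tendsto_integral_svProd hA hT hm hkm.le ha1
  have t0 := tendsto_integral_svProd hA hT hm (by omega) ha0
  have t2 := tendsto_integral_svProd hD hT (by omega) hch hb
  have ts := tendsto_eintegral_sv hA hT hm hkm hb1
  have key : ((b - a1 - a0 : ℝ) : EReal) ≤ lyap μ T A (j + 1 + 1) := by
    rw [lyap_succ_eq_sub hA hT hm hkm hb1]
    refine le_of_tendsto_of_tendsto (EReal.tendsto_coe.2 ((t2.sub t1).sub t0)) ts ?_
    filter_upwards [eventually_ge_atTop 1] with n hn
    have hle : ∀ x, svProd (iter T D n x) 2 ≤ svProd (iter T A n x) (j + 1) *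
        (svProd (iter T A n x) j * sv (iter T A n x) (j + 2)) := fun x => by
      rw [← norm_wedge hch, iter_wedge]
      exact norm_wedge_two_wedge_le _
    have hL1 := logIntegrable_svProd hA hT hm hkm.le hb1 hn
    have hL0 := logIntegrable_svProd hA hT hm (by omega) hb0 hn
    have hLD := logIntegrable_svProd hD hT (by omega) hch hbot hn
    have hpos : ∀ᵐ x ∂μ, 0 < sv (iter T A n x) (j + 2) := by
      filter_upwards [hLD.pos] with x hx
      refine lt_of_le_of_ne (sv_nonneg _ _) fun h0 => ?_
      have := hx.trans_le (hle x)
      rw [← h0] at this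
      simp at this
    have e : (((∫ x, Real.log (svProd (iter T D n x) 2) ∂μ) / n
        - (∫ x, Real.log (svProd (iter T A n x) (j + 1)) ∂μ) / n
        - (∫ x, Real.log (svProd (iter T A n x) j) ∂μ) / n : ℝ) : EReal)
        = eintegral μ fun x => (((Real.log (svProd (iter T D n x) 2)
          - Real.log (svProd (iter T A n x) (j + 1)) - Real.log (svProd (iter T A n x) j)) / n : ℝ)
            : EReal) := by
      have i1 : Integrable (fun x => Real.log (svProd (iter T D n x) 2)
          - Real.log (svProd (iter T A n x) (j + 1))) μ := hLD.integrable.sub hL1.integrable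
      have i2 : Integrable (fun x => Real.log (svProd (iter T D n x) 2)
          - Real.log (svProd (iter T A n x) (j + 1)) - Real.log (svProd (iter T A n x) j)) μ :=
        i1.sub hL0.integrable
      rw [eintegral_coe (i2.div_const _), integral_div, integral_sub i1 hL0.integrable,
        integral_sub hLD.integrable hL1.integrable, sub_div, sub_div]
    rw [e]
    refine eintegral_mono ?_
    filter_upwards [hLD.pos, hL1.pos, hL0.pos, hpos] with x h1 h2 h3 h4
    rw [elog_div_of_pos h4, EReal.coe_le_coe_iff]
    have h5 := Real.log_le_log h1 (hle x)
    rw [Real.log_mul h2.ne' (by positivity), Real.log_mul h3.ne' h4.ne'] at h5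
    gcongr
    linarith
  have h6 := key.trans_lt h
  rw [EReal.coe_lt_coe_iff] at h6
  rw [hb, ← EReal.coe_sub, EReal.coe_lt_coe_iff]
  linarith

end Ext

/-! ### Deviation measure functions -/

section DevMeasure

variable {ι : ℝ → ℝ}

theorem IsDevMeasure.le_of_le (h : IsDevMeasure ι) {s t : ℝ} (hs : 0 < s) (hst : s ≤ t) :
    ι t ≤ ι s :=
  h.strictAntiOn.antitoneOn hs (hs.trans_le hst) hst

theorem IsDevMeasure.rpow_le_rpow (h : IsDevMeasure ι) {s t : ℝ} (hs : 0 < s) (hst : s ≤ t) :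
    ι s ^ (-(1 / 2) : ℝ) ≤ ι t ^ (-(1 / 2) : ℝ) :=
  Real.rpow_le_rpow_of_nonpos (h.pos t (hs.trans_le hst)) (h.le_of_le hs hst) (by norm_num)

theorem IsDevMeasure.psi_strictMonoOn (h : IsDevMeasure ι) : StrictMonoOn (psi ι) (Ioi 0) := by
  intro s hs t ht hst
  have h1 := h.rpow_le_rpow hs hst.le
  have h2 : 0 < ι s ^ (-(1 / 2) : ℝ) := Real.rpow_pos_of_pos (h.pos s hs) _
  exact mul_lt_mul hst h1 h2 (le_of_lt ht)

theorem IsDevMeasure.phi_psi (h : IsDevMeasure ι) {s : ℝ} (hs : 0 < s) : phi ι (psi ι s) = s := by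
  have hex : ∃ a ∈ Ioi (0 : ℝ), psi ι a = psi ι s := ⟨s, hs, rfl⟩
  exact h.psi_strictMonoOn.injOn (Function.invFunOn_mem hex) hs (Function.invFunOn_eq hex)

/-- The condition on `φ_ι` says that `ι` decays by a definite factor when its argument doubles. -/
theorem IsDevMeasure.exists_doubling (h : IsDevMeasure ι) :
    ∃ β s₀, 0 < β ∧ β < 1 ∧ 0 < s₀ ∧ ∀ s, s₀ ≤ s → ι (2 * s) ≤ β * ι s := by
  obtain ⟨r', hr1, hr2⟩ := EReal.lt_iff_exists_real_btwn.1 h.limsup_phi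
  have hr2' : r' < 2 := EReal.coe_lt_coe_iff.1 hr2
  have hev := eventually_lt_of_limsup_lt hr1
  have htend : Tendsto (psi ι) atTop atTop := by
    refine tendsto_atTop_mono' atTop (f₁ := fun s => s * ι 1 ^ (-(1 / 2) : ℝ)) ?_ ?_
    · filter_upwards [eventually_ge_atTop 1] with s hs
      exact mul_le_mul_of_nonneg_left (h.rpow_le_rpow one_pos hs) (by linarith)
    · exact tendsto_id.atTop_mul_const (Real.rpow_pos_of_pos (h.pos 1 one_pos) _)
  obtain ⟨s₀, hs₀⟩ := eventually_atTop.1 ((htend.eventually hev).and (eventually_gt_atTop 0))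
  set r := max r' 1
  have hr : r < 2 := max_lt hr2' one_lt_two
  have hr0 : 0 < r := lt_max_of_lt_right one_pos
  refine ⟨(r / 2) ^ 2, max s₀ 1, by positivity, ?_, lt_max_of_lt_right one_pos, fun s hs => ?_⟩
  · have : r / 2 < 1 := by linarith
    exact pow_lt_one₀ (by positivity) this two_ne_zero
  obtain ⟨hlt, hspos⟩ := hs₀ s ((le_max_left _ _).trans hs)
  have hpos : 0 < psi ι s := mul_pos hspos (Real.rpow_pos_of_pos (h.pos s hspos) _)
  -- the point `u` with `ψ(u) = 2 ψ(s)`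
  obtain ⟨u, hu, hpsi⟩ : ∃ u ∈ Icc s (2 * s), psi ι u = 2 * psi ι s := by
    have hc : ContinuousOn (psi ι) (Icc s (2 * s)) := by
      have hsub : Icc s (2 * s) ⊆ Ioi 0 := fun u hu => hspos.trans_le hu.1
      exact continuousOn_id.mul ((h.continuousOn.mono hsub).rpow_const fun u hu =>
        Or.inl (h.pos u (hsub hu)).ne')
    refine intermediate_value_Icc (by linarith) hc ⟨by linarith, ?_⟩
    rw [psi, psi, mul_assoc]
    have := h.rpow_le_rpow hspos (by linarith : s ≤ 2 * s)
    gcongr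
  have hu0 : 0 < u := hspos.trans_le hu.1
  have hus : u < r * s := by
    rw [← hpsi, h.phi_psi hu0, h.phi_psi hspos, EReal.coe_lt_coe_iff, div_lt_iff₀ hspos] at hlt
    exact hlt.trans_le (mul_le_mul_of_nonneg_right (le_max_left _ _) hspos.le)
  have hrs : 0 < r * s := mul_pos hr0 hspos
  have h1 : 2 * psi ι s < psi ι (r * s) := hpsi ▸ h.psi_strictMonoOn hu0 hrs hus
  have hsq : ∀ {v : ℝ}, 0 < v → (ι v ^ (-(1 / 2) : ℝ)) ^ 2 = (ι v)⁻¹ := fun hv => by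
    rw [← Real.rpow_natCast, ← Real.rpow_mul (h.pos _ hv).le]
    norm_num [Real.rpow_neg_one]
  set a := ι s ^ (-(1 / 2) : ℝ)
  set b := ι (r * s) ^ (-(1 / 2) : ℝ)
  have ha : 0 < a := Real.rpow_pos_of_pos (h.pos s hspos) _
  have h2 : 2 / r * a ≤ b := by
    rw [div_mul_eq_mul_div, div_le_iff₀ hr0]
    have h3 : 2 * (s * a) < r * s * b := h1
    have h4 : s * (2 * a) < s * (b * r) := by linarith
    exact (lt_of_mul_lt_mul_left h4 hspos.le).le
  have h5 : (2 / r * a) ^ 2 ≤ b ^ 2 := pow_le_pow_left₀ (by positivity) h2 2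
  rw [mul_pow, hsq hspos, hsq hrs] at h5
  have hιs := h.pos s hspos
  have hιrs := h.pos _ hrs
  have h6 : ι (r * s) ≤ (r / 2) ^ 2 * ι s := by
    have h7 : (ι (r * s))⁻¹⁻¹ ≤ ((2 / r) ^ 2 * (ι s)⁻¹)⁻¹ := inv_anti₀ (by positivity) h5
    rw [inv_inv, mul_inv, inv_inv, ← inv_pow, inv_div] at h7
    exact h7
  exact (h.le_of_le hrs (by gcongr)).trans h6

theorem IsDevMeasure.exists_exp_le (h : IsDevMeasure ι) :
    ∃ K t₀, 0 < K ∧ 0 < t₀ ∧ ∀ t, t₀ ≤ t → Real.exp (-(K * t)) ≤ ι t := by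
  obtain ⟨K, hK, hev⟩ := h.isBigO_id.exists_pos
  obtain ⟨t₀, ht₀⟩ := eventually_atTop.1 hev.bound
  refine ⟨K, max t₀ 1, hK, lt_max_of_lt_right one_pos, fun t ht => ?_⟩
  have ht0 : 0 < t := one_pos.trans_le ((le_max_right _ _).trans ht)
  have h1 := ht₀ t ((le_max_left _ _).trans ht)
  rw [Real.norm_eq_abs, Real.norm_eq_abs, abs_of_pos ht0, one_div, Real.log_inv, abs_neg] at h1
  rw [← Real.exp_log (h.pos t ht0), Real.exp_le_exp]
  linarith [neg_abs_le (Real.log (ι t))]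

theorem LDTParameters.nonempty_devMeasures (P : LDTParameters) : P.devMeasures.Nonempty := by
  obtain ⟨q, hq, -⟩ := P.exists_small 1 one_pos
  exact ⟨_, (P.mem_params q hq).2.2⟩

end DevMeasure

/-! ### Upper large deviations of the norms -/

section UpperLDT

variable {X : Type*} [MeasurableSpace X] {μ : Measure X} {T : X → X} {m : ℕ}

theorem exists_baseLDT_finset {P : LDTParameters} {J : Type*} (s : Finset J) (ξ : J → X → ℝ)
    (h : ∀ i ∈ s, BaseLDT T μ P (ξ i)) {η : ℝ} (hη : 0 < η) :
    ∃ ι ∈ P.devMeasures, ∃ n₀ : ℕ, 1 ≤ n₀ ∧ ∀ n : ℕ, n₀ ≤ n →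
      μ {x | ∃ i ∈ s, η < |(1 / (n : ℝ)) * ∑ j ∈ Finset.range n, ξ i (T^[j] x) - ∫ y, ξ i y ∂μ|}
        ≤ ENNReal.ofReal (ι n) := by
  classical
  induction s using Finset.induction_on with
  | empty =>
    obtain ⟨ι, hι⟩ := P.nonempty_devMeasures
    exact ⟨ι, hι, 1, le_rfl, fun n _ => by simp⟩
  | insert i s his ih =>
    obtain ⟨ι₁, hι₁, n₁, hn₁, h₁⟩ := ih fun i hi => h i (Finset.mem_insert_of_mem hi)
    obtain ⟨-, h'⟩ := h i (Finset.mem_insert_self i s)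
    obtain ⟨n₂, ε, ι₂, hP, h₂⟩ := h' η hη
    have hι₂ := (P.mem_params _ hP).2.2
    refine ⟨_, P.add_mem _ hι₁ _ hι₂, max n₁ n₂, hn₁.trans (le_max_left _ _), fun n hn => ?_⟩
    have hn0 : (0 : ℝ) < n := by
      exact_mod_cast hn₁.trans ((le_max_left _ _).trans hn)
    obtain ⟨he, hm⟩ := h₂ n ((le_max_right _ _).trans hn)
    rw [ENNReal.ofReal_add ((P.isDevMeasure _ hι₁).pos _ hn0).le
      ((P.isDevMeasure _ hι₂).pos _ hn0).le]
    refine le_trans (measure_mono ?_) ((measure_union_le _ _).trans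
      (add_le_add (h₁ n ((le_max_left _ _).trans hn)) hm.le))
    rintro x ⟨k, hk, hx⟩
    rcases Finset.mem_insert.1 hk with rfl | hk
    · exact Or.inr (he.trans_lt hx)
    · exact Or.inl ⟨k, hk, hx⟩

/-- Approximation of `w` from below by a sum of indicators of `w ≥ η, w ≥ 2η, …`. -/
theorem sum_step_bounds {w η : ℝ} (hη : 0 < η) (hw : 0 ≤ w) (r : ℕ) :
    (∑ i ∈ Finset.range r, if (i + 1 : ℝ) * η ≤ w then η else 0) ≤ w ∧
      (w ≤ r * η → w ≤ (∑ i ∈ Finset.range r, if (i + 1 : ℝ) * η ≤ w then η else 0) + η) := by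
  induction r with
  | zero => simpa [hw] using fun h => h.trans hη.le
  | succ r ih =>
    rw [Finset.sum_range_succ]
    by_cases hr : (r + 1 : ℝ) * η ≤ w
    · have hall : ∑ i ∈ Finset.range r, (if (i + 1 : ℝ) * η ≤ w then η else 0) = r * η := by
        rw [Finset.sum_congr rfl fun i hi => if_pos ?_]
        · simp
        · refine le_trans ?_ hr
          have : (i : ℝ) ≤ r := by exact_mod_cast (Finset.mem_range.1 hi).le
          gcongr
      rw [if_pos hr, hall]
      push_cast
      constructor
      · linarith
      · intro h; linarith
    · rw [if_neg hr, add_zero]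
      refine ⟨ih.1, fun _ => ?_⟩
      by_cases hr' : w ≤ r * η
      · exact ih.2 hr'
      · rw [not_le] at hr hr'
        have hall : ∑ i ∈ Finset.range r, (if (i + 1 : ℝ) * η ≤ w then η else 0) = r * η := by
          rw [Finset.sum_congr rfl fun i hi => if_pos ?_]
          · simp
          · refine le_trans ?_ hr'.le
            have : (i + 1 : ℝ) ≤ r := by exact_mod_cast Finset.mem_range.1 hi
            gcongr
        rw [hall]; linarith

variable [IsProbabilityMeasure μ] {A : X → Matrix (Fin m) (Fin m) ℝ}

/-- A fiber large deviation estimate from above, uniform in a neighbourhood of `A`. The truncated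
logarithm of `‖A^{(q)}‖`, for a large fixed `q`, is approximated from above by a linear combination
of observables in `Ξ` with nearly the same mean, and the base large deviation estimates control
their Birkhoff averages. -/
theorem exists_upper_ldt (hA : IsBddCocycle μ A) (hT : MeasurePreserving T μ μ) (hm : 1 ≤ m)
    {Ξ : Set (X → ℝ)} {P : LDTParameters} (compatible : Compatible μ T Ξ A)
    (base : ∀ ξ ∈ Ξ, BaseLDT T μ P ξ) {c : ℝ} (h : lyap μ T A 1 < c) :
    ∃ δ, 0 < δ ∧ ∃ ι ∈ P.devMeasures, ∃ n₀ : ℕ, 1 ≤ n₀ ∧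
      ∀ B : X → Matrix (Fin m) (Fin m) ℝ, (∀ᵐ x ∂μ, ‖B x - A x‖ ≤ δ) → ∀ n : ℕ, n₀ ≤ n →
        μ {x | Real.exp (n * c) < ‖iter T B n x‖} ≤ ENNReal.ofReal (ι n) := by
  obtain ⟨C, hC1, hC⟩ := hA.bdd
  obtain ⟨q, hqc, hq⟩ := (((hA.tendsto_finiteLyap hT hm).eventually_lt_const h).and
    (eventually_ge_atTop 1)).exists
  obtain ⟨t, ht, -, hI⟩ := hA.exists_trunc hT hq hqc
  have hq' : (0 : ℝ) < q := by exact_mod_cast hq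
  obtain ⟨D, hD⟩ := hA.norm_iter_le hT q
  set V : X → ℝ := fun x => Real.log (max ‖iter T A q x‖ t) / q
  have hVi : Integrable V μ :=
    (integrable_log_max (hA.measurable_norm_iter hT q) hD ht).div_const _
  rw [← integral_div] at hI
  change ∫ x, V x ∂μ < c at hI
  -- the errors add up to `6 η`: two from the discretization of `V` and the passage from `A` to `B`,
  -- two from the observables, one from `E / n`, and one to spare
  obtain ⟨η, hη, hηc⟩ : ∃ η, 0 < η ∧ ∫ x, V x ∂μ + 6 * η ≤ c :=
    ⟨(c - ∫ x, V x ∂μ) / 6, by linarith, by linarith⟩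
  set v₀ := Real.log t / q
  have hV₀ : ∀ x, v₀ ≤ V x := fun x => by
    have := Real.log_le_log ht (le_max_right ‖iter T A q x‖ t)
    simp only [v₀, V]; gcongr
  obtain ⟨r, hr⟩ := exists_nat_ge ((Real.log (max D t) / q - v₀) / η)
  rw [div_le_iff₀ hη] at hr
  have hVr : ∀ᵐ x ∂μ, V x - v₀ ≤ r * η := by
    filter_upwards [hD] with x hx
    have : V x ≤ Real.log (max D t) / q := by
      simp only [V]
      have := (log_max_mem ht hx).2
      gcongr
    linarith
  set F : ℕ → Set X := fun i => {x | Real.exp (q * (v₀ + (i + 1) * η)) ≤ ‖iter T A q x‖}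
  have hF : ∀ (i : ℕ) x, (i + 1 : ℝ) * η ≤ V x - v₀ ↔ x ∈ F i := fun i x => by
    have e : t < Real.exp (q * (v₀ + (i + 1) * η)) := by
      rw [← Real.log_lt_iff_lt_exp ht]
      have : q * (v₀ + (i + 1) * η) = Real.log t + q * ((i + 1) * η) := by
        simp only [v₀]; field_simp
      rw [this]
      have : 0 < q * ((i + 1) * η) := by positivity
      linarith
    simp only [F, Set.mem_ofPred_eq, V, le_sub_iff_add_le, le_div_iff₀ hq']
    rw [Real.le_log_iff_exp_le (lt_max_of_lt_right ht), add_comm, mul_comm, le_max_iff,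
      or_iff_left (not_le.2 e)]
  have hFm : ∀ i, MeasurableSet (F i) := fun i =>
    measurableSet_le measurable_const (hA.measurable_norm_iter hT q)
  have hstep : ∀ x, (∑ i ∈ Finset.range r, if (i + 1 : ℝ) * η ≤ V x - v₀ then η else 0)
      = η * ∑ i ∈ Finset.range r, (F i).indicator (fun _ => (1 : ℝ)) x := fun x => by
    rw [Finset.mul_sum]
    refine Finset.sum_congr rfl fun i _ => ?_
    simp only [hF, Set.indicator_apply, mul_ite, mul_one, mul_zero]
  have hlow : v₀ + η * ∑ i ∈ Finset.range r, μ.real (F i) ≤ ∫ x, V x ∂μ := by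
    have h1 : ∀ i, Integrable (fun x => (F i).indicator (fun _ => (1 : ℝ)) x) μ := fun i =>
      (integrable_const (1 : ℝ)).indicator (hFm i)
    have h2 : ∫ x, (v₀ + η * ∑ i ∈ Finset.range r, (F i).indicator (fun _ => (1 : ℝ)) x) ∂μ
        ≤ ∫ x, V x ∂μ := by
      refine integral_mono ((integrable_const _).add
        ((integrable_finsetSum _ fun i _ => h1 i).const_mul _)) hVi fun x => ?_
      have := (sum_step_bounds hη (sub_nonneg.2 (hV₀ x)) r).1
      rw [hstep] at this
      dsimp only
      linarith
    rw [integral_add (integrable_const _) ((integrable_finsetSum _ fun i _ => h1 i).const_mul _),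
      integral_const_mul, integral_finsetSum _ fun i _ => h1 i] at h2
    simpa [integral_indicator_one, hFm, integral_indicator] using h2
  -- the observables dominating the indicators
  set τ : ℝ := 1 / (r + 1)
  have hτ : 0 < τ := by positivity
  have hrτ : r * τ ≤ 1 := by
    simp only [τ]
    rw [mul_one_div, div_le_one (by positivity)]
    linarith
  have hξ : ∀ i, ∃ ξ ∈ Ξ, (∀ x, (F i).indicator (fun _ => (1 : ℝ)) x ≤ ξ x) ∧
      Integrable ξ μ ∧ ∫ x, ξ x ∂μ ≤ μ.real (F i) + τ := fun i =>
    compatible q (F i) (generateSetAlgebra.base _ ⟨q, le_rfl, _, (Real.exp_pos _).le, Or.inr rfl⟩)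
      τ hτ
  choose ξ hξΞ hξ1 hξi hξ2 using hξ
  obtain ⟨ι, hι, n₁, hn₁, hdev⟩ := exists_baseLDT_finset (Finset.range r) ξ
    (fun i _ => base _ (hξΞ i)) hτ
  set K := (C + 1) ^ q / t
  have hK : 0 < K := by positivity
  obtain ⟨δ, hδ0, hδ1, hδ⟩ : ∃ δ, 0 < δ ∧ δ ≤ 1 ∧ K * δ ≤ η := by
    refine ⟨min 1 (η / K), lt_min one_pos (by positivity), min_le_left _ _, ?_⟩
    calc K * min 1 (η / K) ≤ K * (η / K) := by gcongr; exact min_le_right _ _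
      _ = η := by field_simp
  set E := 2 * q * Real.log (C + 1) - Real.log t
  obtain ⟨n₂, hn₂⟩ := exists_nat_ge (E / η)
  rw [div_le_iff₀ hη] at hn₂
  refine ⟨δ, hδ0, ι, hι, max n₁ (max n₂ q), hn₁.trans (le_max_left _ _), fun B hBA n hn => ?_⟩
  have hnn₁ : n₁ ≤ n := (le_max_left _ _).trans hn
  have hnq : q ≤ n := (le_max_right _ _).trans ((le_max_right _ _).trans hn)
  have hnn₂ : (n₂ : ℝ) ≤ n := by
    exact_mod_cast (le_max_left _ _).trans ((le_max_right _ _).trans hn)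
  have hn0 : (0 : ℝ) < n := hq'.trans_le (by exact_mod_cast hnq)
  refine (measure_mono_ae ?_).trans (hdev n hnn₁)
  filter_upwards [ae_orbit_bounds hT hδ1 hC hBA,
    ae_forall_iterate hT (ae_norm_iter_sub_le hT hC1 hδ1 hC hBA q),
    ae_forall_iterate hT hVr] with x hx hxq hxV hexp
  by_contra hgood
  change ¬ ∃ i ∈ Finset.range r, _ at hgood
  push Not at hgood
  have hpos : 0 < ‖iter T B n x‖ := (Real.exp_pos _).trans hexp
  have hexp' : n * c < Real.log ‖iter T B n x‖ := (Real.lt_log_iff_exp_lt hpos).2 hexp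
  have h1 := log_norm_iter_le (by linarith : 1 ≤ C + 1) (fun j => (hx j).2.1) hq hnq ht hpos
  have h2 : ∀ j, Real.log (max ‖iter T B q (T^[j] x)‖ t) / q
      ≤ v₀ + 2 * η + η * ∑ i ∈ Finset.range r, ξ i (T^[j] x) := fun j => by
    have h3 := (le_abs_self _).trans
      (abs_log_max_sub_le (r := ‖iter T B q (T^[j] x)‖) (s := ‖iter T A q (T^[j] x)‖) ht)
    have h4 : |‖iter T B q (T^[j] x)‖ - ‖iter T A q (T^[j] x)‖| / t ≤ q * η := by
      rw [div_le_iff₀ ht]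
      refine (hxq j).trans ?_
      have e : q * (C + 1) ^ q * δ = q * (K * δ) * t := by simp only [K]; field_simp
      rw [e]
      gcongr
    have h5 : Real.log (max ‖iter T B q (T^[j] x)‖ t) / q ≤ V (T^[j] x) + η := by
      rw [div_le_iff₀ hq', add_mul, div_mul_cancel₀ _ hq'.ne']
      linarith
    have h6 := (sum_step_bounds hη (sub_nonneg.2 (hV₀ (T^[j] x))) r).2 (hxV j)
    rw [hstep] at h6
    have h7 : η * ∑ i ∈ Finset.range r, (F i).indicator (fun _ => (1 : ℝ)) (T^[j] x)
        ≤ η * ∑ i ∈ Finset.range r, ξ i (T^[j] x) :=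
      mul_le_mul_of_nonneg_left (Finset.sum_le_sum fun i _ => hξ1 i _) hη.le
    linarith
  have h8 : (∑ j ∈ Finset.range n, Real.log (max ‖iter T B q (T^[j] x)‖ t)) / q
      ≤ n * (v₀ + 2 * η) + η * ∑ i ∈ Finset.range r, ∑ j ∈ Finset.range n, ξ i (T^[j] x) := by
    rw [Finset.sum_div, Finset.sum_comm, Finset.mul_sum]
    refine (Finset.sum_le_sum fun j _ => h2 j).trans_eq ?_
    rw [Finset.sum_add_distrib, Finset.sum_const, Finset.card_range, nsmul_eq_mul]
  have h9 : ∑ i ∈ Finset.range r, ∑ j ∈ Finset.range n, ξ i (T^[j] x)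
      ≤ ∑ i ∈ Finset.range r, n * (μ.real (F i) + 2 * τ) := by
    refine Finset.sum_le_sum fun i hi => ?_
    have h10 := (le_abs_self _).trans (hgood i hi)
    have h11 : (1 / (n : ℝ)) * ∑ j ∈ Finset.range n, ξ i (T^[j] x) ≤ μ.real (F i) + 2 * τ := by
      linarith [hξ2 i]
    rw [one_div, inv_mul_le_iff₀ hn0] at h11
    exact h11
  rw [← Finset.mul_sum, Finset.sum_add_distrib] at h9
  simp only [Finset.sum_const, Finset.card_range, nsmul_eq_mul] at h9
  set S := ∑ i ∈ Finset.range r, μ.real (F i)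
  have h12 : η * ∑ i ∈ Finset.range r, ∑ j ∈ Finset.range n, ξ i (T^[j] x)
      ≤ n * (η * S + 2 * η) := by
    refine (mul_le_mul_of_nonneg_left h9 hη.le).trans ?_
    have : η * (n * (S + r * (2 * τ))) = n * (η * S + 2 * η * (r * τ)) := by ring
    rw [this]
    have : 2 * η * (r * τ) ≤ 2 * η := by
      nlinarith
    gcongr
  have h13 : E ≤ n * η := hn₂.trans (by gcongr)
  have h14 : n * (v₀ + η * S) ≤ n * (c - 6 * η) := by gcongr; linarith
  nlinarith

end UpperLDT

/-! ### Finite scale continuity -/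

section Holder

/-- The exponent `1 - 1/p`, which is `1` for `p = ∞`. -/
theorem holderExponent_pos {p : ℝ≥0∞} (hp : 1 < p) : 0 < 1 - (1 / p).toReal := by
  have : (1 / p).toReal < 1 := by
    rw [← ENNReal.toReal_one]
    refine (ENNReal.toReal_lt_toReal ?_ ENNReal.one_ne_top).2 ?_
    · rw [one_div]; exact ENNReal.inv_ne_top.2 (zero_lt_one.trans hp).ne'
    · rw [one_div]; exact ENNReal.inv_lt_one.2 hp
  linarith

variable {X : Type*} [MeasurableSpace X] {μ : Measure X} [IsProbabilityMeasure μ]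

/-- A function bounded by `e` off a small set, and by `K` in `L^p`, has a small integral. -/
theorem abs_integral_le_of_ae_notMem {f : X → ℝ} (hf : Integrable f μ) {p : ℝ≥0∞} (hp : 1 ≤ p)
    {K e s : ℝ} (hK : 0 ≤ K) (he : 0 ≤ e) (hs : 0 ≤ s) (hfK : eLpNorm f p μ ≤ ENNReal.ofReal K)
    {S : Set X} (hS : μ S ≤ ENNReal.ofReal s) (h : ∀ᵐ x ∂μ, x ∉ S → |f x| ≤ e) :
    |∫ x, f x ∂μ| ≤ e + K * s ^ (1 - (1 / p).toReal) := by
  set S' := toMeasurable μ S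
  have hSm : MeasurableSet S' := measurableSet_toMeasurable μ S
  have hS' : μ S' ≤ ENNReal.ofReal s := by rwa [measure_toMeasurable]
  have hθ : 0 ≤ 1 - (1 / p).toReal := by
    have : (1 / p).toReal ≤ 1 := by
      refine ENNReal.toReal_le_of_le_ofReal zero_le_one ?_
      rw [ENNReal.ofReal_one, one_div]
      exact ENNReal.inv_le_one.2 hp
    linarith
  have h1 : |∫ x in S', f x ∂μ| ≤ K * s ^ (1 - (1 / p).toReal) := by
    have h2 := eLpNorm_le_eLpNorm_mul_rpow_measure_univ hp (hf.aestronglyMeasurable.restrict (s := S'))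
    have h3 : eLpNorm f 1 (μ.restrict S') ≤ ENNReal.ofReal (K * s ^ (1 - (1 / p).toReal)) := by
      refine h2.trans ?_
      rw [ENNReal.ofReal_mul hK, ← ENNReal.ofReal_rpow_of_nonneg hs hθ,
        Measure.restrict_apply_univ]
      have e1 : 1 / ENNReal.toReal 1 - 1 / p.toReal = 1 - (1 / p).toReal := by
        simp
      rw [e1]
      exact mul_le_mul' ((eLpNorm_mono_measure f Measure.restrict_le_self).trans hfK)
        (ENNReal.rpow_le_rpow hS' hθ)
    rw [eLpNorm_one_eq_lintegral_enorm] at h3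
    have h4 := (enorm_integral_le_lintegral_enorm (μ := μ.restrict S') f).trans h3
    rw [Real.enorm_eq_ofReal_abs] at h4
    exact (ENNReal.ofReal_le_ofReal_iff (by positivity)).1 h4
  have h2 : |∫ x in S'ᶜ, f x ∂μ| ≤ e := by
    have h3 : ‖∫ x in S'ᶜ, f x ∂μ‖ ≤ e * μ.real S'ᶜ := by
      refine norm_setIntegral_le_of_norm_le_const_ae (measure_lt_top _ _) ?_
      rw [ae_restrict_iff' hSm.compl]
      filter_upwards [h] with x hx hxS
      exact hx fun hxS' => hxS (subset_toMeasurable μ S hxS')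
    refine h3.trans ?_
    calc e * μ.real S'ᶜ ≤ e * 1 := by gcongr; exact measureReal_le_one
      _ = e := mul_one e
  rw [← integral_add_compl hSm hf]
  exact (abs_add_le _ _).trans (by linarith)

end Holder

section FiniteScale

variable {X : Type*} [MeasurableSpace X] {μ : Measure X} {T : X → X} {m : ℕ}

/-- The finite scale exponent `L_1^{(n)}` as a real number; meaningful if `log ‖A^{(n)}‖` is
integrable. -/
noncomputable def realLyap (μ : Measure X) (T : X → X) (A : X → Matrix (Fin m) (Fin m) ℝ) (n : ℕ) :
    ℝ := (∫ x, Real.log ‖iter T A n x‖ ∂μ) / n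

/-- The functions `(1/n) log ‖A^{(n)}‖` are bounded by `K` in `L^p`. -/
def LpBounded (μ : Measure X) (T : X → X) (p : ℝ≥0∞) (K : ℝ≥0) (A : X → Matrix (Fin m) (Fin m) ℝ) :
    Prop :=
  ∀ n : ℕ, 1 ≤ n → eLpNorm (fun x => (logNorm T A n x).abs) p μ ≤ K

variable [IsProbabilityMeasure μ] {A B : X → Matrix (Fin m) (Fin m) ℝ} {p : ℝ≥0∞} {K : ℝ≥0}

theorem LpBounded.logIntegrable (h : LpBounded μ T p K A) (hA : IsBddCocycle μ A)
    (hT : MeasurePreserving T μ μ) (hp : 1 ≤ p) {n : ℕ} (hn : 1 ≤ n) :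
    LogIntegrable μ fun x => ‖iter T A n x‖ := by
  have hm := hA.measurable_norm_iter hT n
  have hmeas : Measurable fun x => (logNorm T A n x).abs := by
    have h1 : Measurable fun s : ℝ => (elog s / (n : EReal)).abs := by
      have e : (fun s : ℝ => (elog s / (n : EReal)).abs)
          = fun s => if s ∈ Ioi (0 : ℝ) then ENNReal.ofReal |Real.log s / n| else ∞ := by
        ext s
        split_ifs with hs
        · rw [elog_div_of_pos hs, EReal.abs_def]
        · rw [elog_div_of_nonpos (not_lt.1 hs) hn, EReal.abs_bot]
      rw [e]
      exact Measurable.ite measurableSet_Ioi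
        (Real.measurable_log.div_const _).abs.ennreal_ofReal measurable_const
    exact h1.comp hm
  have h1 := (eLpNorm_le_eLpNorm_of_exponent_le hp hmeas.aestronglyMeasurable).trans (h n hn)
  rw [eLpNorm_one_eq_lintegral_enorm] at h1
  simp only [enorm_eq_self] at h1
  have hpos : ∀ᵐ x ∂μ, 0 < ‖iter T A n x‖ := by
    filter_upwards [ae_lt_top hmeas (h1.trans_lt ENNReal.coe_lt_top).ne] with x hx
    by_contra hc
    rw [logNorm, elog_div_of_nonpos (not_lt.1 hc) hn, EReal.abs_bot] at hx
    exact lt_irrefl _ hx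
  have hn' : (n : ℝ) ≠ 0 := by
    have : (0 : ℝ) < n := by exact_mod_cast hn
    exact this.ne'
  have hi : Integrable (fun x => Real.log ‖iter T A n x‖ / n) μ := by
    refine ⟨((Real.measurable_log.comp hm).div_const _).aestronglyMeasurable, ?_⟩
    refine lt_of_le_of_lt (lintegral_mono_ae ?_) (h1.trans_lt ENNReal.coe_lt_top)
    filter_upwards [hpos] with x hx
    rw [logNorm, elog_div_of_pos hx, EReal.abs_def, Real.enorm_eq_ofReal_abs]
  refine ⟨hpos, (hi.mul_const n).congr (ae_of_all _ fun x => ?_)⟩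
  field_simp

theorem LpBounded.eLpNorm_le (h : LpBounded μ T p K A) (hA : IsBddCocycle μ A)
    (hT : MeasurePreserving T μ μ) (hp : 1 ≤ p) {n : ℕ} (hn : 1 ≤ n) :
    eLpNorm (fun x => Real.log ‖iter T A n x‖ / n) p μ ≤ K := by
  refine le_trans (eLpNorm_mono_enorm_ae ?_) (h n hn)
  filter_upwards [(h.logIntegrable hA hT hp hn).pos] with x hx
  rw [logNorm, elog_div_of_pos hx, EReal.abs_def, enorm_eq_self, Real.enorm_eq_ofReal_abs]

theorem LpBounded.finiteLyap_eq (h : LpBounded μ T p K A) (hA : IsBddCocycle μ A)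
    (hT : MeasurePreserving T μ μ) (hp : 1 ≤ p) {n : ℕ} (hn : 1 ≤ n) :
    finiteLyap μ T A n = (realLyap μ T A n : EReal) :=
  ACT.finiteLyap_eq (h.logIntegrable hA hT hp hn)

theorem LpBounded.lintegral_le (h : LpBounded μ T p K A) (hA : IsBddCocycle μ A)
    (hT : MeasurePreserving T μ μ) (hp : 1 ≤ p) {n : ℕ} (hn : 1 ≤ n) :
    ∫⁻ x, ENNReal.ofReal |Real.log ‖iter T A n x‖ / n| ∂μ ≤ K := by
  have h1 := eLpNorm_le_eLpNorm_of_exponent_le (μ := μ) hp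
    ((h.logIntegrable hA hT hp hn).integrable.div_const (n : ℝ)).aestronglyMeasurable
  rw [eLpNorm_one_eq_lintegral_enorm] at h1
  simp only [Real.enorm_eq_ofReal_abs] at h1
  exact h1.trans (h.eLpNorm_le hA hT hp hn)

theorem LpBounded.abs_realLyap_le (h : LpBounded μ T p K A) (hA : IsBddCocycle μ A)
    (hT : MeasurePreserving T μ μ) (hp : 1 ≤ p) {n : ℕ} (hn : 1 ≤ n) : |realLyap μ T A n| ≤ K := by
  have h1 := enorm_integral_le_lintegral_enorm (μ := μ) fun x => Real.log ‖iter T A n x‖ / n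
  simp only [Real.enorm_eq_ofReal_abs] at h1
  have h2 := h1.trans (h.lintegral_le hA hT hp hn)
  rw [integral_div] at h2
  rw [← ENNReal.ofReal_coe_nnreal] at h2
  exact (ENNReal.ofReal_le_ofReal_iff K.2).1 h2

/-- Chebyshev's inequality for `(1/n) log ‖A^{(n)}‖`. -/
theorem LpBounded.measure_lt_le (h : LpBounded μ T p K A) (hA : IsBddCocycle μ A)
    (hT : MeasurePreserving T μ μ) (hp : 1 ≤ p) {n : ℕ} (hn : 1 ≤ n) {R : ℝ} (hR : 0 < R) :
    μ {x | Real.log ‖iter T A n x‖ / n < -R} ≤ ENNReal.ofReal (K / R) := by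
  have hn' : (0 : ℝ) < n := by exact_mod_cast hn
  have h1 := h.lintegral_le hA hT hp hn
  have h2 := mul_meas_ge_le_lintegral₀ (μ := μ) (f := fun x =>
    ENNReal.ofReal |Real.log ‖iter T A n x‖ / n|)
    (((Real.measurable_log.comp (hA.measurable_norm_iter hT n)).div_const
      (n : ℝ)).abs.ennreal_ofReal.aemeasurable) (ENNReal.ofReal R)
  have h3 : μ {x | Real.log ‖iter T A n x‖ / n < -R}
      ≤ μ {x | ENNReal.ofReal R ≤ ENNReal.ofReal |Real.log ‖iter T A n x‖ / n|} :=
    measure_mono fun x hx => ENNReal.ofReal_le_ofReal (by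
      have hx : Real.log ‖iter T A n x‖ / n < -R := hx
      have := neg_abs_le (Real.log ‖iter T A n x‖ / n)
      linarith)
  rw [ENNReal.ofReal_div_of_pos hR, ENNReal.le_div_iff_mul_le
    (Or.inl (by simpa using hR)) (Or.inl ENNReal.ofReal_ne_top), ENNReal.ofReal_coe_nnreal, mul_comm]
  exact ((mul_le_mul_right h3 _).trans h2).trans h1

theorem abs_log_sub_log_le {a b r : ℝ} (hr : 0 < r) (ha : r ≤ a) (hb : r ≤ b) :
    |Real.log a - Real.log b| ≤ |a - b| / r := by
  have := abs_log_max_sub_le (r := a) (s := b) hr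
  rwa [max_eq_left ha, max_eq_left hb] at this

/-- Comparison of the finite scale exponents of two nearby cocycles, in terms of the measure of the
sets where their iterates are small. -/
theorem abs_realLyap_sub_le (hT : MeasurePreserving T μ μ) (hp : 1 ≤ p) (hA : IsBddCocycle μ A)
    (hB : IsBddCocycle μ B) (hAK : LpBounded μ T p K A) (hBK : LpBounded μ T p K B) {n : ℕ}
    (hn : 1 ≤ n) {R s d : ℝ} (hs : 0 ≤ s)
    (hAs : μ {x | Real.log ‖iter T A n x‖ / n < -R} ≤ ENNReal.ofReal s)
    (hBs : μ {x | Real.log ‖iter T B n x‖ / n < -R} ≤ ENNReal.ofReal s) (hd0 : 0 ≤ d)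
    (hd : ∀ᵐ x ∂μ, |‖iter T A n x‖ - ‖iter T B n x‖| ≤ d) :
    |realLyap μ T A n - realLyap μ T B n|
      ≤ d * Real.exp (n * R) + 2 * K * (2 * s) ^ (1 - (1 / p).toReal) := by
  have hn' : (1 : ℝ) ≤ n := by exact_mod_cast hn
  have hn0 : (0 : ℝ) < n := zero_lt_one.trans_le hn'
  have hLA := hAK.logIntegrable hA hT hp hn
  have hLB := hBK.logIntegrable hB hT hp hn
  have hiA : Integrable (fun x => Real.log ‖iter T A n x‖ / n) μ := hLA.integrable.div_const _
  have hiB : Integrable (fun x => Real.log ‖iter T B n x‖ / n) μ := hLB.integrable.div_const _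
  set S := {x | Real.log ‖iter T A n x‖ / n < -R} ∪ {x | Real.log ‖iter T B n x‖ / n < -R}
  have hS : μ S ≤ ENNReal.ofReal (2 * s) := by
    rw [two_mul, ENNReal.ofReal_add hs hs]
    exact (measure_union_le _ _).trans (add_le_add hAs hBs)
  have hnorm : eLpNorm (fun x => Real.log ‖iter T A n x‖ / n - Real.log ‖iter T B n x‖ / n) p μ
      ≤ ENNReal.ofReal (2 * K) := by
    refine (eLpNorm_sub_le hiA.aestronglyMeasurable hiB.aestronglyMeasurable hp).trans ?_
    rw [two_mul, ENNReal.ofReal_add K.coe_nonneg K.coe_nonneg, ENNReal.ofReal_coe_nnreal]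
    exact add_le_add (hAK.eLpNorm_le hA hT hp hn) (hBK.eLpNorm_le hB hT hp hn)
  have key := abs_integral_le_of_ae_notMem (hiA.sub hiB) hp (K := 2 * K) (e := d * Real.exp (n * R))
    (s := 2 * s) (by positivity) (by positivity) (by positivity) hnorm hS ?_
  · simp only [Pi.sub_apply] at key
    rw [integral_sub hiA hiB, integral_div, integral_div] at key
    exact key
  · filter_upwards [hLA.pos, hLB.pos, hd] with x hxA hxB hxd hxS
    have hlow : ∀ {a : ℝ}, 0 < a → ¬ Real.log a / n < -R → Real.exp (-(n * R)) ≤ a :=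
      fun {a} ha h => by
        rw [← Real.le_log_iff_exp_le ha]
        rw [not_lt, le_div_iff₀ hn0] at h
        linarith
    have h1 := hlow hxA fun h => hxS (Or.inl h)
    have h2 := hlow hxB fun h => hxS (Or.inr h)
    simp only [Pi.sub_apply]
    rw [← sub_div, abs_div, abs_of_pos hn0]
    refine (div_le_self (abs_nonneg _) hn').trans
      ((abs_log_sub_log_le (Real.exp_pos _) h1 h2).trans ?_)
    rw [Real.exp_neg, div_inv_eq_mul]
    gcongr

/-- Continuity of the finite scale exponents at a fixed scale. -/
theorem exists_abs_realLyap_sub_le (hT : MeasurePreserving T μ μ) (hp : 1 < p)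
    (hA : IsBddCocycle μ A) (hAK : LpBounded μ T p K A) {n : ℕ} (hn : 1 ≤ n) {η : ℝ} (hη : 0 < η) :
    ∃ δ, 0 < δ ∧ ∀ B : X → Matrix (Fin m) (Fin m) ℝ, IsBddCocycle μ B → LpBounded μ T p K B →
      (∀ᵐ x ∂μ, ‖B x - A x‖ ≤ δ) → |realLyap μ T B n - realLyap μ T A n| ≤ η := by
  obtain ⟨C, hC1, hC⟩ := hA.bdd
  set θ := 1 - (1 / p).toReal
  have hθ : 0 < θ := holderExponent_pos hp
  obtain ⟨R, hR0, hR⟩ : ∃ R : ℝ, 0 < R ∧ 2 * K * (2 * (K / R)) ^ θ ≤ η / 2 := by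
    have h1 : Tendsto (fun R : ℝ => 2 * K * (2 * (K / R)) ^ θ) atTop (𝓝 (2 * K * (2 * 0) ^ θ)) := by
      have h2 : Tendsto (fun R : ℝ => (K : ℝ) / R) atTop (𝓝 0) := tendsto_const_nhds.div_atTop tendsto_id
      exact ((h2.const_mul 2).rpow_const (Or.inr hθ.le)).const_mul _
    rw [mul_zero, Real.zero_rpow hθ.ne', mul_zero] at h1
    obtain ⟨R, h3, h4⟩ := ((h1.eventually_lt_const (half_pos hη)).and (eventually_gt_atTop 0)).exists
    exact ⟨R, h4, h3.le⟩
  set D := n * (C + 1) ^ n * Real.exp (n * R)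
  have hD : 0 < D := by
    have : (0 : ℝ) < n := by exact_mod_cast hn
    positivity
  obtain ⟨δ, hδ0, hδ1, hδ⟩ : ∃ δ, 0 < δ ∧ δ ≤ 1 ∧ D * δ ≤ η / 2 := by
    refine ⟨min 1 (η / 2 / D), lt_min one_pos (by positivity), min_le_left _ _, ?_⟩
    calc D * min 1 (η / 2 / D) ≤ D * (η / 2 / D) := by gcongr; exact min_le_right _ _
      _ = η / 2 := by field_simp
  refine ⟨δ, hδ0, fun B hB hBK hAB => ?_⟩
  have := abs_realLyap_sub_le hT hp.le hB hA hBK hAK hn (s := K / R) (by positivity)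
    (hBK.measure_lt_le hB hT hp.le hn hR0) (hAK.measure_lt_le hA hT hp.le hn hR0)
    (d := n * (C + 1) ^ n * δ) (by positivity) (ae_norm_iter_sub_le hT hC1 hδ1 hC hAB n)
  refine this.trans ?_
  have e : n * (C + 1) ^ n * δ * Real.exp (n * R) = D * δ := by simp only [D]; ring
  rw [e]
  linarith

end FiniteScale

/-! ### The avalanche principle for four blocks -/

section Blocks

variable {d : ℕ}

theorem abs_log_le_of_abs_sub_one_le {z u : ℝ} (hu : u ≤ 1 / 2) (hz : |z - 1| ≤ u) :
    0 < z ∧ |Real.log z| ≤ 2 * u := by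
  rw [abs_le] at hz
  have hz0 : 0 < z := by linarith
  refine ⟨hz0, abs_le.2 ⟨?_, ?_⟩⟩
  · refine le_trans ?_ (Real.one_sub_inv_le_log_of_pos hz0)
    have h0 : 0 ≤ u := by linarith
    have : z⁻¹ ≤ 1 + 2 * u := by
      rw [inv_le_iff_one_le_mul₀ hz0]
      nlinarith
    linarith
  · linarith [Real.log_le_sub_one_of_pos hz0]

/-- The three block estimate in logarithmic form. -/
theorem log_norm_three_blocks (hd : 2 ≤ d) {a g b : Matrix (Fin d) (Fin d) ℝ} {W α β s t c : ℝ}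
    (hg : 0 < ‖g‖) (hW : ‖wedge 2 g‖ ≤ Real.exp W) (ha : ‖a‖ ≤ Real.exp α) (hb : ‖b‖ ≤ Real.exp β)
    (hag : Real.exp s ≤ ‖a * g‖) (hgb : Real.exp t ≤ ‖g * b‖) (hc : W + α + β ≤ s + t - c)
    (hc' : Real.exp (-c) ≤ 1 / 8) :
    0 < ‖a * g * b‖ ∧ |Real.log ‖a * g * b‖ + Real.log ‖g‖ - Real.log ‖a * g‖ - Real.log ‖g * b‖|
      ≤ 8 * Real.exp (-c) := by
  have hag0 : 0 < ‖a * g‖ := (Real.exp_pos _).trans_le hag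
  have hgb0 : 0 < ‖g * b‖ := (Real.exp_pos _).trans_le hgb
  have h1 := abs_norm_mul_sub_le hd a g b
  have h2 : 4 * ‖wedge 2 g‖ * ‖a‖ * ‖b‖ ≤ 4 * Real.exp (-c) * (‖a * g‖ * ‖g * b‖) := by
    have h3 : ‖wedge 2 g‖ * ‖a‖ * ‖b‖ ≤ Real.exp W * Real.exp α * Real.exp β := by gcongr
    have h4 : Real.exp s * Real.exp t ≤ ‖a * g‖ * ‖g * b‖ := by gcongr
    have h5 : Real.exp W * Real.exp α * Real.exp β
        ≤ Real.exp (-c) * (Real.exp s * Real.exp t) := by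
      rw [← Real.exp_add, ← Real.exp_add, ← Real.exp_add, ← Real.exp_add, Real.exp_le_exp]
      linarith
    have h6 : Real.exp (-c) * (Real.exp s * Real.exp t)
        ≤ Real.exp (-c) * (‖a * g‖ * ‖g * b‖) := by gcongr
    linarith
  have hprod : 0 < ‖a * g‖ * ‖g * b‖ := mul_pos hag0 hgb0
  have h3 : |‖g‖ * ‖a * g * b‖ / (‖a * g‖ * ‖g * b‖) - 1| ≤ 4 * Real.exp (-c) := by
    rw [div_sub_one hprod.ne', abs_div, abs_of_pos hprod, div_le_iff₀ hprod]
    exact h1.trans h2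
  obtain ⟨h4, h5⟩ := abs_log_le_of_abs_sub_one_le (by linarith) h3
  have h6 : 0 < ‖a * g * b‖ := by
    refine lt_of_le_of_ne (norm_nonneg _) fun h0 => ?_
    rw [← h0, mul_zero, zero_div] at h4
    exact lt_irrefl _ h4
  refine ⟨h6, ?_⟩
  rw [Real.log_div (by positivity) hprod.ne', Real.log_mul hg.ne' h6.ne',
    Real.log_mul hag0.ne' hgb0.ne'] at h5
  convert h5 using 1
  · congr 1; ring
  · ring

/-- If four consecutive blocks have growth rate nearly `L`, so have the three products of two
neighbours, and the middle blocks have a gap between their first two singular values, then the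
norm of the product of the four blocks is determined by the norms of the blocks and of these
products up to an exponentially small relative error. -/
theorem log_norm_four_blocks (hd : 2 ≤ d) {g₀ g₁ g₂ g₃ : Matrix (Fin d) (Fin d) ℝ} {n L η γ : ℝ}
    (hn : 0 ≤ n) (hηγ : 40 * η ≤ γ)
    (h₀ : 0 < ‖g₀‖) (h₁ : 0 < ‖g₁‖) (h₂ : 0 < ‖g₂‖) (h₃ : 0 < ‖g₃‖)
    (h₀₁ : 0 < ‖g₁ * g₀‖) (h₁₂ : 0 < ‖g₂ * g₁‖) (h₂₃ : 0 < ‖g₃ * g₂‖)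
    (l₀ : |Real.log ‖g₀‖ - n * L| ≤ 2 * n * η) (l₁ : |Real.log ‖g₁‖ - n * L| ≤ 2 * n * η)
    (l₂ : |Real.log ‖g₂‖ - n * L| ≤ 2 * n * η) (l₃ : |Real.log ‖g₃‖ - n * L| ≤ 2 * n * η)
    (l₀₁ : |Real.log ‖g₁ * g₀‖ - 2 * n * L| ≤ 4 * n * η)
    (l₁₂ : |Real.log ‖g₂ * g₁‖ - 2 * n * L| ≤ 4 * n * η)
    (l₂₃ : |Real.log ‖g₃ * g₂‖ - 2 * n * L| ≤ 4 * n * η)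
    (w₁ : ‖wedge 2 g₁‖ ≤ Real.exp (n * (2 * L - γ)))
    (w₂ : ‖wedge 2 g₂‖ ≤ Real.exp (n * (2 * L - γ)))
    (hlarge : Real.exp (-(n * γ / 2 - 1)) ≤ 1 / 8) :
    |Real.log ‖g₃ * g₂ * (g₁ * g₀)‖ + Real.log ‖g₁‖ + Real.log ‖g₂‖
      - Real.log ‖g₁ * g₀‖ - Real.log ‖g₂ * g₁‖ - Real.log ‖g₃ * g₂‖|
      ≤ 16 * Real.exp (-(n * γ / 2 - 1)) := by
  have hnη : 40 * (n * η) ≤ n * γ := by nlinarith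
  rw [abs_le] at l₀ l₁ l₂ l₃ l₀₁ l₁₂ l₂₃
  have up : ∀ {g : Matrix (Fin d) (Fin d) ℝ} {s : ℝ}, 0 < ‖g‖ → Real.log ‖g‖ ≤ s → ‖g‖ ≤ Real.exp s :=
    fun hg hs => (Real.log_le_iff_le_exp hg).1 hs
  have lo : ∀ {g : Matrix (Fin d) (Fin d) ℝ} {s : ℝ}, 0 < ‖g‖ → s ≤ Real.log ‖g‖ → Real.exp s ≤ ‖g‖ :=
    fun hg hs => (Real.le_log_iff_exp_le hg).1 hs
  have hnγ : 1 ≤ n * γ / 2 := by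
    have := Real.add_one_le_exp (-(n * γ / 2 - 1))
    by_contra hc
    have : 1 ≤ Real.exp (-(n * γ / 2 - 1)) := Real.one_le_exp (by linarith)
    linarith
  obtain ⟨p1, e1⟩ := log_norm_three_blocks hd (a := g₂) (g := g₁) (b := g₀)
    (W := n * (2 * L - γ)) (α := n * L + 2 * n * η) (β := n * L + 2 * n * η)
    (s := 2 * n * L - 4 * n * η) (t := 2 * n * L - 4 * n * η) (c := n * γ / 2 - 1) h₁ w₁
    (up h₂ (by linarith)) (up h₀ (by linarith)) (lo h₁₂ (by linarith)) (lo h₀₁ (by linarith))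
    (by nlinarith) hlarge
  have e1' := abs_le.1 e1
  rw [Matrix.mul_assoc] at p1 e1 e1'
  obtain ⟨p2, e2⟩ := log_norm_three_blocks hd (a := g₃) (g := g₂) (b := g₁ * g₀)
    (W := n * (2 * L - γ)) (α := n * L + 2 * n * η) (β := 2 * n * L + 4 * n * η)
    (s := 2 * n * L - 4 * n * η) (t := 3 * n * L - 10 * n * η - 1) (c := n * γ / 2 - 1) h₂ w₂
    (up h₃ (by linarith)) (up h₀₁ (by linarith)) (lo h₂₃ (by linarith)) (lo p1 (by linarith))
    (by nlinarith) hlarge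
  have e2' := abs_le.1 e2
  rw [abs_le]
  constructor <;> linarith

end Blocks

/-! ### Doubling the scale -/

section Doubling

variable {X : Type*} [MeasurableSpace X] {μ : Measure X} {T : X → X} {d : ℕ}

theorem measure_preimage_le (hT : MeasurePreserving T μ μ) (S : Set X) (j : ℕ) :
    μ (T^[j] ⁻¹' S) ≤ μ S := by
  rw [← measure_toMeasurable S,
    ← (hT.iterate j).measure_preimage (measurableSet_toMeasurable μ S).nullMeasurableSet]
  exact measure_mono (preimage_mono (subset_toMeasurable μ S))

variable [IsProbabilityMeasure μ] {B : X → Matrix (Fin d) (Fin d) ℝ} {p : ℝ≥0∞} {K : ℝ≥0}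

/-- The avalanche principle for four blocks of length `n`, integrated. The deviation in
`log_norm_four_blocks` is exponentially small off a set of measure `12 σ`, which consists of the
points with a large deviation at one of the four blocks; on this set the `L^p` bound is used. -/
theorem abs_realLyap_four_le (hT : MeasurePreserving T μ μ) (hp : 1 ≤ p) (hd : 2 ≤ d)
    (hB : IsBddCocycle μ B) (hBK : LpBounded μ T p K B) {n : ℕ} (hn : 1 ≤ n) {L η γ σ : ℝ}
    (hσ : 0 ≤ σ) (hηγ : 40 * η ≤ γ)
    (dev₁ : μ {x | η < |Real.log ‖iter T B n x‖ / n - realLyap μ T B n|} ≤ ENNReal.ofReal σ)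
    (dev₂ : μ {x | η < |Real.log ‖iter T B (2 * n) x‖ / (2 * n : ℕ) - realLyap μ T B (2 * n)|}
      ≤ ENNReal.ofReal σ)
    (dev₃ : μ {x | Real.exp (n * (2 * L - γ)) < ‖wedge 2 (iter T B n x)‖} ≤ ENNReal.ofReal σ)
    (hL₁ : |realLyap μ T B n - L| ≤ η) (hL₂ : |realLyap μ T B (2 * n) - L| ≤ η)
    (hlarge : Real.exp (-(n * γ / 2 - 1)) ≤ 1 / 8) :
    |4 * realLyap μ T B (4 * n) + 2 * realLyap μ T B n - 6 * realLyap μ T B (2 * n)|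
      ≤ 16 * Real.exp (-(n * γ / 2 - 1)) + 12 * K * (12 * σ) ^ (1 - (1 / p).toReal) := by
  have hn' : (1 : ℝ) ≤ n := by exact_mod_cast hn
  have hn0 : (0 : ℝ) < n := zero_lt_one.trans_le hn'
  set φ : ℕ → X → ℝ := fun k x => Real.log ‖iter T B k x‖ / k
  have hφi : ∀ k, 1 ≤ k → Integrable (φ k) μ := fun k hk =>
    (hBK.logIntegrable hB hT hp hk).integrable.div_const _
  have hφint : ∀ k, ∫ x, φ k x ∂μ = realLyap μ T B k := fun k => integral_div _ _
  have hφK : ∀ k, 1 ≤ k → eLpNorm (φ k) p μ ≤ ENNReal.ofReal K := fun k hk => by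
    rw [ENNReal.ofReal_coe_nnreal]; exact hBK.eLpNorm_le hB hT hp hk
  have hci : ∀ k, 1 ≤ k → ∀ j, Integrable (fun x => φ k (T^[j] x)) μ := fun k hk j =>
    (hT.iterate j).integrable_comp_of_integrable (hφi k hk)
  have hcint : ∀ k, 1 ≤ k → ∀ j, ∫ x, φ k (T^[j] x) ∂μ = realLyap μ T B k := fun k hk j => by
    rw [integral_comp_iterate hT (hφi k hk).aestronglyMeasurable, hφint]
  have hcK : ∀ k, 1 ≤ k → ∀ j, eLpNorm (fun x => φ k (T^[j] x)) p μ ≤ ENNReal.ofReal K :=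
    fun k hk j => (eLpNorm_comp_measurePreserving (hφi k hk).aestronglyMeasurable
      (hT.iterate j)).trans_le (hφK k hk)
  have h2n : 1 ≤ 2 * n := by omega
  have h4n : 1 ≤ 4 * n := by omega
  -- the deviation in the avalanche principle, as a combination of functions bounded in `L^p`
  set I : Fin 6 → ℕ × ℕ := ![(4 * n, 0), (n, n), (n, n + n), (2 * n, 0), (2 * n, n), (2 * n, n + n)]
  set w : Fin 6 → ℝ := ![4, 1, 1, -2, -2, -2]
  have hI : ∀ i, 1 ≤ (I i).1 := by
    intro i; fin_cases i <;> simp [I] <;> omega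
  set f : X → ℝ := fun x => ∑ i, w i * φ (I i).1 (T^[(I i).2] x)
  have hwi : ∀ i, Integrable (fun x => w i * φ (I i).1 (T^[(I i).2] x)) μ := fun i =>
    (hci _ (hI i) _).const_mul _
  have hf : Integrable f μ := integrable_finsetSum _ fun i _ => hwi i
  have hfint : ∫ x, f x ∂μ
      = 4 * realLyap μ T B (4 * n) + 2 * realLyap μ T B n - 6 * realLyap μ T B (2 * n) := by
    simp only [f]
    rw [integral_finsetSum _ fun i _ => hwi i]
    simp only [integral_const_mul, hcint _ (hI _)]
    simp only [Fin.sum_univ_succ, w, I]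
    simp
    ring
  have hfK : eLpNorm f p μ ≤ ENNReal.ofReal (12 * K) := by
    have h1 : f = ∑ i, fun x => w i * φ (I i).1 (T^[(I i).2] x) := by
      ext x; simp [f]
    rw [h1]
    refine (eLpNorm_sum_le (fun i _ => (hwi i).aestronglyMeasurable) hp).trans ?_
    have h2 : ∀ i, eLpNorm (fun x => w i * φ (I i).1 (T^[(I i).2] x)) p μ
        ≤ ENNReal.ofReal (|w i| * K) := fun i => by
      have := eLpNorm_const_smul (w i) (fun x => φ (I i).1 (T^[(I i).2] x)) p μ
      refine (le_of_eq this).trans ?_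
      rw [ENNReal.ofReal_mul (abs_nonneg _), Real.enorm_eq_ofReal_abs]
      exact mul_le_mul_right (hcK _ (hI i) _) _
    refine (Finset.sum_le_sum fun i _ => h2 i).trans ?_
    rw [← ENNReal.ofReal_sum_of_nonneg fun i _ => by positivity, ← Finset.sum_mul]
    refine le_of_eq (congrArg _ (congrArg (· * (K : ℝ)) ?_))
    simp only [Fin.sum_univ_succ, w]
    simp
    norm_num
  set G : Set X := {x | η < |Real.log ‖iter T B n x‖ / n - realLyap μ T B n|} ∪
    {x | η < |Real.log ‖iter T B (2 * n) x‖ / (2 * n : ℕ) - realLyap μ T B (2 * n)|} ∪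
    {x | Real.exp (n * (2 * L - γ)) < ‖wedge 2 (iter T B n x)‖}
  have hG : μ G ≤ ENNReal.ofReal (3 * σ) := by
    rw [show 3 * σ = σ + σ + σ by ring, ENNReal.ofReal_add (by positivity) hσ,
      ENNReal.ofReal_add hσ hσ]
    exact (measure_union_le _ _).trans
      (add_le_add ((measure_union_le _ _).trans (add_le_add dev₁ dev₂)) dev₃)
  set S : Set X := ⋃ i ∈ Finset.range 4, T^[i * n] ⁻¹' G
  have hS : μ S ≤ ENNReal.ofReal (12 * σ) := by
    refine (measure_biUnion_finset_le _ _).trans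
      ((Finset.sum_le_sum fun i _ => (measure_preimage_le hT G (i * n)).trans hG).trans ?_)
    rw [← ENNReal.ofReal_sum_of_nonneg fun i _ => by positivity]
    refine ENNReal.ofReal_le_ofReal ?_
    simp only [Finset.sum_const, Finset.card_range, nsmul_eq_mul]
    push_cast
    linarith
  rw [← hfint]
  refine abs_integral_le_of_ae_notMem hf hp (by positivity) (by positivity) (by positivity) hfK hS ?_
  have hL₁' := abs_le.1 hL₁
  have hL₂' := abs_le.1 hL₂
  filter_upwards [ae_forall_iterate hT (hBK.logIntegrable hB hT hp hn).pos,
    ae_forall_iterate hT (hBK.logIntegrable hB hT hp h2n).pos] with x hx1 hx2 hxS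
  have hgood : ∀ i, i < 4 → T^[i * n] x ∉ G := fun i hi hmem =>
    hxS (Set.mem_biUnion (Finset.mem_coe.2 (Finset.mem_range.2 hi)) hmem)
  have hone : ∀ i, i < 4 → |Real.log ‖iter T B n (T^[i * n] x)‖ - n * L| ≤ 2 * n * η := by
    intro i hi
    have h1 : |Real.log ‖iter T B n (T^[i * n] x)‖ / n - realLyap μ T B n| ≤ η :=
      not_lt.1 fun h => hgood i hi (Or.inl (Or.inl h))
    have h2 : |Real.log ‖iter T B n (T^[i * n] x)‖ / n - L| ≤ 2 * η := by
      rw [abs_le] at h1 ⊢; constructor <;> linarith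
    have e : Real.log ‖iter T B n (T^[i * n] x)‖ - n * L
        = n * (Real.log ‖iter T B n (T^[i * n] x)‖ / n - L) := by field_simp
    rw [e, abs_mul, abs_of_pos hn0]
    calc n * _ ≤ n * (2 * η) := by gcongr
      _ = _ := by ring
  have htwo : ∀ i, i < 4 → |Real.log ‖iter T B (2 * n) (T^[i * n] x)‖ - 2 * n * L|
      ≤ 4 * n * η := by
    intro i hi
    have h1 : |Real.log ‖iter T B (2 * n) (T^[i * n] x)‖ / (2 * n : ℕ) - realLyap μ T B (2 * n)|
        ≤ η := not_lt.1 fun h => hgood i hi (Or.inl (Or.inr h))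
    push_cast at h1
    have h2 : |Real.log ‖iter T B (2 * n) (T^[i * n] x)‖ / (2 * n) - L| ≤ 2 * η := by
      rw [abs_le] at h1 ⊢; constructor <;> linarith
    have e : Real.log ‖iter T B (2 * n) (T^[i * n] x)‖ - 2 * n * L
        = 2 * n * (Real.log ‖iter T B (2 * n) (T^[i * n] x)‖ / (2 * n) - L) := by field_simp
    rw [e, abs_mul, abs_of_pos (by positivity : (0 : ℝ) < 2 * n)]
    calc 2 * (n : ℝ) * _ ≤ 2 * n * (2 * η) := by gcongr
      _ = _ := by ring
  have hw : ∀ i, i < 4 → ‖wedge 2 (iter T B n (T^[i * n] x))‖ ≤ Real.exp (n * (2 * L - γ)) :=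
    fun i hi => not_lt.1 fun h => hgood i hi (Or.inr h)
  have hpair : ∀ i, iter T B (2 * n) (T^[i * n] x)
      = iter T B n (T^[(i + 1) * n] x) * iter T B n (T^[i * n] x) := fun i => by
    rw [two_mul, iter_add, ← Function.iterate_add_apply, show n + i * n = (i + 1) * n by ring]
  have hquad : iter T B (4 * n) x = iter T B n (T^[3 * n] x) * iter T B n (T^[2 * n] x) *
      (iter T B n (T^[1 * n] x) * iter T B n (T^[0 * n] x)) := by
    have h1 := hpair 0
    have h2 := hpair 2
    simp only [zero_mul, Function.iterate_zero, id, zero_add] at h1 h2 ⊢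
    rw [show 4 * n = 2 * n + 2 * n by ring, iter_add, h2, h1]
  have key := log_norm_four_blocks hd hn0.le hηγ (hx1 _) (hx1 _) (hx1 _) (hx1 _)
    (hpair 0 ▸ hx2 (0 * n)) (hpair 1 ▸ hx2 (1 * n)) (hpair 2 ▸ hx2 (2 * n))
    (hone 0 (by norm_num)) (hone 1 (by norm_num)) (hone 2 (by norm_num)) (hone 3 (by norm_num))
    (hpair 0 ▸ htwo 0 (by norm_num)) (hpair 1 ▸ htwo 1 (by norm_num))
    (hpair 2 ▸ htwo 2 (by norm_num)) (hw 1 (by norm_num)) (hw 2 (by norm_num)) hlarge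
  rw [← hquad] at key
  have q0 := hpair 0
  have q1 := hpair 1
  have q2 := hpair 2
  norm_num only [zero_add, one_mul, zero_mul] at q0 q1 q2 key
  rw [← q0, ← q1, ← q2] at key
  have hfx : f x = (Real.log ‖iter T B (4 * n) x‖ + Real.log ‖iter T B n (T^[n] x)‖
      + Real.log ‖iter T B n (T^[2 * n] x)‖ - Real.log ‖iter T B (2 * n) (T^[0] x)‖
      - Real.log ‖iter T B (2 * n) (T^[n] x)‖ - Real.log ‖iter T B (2 * n) (T^[2 * n] x)‖) / n := by
    simp only [f, Fin.sum_univ_succ, w, I, φ]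
    simp [← two_mul]
    field_simp
    ring
  rw [hfx, abs_div, abs_of_pos hn0]
  exact (div_le_self (abs_nonneg _) hn').trans key

end Doubling

/-- If `e_{k+2} ≈ (3 e_{k+1} - e_k) / 2` with summable errors, then `2 e_{k+1} - e_k` is nearly
constant. The approximation is only required as long as the `e_k` stay close to `L`, which is part
of the conclusion: `e_{k+1}` is the mean of `e_k` and `2 e_{k+1} - e_k`. -/
theorem dyadic_recursion {e τ : ℕ → ℝ} {L η β : ℝ} (hβ : β < 1) (hη : 0 ≤ η) (hτ0 : ∀ k, 0 ≤ τ k)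
    (hτ : ∀ k, τ (k + 1) ≤ β * τ k) (hτη : τ 0 / (1 - β) ≤ η)
    (h0 : |e 0 - L| ≤ η / 6) (h1 : |e 1 - L| ≤ η / 6)
    (hstep : ∀ k, |e k - L| ≤ η → |e (k + 1) - L| ≤ η →
      |4 * e (k + 2) + 2 * e k - 6 * e (k + 1)| ≤ τ k) :
    (∀ k, |e k - L| ≤ η) ∧ ∀ l, Tendsto e atTop (𝓝 l) →
      ∀ k, |l - (2 * e (k + 1) - e k)| ≤ τ k / (1 - β) := by
  have hβ' : 0 < 1 - β := by linarith
  set ρ : ℕ → ℝ := fun k => τ k / (1 - β) / 2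
  have hρ0 : ∀ k, 0 ≤ ρ k := fun k => by have := hτ0 k; positivity
  have hρ : ∀ k, τ k / 2 + ρ (k + 1) ≤ ρ k := fun k => by
    have h2 : ρ (k + 1) ≤ β * τ k / (1 - β) / 2 := by simp only [ρ]; gcongr; exact hτ k
    have h3 : τ k / 2 + β * τ k / (1 - β) / 2 = ρ k := by simp only [ρ]; field_simp; ring
    linarith
  have hinv : ∀ k, |e k - L| ≤ η ∧ |2 * e (k + 1) - e k - L| ≤ η - ρ k := by
    intro k
    induction k with
    | zero =>
      rw [abs_le] at h0 h1 ⊢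
      have : ρ 0 ≤ η / 2 := by simp only [ρ]; linarith
      refine ⟨⟨by linarith, by linarith⟩, ?_⟩
      rw [zero_add, abs_le]
      constructor <;> linarith
    | succ k ih =>
      obtain ⟨i1, i2⟩ := ih
      have hk1 : |e (k + 1) - L| ≤ η := by
        have := hρ0 k
        rw [abs_le] at i1 i2 ⊢
        constructor <;> linarith
      refine ⟨hk1, ?_⟩
      have h2 := hstep k i1 hk1
      have h3 := hρ k
      rw [abs_le] at i2 h2 ⊢
      constructor <;> linarith
  refine ⟨fun k => (hinv k).1, fun l hl k => ?_⟩
  have hE : ∀ j, |(2 * e (k + j + 1) - e (k + j)) - (2 * e (k + 1) - e k)| ≤ ρ k - ρ (k + j) := by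
    intro j
    induction j with
    | zero => simp
    | succ j ih =>
      have h2 := hstep (k + j) (hinv _).1 (hinv _).1
      have h3 := hρ (k + j)
      rw [← add_assoc]
      rw [abs_le] at ih h2 ⊢
      constructor <;> linarith
  have hlim : Tendsto (fun j => |(2 * e (k + j + 1) - e (k + j)) - (2 * e (k + 1) - e k)|) atTop
      (𝓝 |(2 * l - l) - (2 * e (k + 1) - e k)|) := by
    have t1 : Tendsto (fun j => e (k + j)) atTop (𝓝 l) :=
      hl.comp (tendsto_atTop_mono (fun j => Nat.le_add_left j k) tendsto_id)
    have t2 : Tendsto (fun j => e (k + j + 1)) atTop (𝓝 l) :=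
      hl.comp (tendsto_atTop_mono (fun j => by simp only [id]; omega) tendsto_id)
    exact (((t2.const_mul 2).sub t1).sub_const _).abs
  have := le_of_tendsto' hlim fun j => (hE j).trans (sub_le_self _ (hρ0 _))
  rw [show 2 * l - l = l by ring] at this
  refine this.trans ?_
  have := hρ0 k
  have : τ k / (1 - β) = 2 * ρ k := by simp only [ρ]; ring
  linarith

/-! ### Spaces of cocycles -/

section Space

variable {X : Type*} [MeasurableSpace X] {μ : Measure X} {C : CocycleSpace μ} {T : X → X} {m : ℕ}

theorem CocycleSpace.isBddCocycle (A : C.Space m) : IsBddCocycle μ A.1 := by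
  refine ⟨C.measurable m A.1 A.2, max 1 (eLpNorm (fun x => ‖A.1 x‖) ∞ μ).toReal, le_max_left _ _, ?_⟩
  have h := C.bounded m A.1 A.2
  rw [eLpNorm_exponent_top] at h ⊢
  filter_upwards [ae_le_eLpNormEssSup (f := fun x => ‖A.1 x‖) (μ := μ)] with x hx
  refine le_max_of_le_right ?_
  rw [Real.enorm_eq_ofReal (norm_nonneg _)] at hx
  exact (ENNReal.ofReal_le_iff_le_toReal h.ne).1 hx

theorem CocycleSpace.ae_norm_sub_le (A B : C.Space m) :
    ∀ᵐ x ∂μ, ‖B.1 x - A.1 x‖ ≤ dist B A := by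
  have h := C.le_dist m A B
  rw [eLpNorm_exponent_top] at h
  filter_upwards [ae_le_eLpNormEssSup (f := fun x => ‖B.1 x - A.1 x‖) (μ := μ)] with x hx
  rw [Real.enorm_eq_ofReal (norm_nonneg _)] at hx
  exact (ENNReal.ofReal_le_ofReal_iff dist_nonneg).1 (hx.trans h)

theorem CocycleSpace.ae_norm_sub_le_of_le {A B : C.Space m} {h : ℝ} (hd : dist B A ≤ h) :
    ∀ᵐ x ∂μ, ‖B.1 x - A.1 x‖ ≤ h :=
  (CocycleSpace.ae_norm_sub_le A B).mono fun _ hx => hx.trans hd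

/-- The exterior power `∧_k` as a map between the spaces of cocycles. -/
noncomputable def CocycleSpace.wedgeMap (C : CocycleSpace μ) {m k : ℕ} (hk : 1 ≤ k) (hkm : k ≤ m)
    (A : C.Space m) : C.Space (m.choose k) :=
  ⟨fun x => wedge k (A.1 x), C.wedge_mem m k hk hkm A.1 A.2⟩

theorem CocycleSpace.wedgeMap_val {k : ℕ} (hk : 1 ≤ k) (hkm : k ≤ m) (A : C.Space m) :
    (C.wedgeMap hk hkm A).1 = fun x => wedge k (A.1 x) := rfl

theorem CocycleSpace.exists_dist_wedgeMap_le {k : ℕ} (hk : 1 ≤ k) (hkm : k ≤ m) (A : C.Space m) :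
    ∃ M δ : ℝ, 1 ≤ M ∧ 0 < δ ∧ ∀ B₁ B₂ : C.Space m, dist B₁ A < δ → dist B₂ A < δ →
      dist (C.wedgeMap hk hkm B₁) (C.wedgeMap hk hkm B₂) ≤ M * dist B₁ B₂ := by
  obtain ⟨K, t, ht, hK⟩ := C.wedge_locallyLipschitz m k hk hkm A
  obtain ⟨δ, hδ, hδt⟩ := Metric.mem_nhds_iff.1 ht
  refine ⟨max 1 K, δ, le_max_left _ _, hδ, fun B₁ B₂ h₁ h₂ => ?_⟩
  exact (hK.dist_le_mul B₁ (hδt h₁) B₂ (hδt h₂)).trans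
    (mul_le_mul_of_nonneg_right (le_max_right _ _) dist_nonneg)

theorem CocycleSpace.exists_dist_wedgeMap_lt {k : ℕ} (hk : 1 ≤ k) (hkm : k ≤ m) (A : C.Space m)
    {δ' : ℝ} (hδ' : 0 < δ') : ∃ δ : ℝ, 0 < δ ∧ ∀ B : C.Space m, dist B A < δ →
      dist (C.wedgeMap hk hkm B) (C.wedgeMap hk hkm A) < δ' := by
  obtain ⟨M, δ, hM, hδ, h⟩ := CocycleSpace.exists_dist_wedgeMap_le hk hkm A
  have hM0 : 0 < M := one_pos.trans_le hM
  refine ⟨min δ (δ' / M), lt_min hδ (by positivity), fun B hB => ?_⟩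
  refine (h B A (hB.trans_le (min_le_left _ _)) (by rwa [dist_self])).trans_lt ?_
  have := hB.trans_le (min_le_right _ _)
  rwa [lt_div_iff₀' hM0] at this

theorem CocycleSpace.exists_ae_norm_wedge_sub_le {k : ℕ} (hk : 1 ≤ k) (hkm : k ≤ m) (A : C.Space m)
    {δ' : ℝ} (hδ' : 0 < δ') : ∃ δ : ℝ, 0 < δ ∧ ∀ B : C.Space m, dist B A < δ →
      ∀ᵐ x ∂μ, ‖wedge k (B.1 x) - wedge k (A.1 x)‖ ≤ δ' := by
  obtain ⟨δ, hδ, h⟩ := CocycleSpace.exists_dist_wedgeMap_lt hk hkm A hδ'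
  refine ⟨δ, hδ, fun B hB => ?_⟩
  have h1 := CocycleSpace.ae_norm_sub_le_of_le (h B hB).le
  rwa [CocycleSpace.wedgeMap_val, CocycleSpace.wedgeMap_val] at h1

theorem UniformlyLpBounded.exists_lpBounded {p : ℝ≥0∞} {A : C.Space m}
    (h : UniformlyLpBounded T C p A) :
    ∃ δ : ℝ, 0 < δ ∧ ∃ K : ℝ≥0, ∀ B : C.Space m, dist B A < δ → LpBounded μ T p K B.1 := by
  obtain ⟨δ, hδ, K, hK⟩ := h
  exact ⟨δ, hδ, K, fun B hB n hn => (hK B hB n hn).le⟩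

/-- The uniform fiber-LDT estimate in terms of real valued logarithms. -/
theorem UniformFiberLDT.exists_measure_le [IsProbabilityMeasure μ] {P : LDTParameters}
    {A : C.Space m} (h : UniformFiberLDT T C P A) (hT : MeasurePreserving T μ μ) {p : ℝ≥0∞}
    (hp : 1 ≤ p) (hA : UniformlyLpBounded T C p A) {η : ℝ} (hη : 0 < η) :
    ∃ δ : ℝ, 0 < δ ∧ ∃ ι ∈ P.devMeasures, ∃ n₀ : ℕ, 1 ≤ n₀ ∧
      ∀ B : C.Space m, dist B A < δ → ∀ n : ℕ, n₀ ≤ n →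
        μ {x | η < |Real.log ‖iter T B.1 n x‖ / n - realLyap μ T B.1 n|} ≤ ENNReal.ofReal (ι n) := by
  obtain ⟨δ₁, hδ₁, K, hK⟩ := hA.exists_lpBounded
  obtain ⟨δ₂, hδ₂, n₀, ε, ι, hP, hL⟩ := h η hη
  obtain ⟨hn₀, -, hι⟩ := P.mem_params _ hP
  refine ⟨min δ₁ δ₂, lt_min hδ₁ hδ₂, ι, hι, n₀, hn₀, fun B hB n hn => ?_⟩
  have hBK := hK B (hB.trans_le (min_le_left _ _))
  have hBb := CocycleSpace.isBddCocycle B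
  obtain ⟨hε, hμ⟩ := hL B (hB.trans_le (min_le_right _ _)) n hn
  refine le_trans (measure_mono_ae ?_) hμ.le
  filter_upwards [(hBK.logIntegrable hBb hT hp (hn₀.trans hn)).pos] with x hx hxη
  have hxη : η < |Real.log ‖iter T B.1 n x‖ / n - realLyap μ T B.1 n| := hxη
  change ENNReal.ofReal (ε n) < (logNorm T B.1 n x - finiteLyap μ T B.1 n).abs
  rw [logNorm, elog_div_of_pos hx, hBK.finiteLyap_eq hBb hT hp (hn₀.trans hn), ← EReal.coe_sub,
    EReal.abs_def]
  exact (ENNReal.ofReal_lt_ofReal_iff (hη.trans hxη)).2 (hε.trans_lt hxη)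

end Space

/-! ### Rate of convergence near a cocycle with a gap -/

section Rate

variable {X : Type*} [MeasurableSpace X] {μ : Measure X} {T : X → X} {m : ℕ}

/-- Quantitative convergence of the finite scale exponents of `B` to `L_1(B) = l` along the scales
`2^k N`. All data other than `B` and `l` will be the same for all cocycles in a neighbourhood. -/
structure HasRate (μ : Measure X) (T : X → X) (p : ℝ≥0∞) (K : ℝ≥0) (ι : ℝ → ℝ) (N : ℕ) (D a : ℝ)
    (B : X → Matrix (Fin m) (Fin m) ℝ) (l : ℝ) : Prop where
  lpBounded : LpBounded μ T p K B
  measure_le : ∀ n : ℕ, N ≤ n →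
    μ {x | Real.log ‖iter T B n x‖ / n < -(K + 1)} ≤ ENNReal.ofReal (ι n)
  lyap_eq : lyap μ T B 1 = l
  abs_sub_le : ∀ k : ℕ,
    |l - (2 * realLyap μ T B (2 ^ (k + 1) * N) - realLyap μ T B (2 ^ k * N))|
      ≤ D * ι (a * (2 ^ k * N)) ^ (1 - (1 / p).toReal)

/-- Uniform quantitative convergence of the finite scale exponents to limits within `η` of `L`, in a
neighbourhood of `A`. -/
def UniformRate {C : CocycleSpace μ} (T : X → X) (P : LDTParameters) (p : ℝ≥0∞) (A : C.Space m)
    (L η : ℝ) : Prop :=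
  ∃ δ : ℝ, 0 < δ ∧ ∃ K : ℝ≥0, ∃ ι ∈ P.devMeasures, ∃ N : ℕ, 1 ≤ N ∧ ∃ D a : ℝ, 0 ≤ D ∧ 0 < a ∧
    a ≤ 1 ∧ ∀ B : C.Space m, dist B A < δ → ∃ l : ℝ, HasRate μ T p K ι N D a B.1 l ∧ |l - L| ≤ η

theorem measure_log_lt_le_of_dev {K η : ℝ} {n : ℕ} {B : X → Matrix (Fin m) (Fin m) ℝ} {s : ℝ≥0∞}
    (hη : η ≤ 1) (hK : |realLyap μ T B n| ≤ K)
    (h : μ {x | η < |Real.log ‖iter T B n x‖ / n - realLyap μ T B n|} ≤ s) :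
    μ {x | Real.log ‖iter T B n x‖ / n < -(K + 1)} ≤ s := by
  refine (measure_mono fun x hx => ?_).trans h
  have hx : Real.log ‖iter T B n x‖ / n < -(K + 1) := hx
  have h1 := neg_abs_le (Real.log ‖iter T B n x‖ / n - realLyap μ T B n)
  have h2 := (abs_le.1 hK).1
  change η < _
  linarith

variable [IsProbabilityMeasure μ]

/-- Cocycles that are bounded in `L^p` have a finite top exponent, since their finite scale exponents
are bounded. -/
theorem LpBounded.exists_lyap_eq {p : ℝ≥0∞} {K : ℝ≥0} {B : X → Matrix (Fin m) (Fin m) ℝ}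
    (h : LpBounded μ T p K B) (hB : IsBddCocycle μ B) (hT : MeasurePreserving T μ μ) (hp : 1 ≤ p)
    (hm : 1 ≤ m) : ∃ l : ℝ, lyap μ T B 1 = l ∧ Tendsto (realLyap μ T B) atTop (𝓝 l) := by
  have h1 := hB.tendsto_finiteLyap hT hm
  have hev : ∀ᶠ n in atTop, finiteLyap μ T B n = (realLyap μ T B n : EReal) := by
    filter_upwards [eventually_ge_atTop 1] with n hn using h.finiteLyap_eq hB hT hp hn
  have h2 := (tendsto_congr' hev).1 h1
  have hb : ⊥ < lyap μ T B 1 := by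
    refine (EReal.bot_lt_coe (-(K : ℝ))).trans_le (ge_of_tendsto h2 ?_)
    filter_upwards [eventually_ge_atTop 1] with n hn
    exact EReal.coe_le_coe_iff.2 (abs_le.1 (h.abs_realLyap_le hB hT hp hn)).1
  obtain ⟨l, hl⟩ := EReal_exists_coe hb (hB.lyap_one_lt_top hT hm)
  exact ⟨l, hl, EReal.tendsto_coe.1 (hl ▸ h2)⟩

/-- The error in the integrated avalanche principle is dominated by a power of the deviation
measure. -/
theorem IsDevMeasure.exists_error_le {ι : ℝ → ℝ} (h : IsDevMeasure ι) {γ θ K : ℝ} (hγ : 0 < γ)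
    (hθ : 0 < θ) (hK : 0 ≤ K) : ∃ D a t₀ : ℝ, 0 ≤ D ∧ 0 < a ∧ a ≤ 1 ∧ 0 < t₀ ∧ ∀ n : ℝ, t₀ ≤ n →
      16 * Real.exp (-(n * γ / 2 - 1)) + 12 * K * (12 * ι n) ^ θ ≤ D * ι (a * n) ^ θ := by
  obtain ⟨K₀, t₀, hK₀, ht₀, hexp⟩ := h.exists_exp_le
  set a := min 1 (γ / (2 * K₀ * θ))
  have ha : 0 < a := lt_min one_pos (by positivity)
  have ha1 : a ≤ 1 := min_le_left _ _
  have ha2 : K₀ * a * θ ≤ γ / 2 := by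
    calc K₀ * a * θ ≤ K₀ * (γ / (2 * K₀ * θ)) * θ := by gcongr; exact min_le_right _ _
      _ = γ / 2 := by field_simp
  refine ⟨16 * Real.exp 1 + 12 * K * 12 ^ θ, a, t₀ / a, by positivity, ha, ha1, by positivity,
    fun n hn => ?_⟩
  have hn1 : t₀ ≤ a * n := by rwa [div_le_iff₀' ha] at hn
  have hn0 : 0 < a * n := ht₀.trans_le hn1
  have hn0' : 0 < n := by
    by_contra hc
    exact absurd hn0 (not_lt.2 (mul_nonpos_of_nonneg_of_nonpos ha.le (not_lt.1 hc)))
  have h1 : Real.exp (-(n * γ / 2)) ≤ ι (a * n) ^ θ := by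
    calc Real.exp (-(n * γ / 2)) ≤ Real.exp (-(K₀ * (a * n)) * θ) := by
          rw [Real.exp_le_exp]
          have := mul_le_mul_of_nonneg_right ha2 hn0'.le
          linarith
      _ = Real.exp (-(K₀ * (a * n))) ^ θ := Real.exp_mul _ _
      _ ≤ ι (a * n) ^ θ := Real.rpow_le_rpow (Real.exp_pos _).le (hexp _ hn1) hθ.le
  have h2 : (12 * ι n) ^ θ ≤ 12 ^ θ * ι (a * n) ^ θ := by
    rw [Real.mul_rpow (by norm_num) (h.pos n hn0').le]
    gcongr
    · exact (h.pos n hn0').le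
    · exact h.le_of_le hn0 (by nlinarith)
  have h3 : Real.exp (-(n * γ / 2 - 1)) = Real.exp 1 * Real.exp (-(n * γ / 2)) := by
    rw [← Real.exp_add]; congr 1; ring
  rw [h3]
  calc _ ≤ 16 * (Real.exp 1 * ι (a * n) ^ θ) + 12 * K * (12 ^ θ * ι (a * n) ^ θ) := by gcongr
    _ = _ := by ring

/-- The requirements on the initial scale `N` in the induction over scales. -/
theorem IsDevMeasure.exists_scale {ι : ℝ → ℝ} (hι : IsDevMeasure ι) {γ θ a b L η : ℝ} (hγ : 0 < γ)
    (hθ : 0 < θ) (ha : 0 < a) (D : ℝ) {u : ℕ → ℝ} (hu : Tendsto u atTop (𝓝 L))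
    (hη : 0 < η) (n₀ : ℕ) (t₀ s₀ : ℝ) :
    ∃ N : ℕ, 1 ≤ N ∧ n₀ ≤ N ∧ t₀ ≤ N ∧ s₀ ≤ a * N ∧ Real.exp (-(N * γ / 2 - 1)) ≤ 1 / 8 ∧
      D * ι (a * N) ^ θ / b ≤ η ∧ |u N - L| ≤ η / 12 ∧ |u (2 * N) - L| ≤ η / 12 := by
  have hcast : Tendsto (fun N : ℕ => (N : ℝ)) atTop atTop := tendsto_natCast_atTop_atTop
  have haN : Tendsto (fun N : ℕ => a * (N : ℝ)) atTop atTop := hcast.const_mul_atTop ha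
  have t1 : Tendsto (fun N : ℕ => Real.exp (-(N * γ / 2 - 1))) atTop (𝓝 0) := by
    refine Real.tendsto_exp_neg_atTop_nhds_zero.comp ?_
    refine (tendsto_atTop_add_const_right atTop (-1 : ℝ)
      (hcast.const_mul_atTop (half_pos hγ))).congr fun N => ?_
    ring
  have t2 : Tendsto (fun N : ℕ => D * ι (a * N) ^ θ / b) atTop (𝓝 0) := by
    have := (((hι.tendsto.comp haN).rpow_const (Or.inr hθ.le)).const_mul D).div_const b
    simpa [Real.zero_rpow hθ.ne'] using this
  have t3 : ∀ᶠ N : ℕ in atTop, |u N - L| ≤ η / 12 :=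
    (Metric.tendsto_nhds.1 hu (η / 12) (by positivity)).mono fun n hn => hn.le
  have t4 : ∀ᶠ N : ℕ in atTop, |u (2 * N) - L| ≤ η / 12 :=
    (tendsto_id.const_mul_atTop' two_pos).eventually t3
  exact ((eventually_ge_atTop 1).and ((eventually_ge_atTop n₀).and
    ((hcast.eventually_ge_atTop t₀).and ((haN.eventually_ge_atTop s₀).and
    ((t1.eventually_le_const (by norm_num : (0 : ℝ) < 1 / 8)).and
    ((t2.eventually_le_const hη).and (t3.and t4))))))).exists

end Rate

section Gap

variable {X : Type*} [MeasurableSpace X] {μ : Measure X} {C : CocycleSpace μ} {T : X → X} {m : ℕ}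
  [IsProbabilityMeasure μ]

/-- The gap `L_1 > L_2` in the form `L_1(∧_2 A) < 2 L_1(A)`. -/
theorem exists_extLyap_two_lt (hm : 2 ≤ m) {A : X → Matrix (Fin m) (Fin m) ℝ}
    (hA : IsBddCocycle μ A) (hT : MeasurePreserving T μ μ) {L : ℝ} (hL : lyap μ T A 1 = L)
    (h : lyap μ T A 2 < lyap μ T A 1) :
    ∃ γ : ℝ, 0 < γ ∧ extLyap μ T A 2 < ((2 * L - γ : ℝ) : EReal) := by
  have h1 : extLyap μ T A 1 = L := (extLyap_one (by omega) A).trans hL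
  have h2 := lyap_succ_eq_sub hA hT (by omega) (k := 1) hm (by rw [h1]; exact EReal.bot_lt_coe L)
  rw [show 1 + 1 = 2 from rfl, h1] at h2
  rw [h2, hL] at h
  obtain ⟨r, hr1, hr2⟩ := EReal.lt_iff_exists_real_btwn.1 h
  have hr2' : r < L := EReal.coe_lt_coe_iff.1 hr2
  refine ⟨L - r, by linarith, ?_⟩
  rw [EReal.sub_lt_iff (Or.inl (EReal.coe_ne_bot L)) (Or.inl (EReal.coe_ne_top L)),
    ← EReal.coe_add] at hr1
  rwa [show 2 * L - (L - r) = r + L by ring]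

/-- The inductive step along the scales `2^k N` is the avalanche principle for four blocks. -/
theorem exists_hasRate_of_deviations (hT : MeasurePreserving T μ μ) {p : ℝ≥0∞} (hp : 1 < p)
    (hm : 2 ≤ m) {B : X → Matrix (Fin m) (Fin m) ℝ} (hB : IsBddCocycle μ B) {K : ℝ≥0}
    (hBK : LpBounded μ T p K B) {ι : ℝ → ℝ} (hι : IsDevMeasure ι) {N : ℕ} (hN1 : 1 ≤ N)
    {L η γ D a β : ℝ} (hη0 : 0 ≤ η) (hη1 : η ≤ 1) (hγ : 0 ≤ γ) (hηγ : 40 * η ≤ γ) (hD : 0 ≤ D)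
    (ha : 0 < a) (hβ0 : 0 ≤ β) (hβ : β ^ (1 - (1 / p).toReal) < 1)
    (herr : ∀ n : ℝ, N ≤ n → 16 * Real.exp (-(n * γ / 2 - 1))
      + 12 * K * (12 * ι n) ^ (1 - (1 / p).toReal) ≤ D * ι (a * n) ^ (1 - (1 / p).toReal))
    (hdouble : ∀ s, a * N ≤ s → ι (2 * s) ≤ β * ι s)
    (hNexp : Real.exp (-(N * γ / 2 - 1)) ≤ 1 / 8)
    (hNτ : D * ι (a * N) ^ (1 - (1 / p).toReal) / (1 - β ^ (1 - (1 / p).toReal)) ≤ η)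
    (hdev : ∀ n : ℕ, N ≤ n →
      μ {x | η < |Real.log ‖iter T B n x‖ / n - realLyap μ T B n|} ≤ ENNReal.ofReal (ι n))
    (hupp : ∀ n : ℕ, N ≤ n →
      μ {x | Real.exp (n * (2 * L - γ)) < ‖wedge 2 (iter T B n x)‖} ≤ ENNReal.ofReal (ι n))
    (h0 : |realLyap μ T B N - L| ≤ η / 6) (h1 : |realLyap μ T B (2 * N) - L| ≤ η / 6) :
    ∃ l : ℝ, HasRate μ T p K ι N (D / (1 - β ^ (1 - (1 / p).toReal))) a B l ∧ |l - L| ≤ η := by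
  set θ := 1 - (1 / p).toReal with hθdef
  have hθ : 0 < θ := holderExponent_pos hp
  have hιpos : ∀ k : ℕ, 0 < a * (2 ^ k * N) := fun k => by
    have : (0 : ℝ) < N := by exact_mod_cast hN1
    positivity
  have hNk : ∀ k : ℕ, N ≤ 2 ^ k * N := fun k => Nat.le_mul_of_pos_left _ (by positivity)
  have hNkr : ∀ k : ℕ, (N : ℝ) ≤ 2 ^ k * N := fun k => by exact_mod_cast hNk k
  have hτ : ∀ k : ℕ, D * ι (a * (2 ^ (k + 1) * N)) ^ θ ≤ β ^ θ * (D * ι (a * (2 ^ k * N)) ^ θ) := by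
    intro k
    have h1 : ι (a * (2 ^ (k + 1) * N)) ≤ β * ι (a * (2 ^ k * N)) := by
      have := hdouble (a * (2 ^ k * N)) (by gcongr; exact hNkr k)
      rwa [show 2 * (a * (2 ^ k * N)) = a * (2 ^ (k + 1) * (N : ℝ)) by ring] at this
    have h2 := Real.rpow_le_rpow (hι.pos _ (hιpos (k + 1))).le h1 hθ.le
    rw [Real.mul_rpow hβ0 (hι.pos _ (hιpos k)).le] at h2
    calc D * ι (a * (2 ^ (k + 1) * N)) ^ θ ≤ D * (β ^ θ * ι (a * (2 ^ k * N)) ^ θ) := by gcongr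
      _ = _ := by ring
  have hstep : ∀ k : ℕ, |realLyap μ T B (2 ^ k * N) - L| ≤ η →
      |realLyap μ T B (2 ^ (k + 1) * N) - L| ≤ η →
      |4 * realLyap μ T B (2 ^ (k + 2) * N) + 2 * realLyap μ T B (2 ^ k * N)
        - 6 * realLyap μ T B (2 ^ (k + 1) * N)| ≤ D * ι (a * (2 ^ k * N)) ^ θ := by
    intro k hk1 hk2
    obtain ⟨n, hn⟩ : ∃ n, n = 2 ^ k * N := ⟨_, rfl⟩
    have hNn : N ≤ n := hn ▸ hNk k
    have hn1 : 1 ≤ n := hN1.trans hNn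
    have hn0 : (0 : ℝ) < n := by exact_mod_cast hn1
    have e1 : 2 ^ (k + 1) * N = 2 * n := by rw [hn]; ring
    have e2 : 2 ^ (k + 2) * N = 4 * n := by rw [hn]; ring
    have e3 : (2 ^ k * N : ℝ) = n := by rw [hn]; push_cast; ring
    have hNnr : (N : ℝ) ≤ n := by exact_mod_cast hNn
    rw [← hn] at hk1
    rw [e1] at hk2
    rw [e1, e2, ← hn, e3]
    have dev₂ := (hdev (2 * n) (by omega)).trans (ENNReal.ofReal_le_ofReal
      (hι.le_of_le hn0 (by push_cast; linarith)))
    refine (abs_realLyap_four_le hT hp.le hm hB hBK hn1 (hι.pos n hn0).le hηγ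
      (hdev n hNn) dev₂ (hupp n hNn) hk1 hk2 ?_).trans (herr n hNnr)
    refine le_trans (Real.exp_le_exp.2 ?_) hNexp
    have := mul_le_mul_of_nonneg_right hNnr hγ
    linarith
  obtain ⟨l, hl, hBl⟩ := hBK.exists_lyap_eq hB hT hp.le (by omega)
  obtain ⟨hr1, hr2⟩ := dyadic_recursion (e := fun k => realLyap μ T B (2 ^ k * N))
    (τ := fun k => D * ι (a * (2 ^ k * N)) ^ θ) hβ hη0
    (fun k => mul_nonneg hD (Real.rpow_nonneg (hι.pos _ (hιpos k)).le _)) hτ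
    (by simpa using hNτ) (by simpa using h0) (by simpa using h1) hstep
  have hsub : Tendsto (fun k => realLyap μ T B (2 ^ k * N)) atTop (𝓝 l) := by
    refine hBl.comp (tendsto_atTop_mono (f := fun k => k) (fun k => ?_) tendsto_id)
    exact (Nat.lt_two_pow_self).le.trans (Nat.le_mul_of_pos_right _ hN1)
  refine ⟨l, ⟨hBK, fun n hn => measure_log_lt_le_of_dev hη1
    (hBK.abs_realLyap_le hB hT hp.le (hN1.trans hn)) (hdev n hn), hl, fun k => ?_⟩, ?_⟩
  · rw [div_mul_eq_mul_div]
    exact hr2 l hsub k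
  · exact le_of_tendsto' (hsub.sub_const L).abs hr1

/-- Near a cocycle with a gap `L_1 > L_2` the finite scale exponents converge at a uniform rate: the
top exponent of `∧_2 A` is smaller than `2 L_1(A)`, so that the avalanche principle applies. -/
theorem uniformRate_of_two_le (hT : MeasurePreserving T μ μ) {Ξ : Set (X → ℝ)} {P : LDTParameters}
    {p : ℝ≥0∞} (hp : 1 < p) (hm : 2 ≤ m) {A : C.Space m}
    (compatible : Compatible μ T Ξ fun x => wedge 2 (A.1 x))
    (base : ∀ ξ ∈ Ξ, BaseLDT T μ P ξ) (lpBounded : UniformlyLpBounded T C p A)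
    (fiber : UniformFiberLDT T C P A) (gap : lyap μ T A.1 2 < lyap μ T A.1 1) {L : ℝ}
    (hL : lyap μ T A.1 1 = L) {η : ℝ} (hη : 0 < η) :
    UniformRate T P p A L η := by
  have hA := CocycleSpace.isBddCocycle A
  have hm1 : 1 ≤ m := by omega
  set θ := 1 - (1 / p).toReal with hθdef
  have hθ : 0 < θ := holderExponent_pos hp
  obtain ⟨γ, hγ, hγL⟩ := exists_extLyap_two_lt hm hA hT hL gap
  -- smaller `η` to which the avalanche principle applies
  obtain ⟨η', hη'0, hη'η, hη'1, hη'γ⟩ : ∃ η' : ℝ, 0 < η' ∧ η' ≤ η ∧ η' ≤ 1 ∧ 40 * η' ≤ γ := by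
    refine ⟨min (min η 1) (γ / 40), by positivity, (min_le_left _ _).trans (min_le_left _ _),
      (min_le_left _ _).trans (min_le_right _ _), ?_⟩
    have := min_le_right (min η 1) (γ / 40)
    linarith
  obtain ⟨δK, hδK, K, hK⟩ := lpBounded.exists_lpBounded
  obtain ⟨δ₁, hδ₁, ι₁, hι₁, n₁, hn₁, hdev⟩ := fiber.exists_measure_le hT hp.le lpBounded hη'0
  obtain ⟨δ₂', hδ₂', ι₂, hι₂, n₂, hn₂, hupp⟩ := exists_upper_ldt (hA.wedge hm1 hm) hT
    (Nat.choose_pos hm) compatible base hγL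
  obtain ⟨δ₂, hδ₂, hwedge⟩ := CocycleSpace.exists_ae_norm_wedge_sub_le one_le_two hm A hδ₂'
  have hι₁' := P.isDevMeasure ι₁ hι₁
  have hι₂' := P.isDevMeasure ι₂ hι₂
  set ι : ℝ → ℝ := fun t => ι₁ t + ι₂ t with hιdef
  have hιP : ι ∈ P.devMeasures := P.add_mem ι₁ hι₁ ι₂ hι₂
  have hι := P.isDevMeasure ι hιP
  obtain ⟨D₀, a, t₀, hD₀, ha, ha1, ht₀, herr⟩ := hι.exists_error_le hγ hθ K.2
  obtain ⟨β, s₀, hβ0, hβ1, hs₀, hdouble⟩ := hι.exists_doubling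
  have hβθ0 : 0 < β ^ θ := Real.rpow_pos_of_pos hβ0 θ
  have hβθ : β ^ θ < 1 := Real.rpow_lt_one hβ0.le hβ1 hθ
  have hβθ' : 0 < 1 - β ^ θ := by linarith
  have hAK : LpBounded μ T p K A.1 := hK A (by rwa [dist_self])
  obtain ⟨L', hL', hAL⟩ := hAK.exists_lyap_eq hA hT hp.le hm1
  have hLL' : L' = L := EReal.coe_injective (hL'.symm.trans hL)
  rw [hLL'] at hAL
  -- choice of the initial scale
  obtain ⟨N, hN1, hNn, hNt, hNs, hNexp, hNτ, hNL, hNL2⟩ :=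
    hι.exists_scale hγ hθ ha (b := 1 - β ^ θ) D₀ hAL hη'0 (max n₁ n₂) t₀ s₀
  have hNn₁ : n₁ ≤ N := (le_max_left _ _).trans hNn
  have hNn₂ : n₂ ≤ N := (le_max_right _ _).trans hNn
  obtain ⟨δ₃, hδ₃, hc₃⟩ := exists_abs_realLyap_sub_le hT hp hA hAK hN1
    (η := η' / 12) (by positivity)
  obtain ⟨δ₄, hδ₄, hc₄⟩ := exists_abs_realLyap_sub_le hT hp hA hAK (n := 2 * N) (by omega)
    (η := η' / 12) (by positivity)
  refine ⟨min (min δK δ₁) (min δ₂ (min δ₃ δ₄)), by positivity, K, ι, hιP, N, hN1,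
    D₀ / (1 - β ^ θ), a, by positivity, ha, ha1, fun B hBA => ?_⟩
  simp only [lt_min_iff] at hBA
  obtain ⟨⟨hBK', hB₁⟩, hB₂, hB₃, hB₄⟩ := hBA
  have hB := CocycleSpace.isBddCocycle B
  have hBK := hK B hBK'
  have hpos : ∀ n : ℕ, N ≤ n → (0 : ℝ) < n := fun n hn => by exact_mod_cast hN1.trans hn
  have hdevι : ∀ n : ℕ, N ≤ n →
      μ {x | η' < |Real.log ‖iter T B.1 n x‖ / n - realLyap μ T B.1 n|} ≤ ENNReal.ofReal (ι n) :=
    fun n hn => (hdev B hB₁ n (hNn₁.trans hn)).trans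
      (ENNReal.ofReal_le_ofReal (le_add_of_nonneg_right (hι₂'.pos n (hpos n hn)).le))
  have huppι : ∀ n : ℕ, N ≤ n →
      μ {x | Real.exp (n * (2 * L - γ)) < ‖wedge 2 (iter T B.1 n x)‖} ≤ ENNReal.ofReal (ι n) := by
    intro n hn
    have h1 := hupp (fun x => wedge 2 (B.1 x)) (hwedge B hB₂) n (hNn₂.trans hn)
    simp only [iter_wedge] at h1
    exact h1.trans
      (ENNReal.ofReal_le_ofReal (le_add_of_nonneg_left (hι₁'.pos n (hpos n hn)).le))
  have hclose : ∀ {u v : ℝ}, |u - v| ≤ η' / 12 → |v - L| ≤ η' / 12 → |u - L| ≤ η' / 6 := by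
    intro u v h1 h2
    rw [abs_le] at h1 h2 ⊢
    constructor <;> linarith
  obtain ⟨l, hl, hlL⟩ := exists_hasRate_of_deviations hT hp hm hB hBK hι hN1 hη'0.le hη'1 hγ.le hη'γ
    hD₀ ha hβ0.le hβθ (fun n hn => herr n (hNt.trans hn)) (fun s hs => hdouble s (hNs.trans hs)) hNexp
    hNτ hdevι huppι
    (hclose (hc₃ B.1 hB hBK (CocycleSpace.ae_norm_sub_le_of_le hB₃.le)) hNL)
    (hclose (hc₄ B.1 hB hBK (CocycleSpace.ae_norm_sub_le_of_le hB₄.le)) hNL2)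
  exact ⟨l, hl, hlL.trans hη'η⟩

end Gap

/-! ### Cocycles in dimension one -/

section DimOne

variable {X : Type*} [MeasurableSpace X] {μ : Measure X} {T : X → X} {d : ℕ}

theorem norm_mul_of_dim_one (hd : d = 1) (g h : Matrix (Fin d) (Fin d) ℝ) :
    ‖g * h‖ = ‖g‖ * ‖h‖ := by
  subst hd
  have key : ∀ g : Matrix (Fin 1) (Fin 1) ℝ, ‖g‖ = |g 0 0| := fun g => by
    have e : g = Matrix.diagonal fun _ => g 0 0 := by
      ext i j
      rw [Subsingleton.elim i 0, Subsingleton.elim j 0, Matrix.diagonal_apply_eq]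
    conv_lhs => rw [e]
    rw [Matrix.l2_opNorm_diagonal, pi_norm_const, Real.norm_eq_abs]
  rw [key, key, key, Matrix.mul_apply, Fin.sum_univ_one, abs_mul]

variable [IsProbabilityMeasure μ] {B : X → Matrix (Fin d) (Fin d) ℝ} {p : ℝ≥0∞} {K : ℝ≥0}

theorem realLyap_eq_of_dim_one (hd : d = 1) (hB : IsBddCocycle μ B) (hT : MeasurePreserving T μ μ)
    (hp : 1 ≤ p) (hBK : LpBounded μ T p K B) {n : ℕ} (hn : 1 ≤ n) :
    realLyap μ T B n = realLyap μ T B 1 := by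
  have key : ∫ x, Real.log ‖iter T B n x‖ ∂μ = n * ∫ x, Real.log ‖iter T B 1 x‖ ∂μ := by
    induction n, hn using Nat.le_induction with
    | base => simp
    | succ n hn ih =>
      have h1 := hBK.logIntegrable hB hT hp le_rfl
      have h2 := hBK.logIntegrable hB hT hp hn
      have h3 := hBK.logIntegrable hB hT hp (Nat.le_add_left 1 n)
      have e : ∀ᵐ x ∂μ, Real.log ‖iter T B (n + 1) x‖
          = Real.log ‖iter T B 1 (T^[n] x)‖ + Real.log ‖iter T B n x‖ := by
        filter_upwards [h3.pos] with x hx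
        have e1 : iter T B (n + 1) x = iter T B 1 (T^[n] x) * iter T B n x := by
          rw [iter_one, iter]
        rw [e1, norm_mul_of_dim_one hd] at hx
        rw [e1, norm_mul_of_dim_one hd, Real.log_mul (left_ne_zero_of_mul hx.ne')
          (right_ne_zero_of_mul hx.ne')]
      have h4 : Integrable (fun x => Real.log ‖iter T B 1 (T^[n] x)‖) μ :=
        (hT.iterate n).integrable_comp_of_integrable h1.integrable
      rw [integral_congr_ae e, integral_add h4 h2.integrable, ih, integral_comp_iterate hT h1.integrable.aestronglyMeasurable n]
      push_cast
      ring
  have hn0 : (n : ℝ) ≠ 0 := by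
    have : (0 : ℝ) < n := by exact_mod_cast hn
    exact this.ne'
  rw [realLyap, key, realLyap]
  field_simp
  simp

theorem lyap_eq_of_dim_one (hd : d = 1) (hB : IsBddCocycle μ B) (hT : MeasurePreserving T μ μ)
    (hp : 1 ≤ p) (hBK : LpBounded μ T p K B) : lyap μ T B 1 = (realLyap μ T B 1 : EReal) := by
  obtain ⟨l, hl, hBl⟩ := hBK.exists_lyap_eq hB hT hp hd.ge
  rw [hl]
  congr 1
  refine tendsto_nhds_unique hBl (tendsto_const_nhds.congr' ?_)
  filter_upwards [eventually_ge_atTop 1] with n hn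
  exact (realLyap_eq_of_dim_one hd hB hT hp hBK hn).symm

variable {C : CocycleSpace μ}

theorem exists_abs_realLyap_sub_le_of_dim_one (hT : MeasurePreserving T μ μ) (hp : 1 < p)
    {A : C.Space d} (lpBounded : UniformlyLpBounded T C p A) {η : ℝ} (hη : 0 < η) :
    ∃ δ : ℝ, 0 < δ ∧ ∃ K : ℝ≥0, ∀ B : C.Space d, dist B A < δ → LpBounded μ T p K B.1 ∧
      |realLyap μ T B.1 1 - realLyap μ T A.1 1| ≤ η := by
  obtain ⟨δK, hδK, K, hK⟩ := lpBounded.exists_lpBounded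
  have hAK := hK A (by rwa [dist_self])
  obtain ⟨δ₁, hδ₁, h⟩ := exists_abs_realLyap_sub_le hT hp (CocycleSpace.isBddCocycle A) hAK le_rfl hη
  refine ⟨min δK δ₁, lt_min hδK hδ₁, K, fun B hB => ?_⟩
  have hBK := hK B (hB.trans_le (min_le_left _ _))
  exact ⟨hBK, h B.1 (CocycleSpace.isBddCocycle B) hBK
    (CocycleSpace.ae_norm_sub_le_of_le (hB.le.trans (min_le_right _ _)))⟩

/-- In dimension one `log ‖B^{(n)}‖` is a Birkhoff sum, so that all finite scale exponents agree and
the rate of convergence is trivial (`D = 0`). The fiber-LDT still serves to control the set where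
the iterates are small. -/
theorem uniformRate_of_dim_one (hd : d = 1) (hT : MeasurePreserving T μ μ) {P : LDTParameters}
    (hp : 1 < p) {A : C.Space d} (lpBounded : UniformlyLpBounded T C p A)
    (fiber : UniformFiberLDT T C P A) {L : ℝ} (hL : lyap μ T A.1 1 = L) {η : ℝ} (hη : 0 < η) :
    UniformRate T P p A L η := by
  obtain ⟨δ₁, hδ₁, K, hK⟩ := exists_abs_realLyap_sub_le_of_dim_one hT hp lpBounded hη
  obtain ⟨δ₂, hδ₂, ι, hι, N, hN, hdev⟩ := fiber.exists_measure_le hT hp.le lpBounded one_pos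
  have hAL : realLyap μ T A.1 1 = L := EReal.coe_injective
    ((lyap_eq_of_dim_one hd (CocycleSpace.isBddCocycle A) hT hp.le
      (hK A (by rwa [dist_self])).1).symm.trans hL)
  refine ⟨min δ₁ δ₂, lt_min hδ₁ hδ₂, K, ι, hι, N, hN, 0, 1, le_rfl, one_pos, le_rfl, fun B hB => ?_⟩
  have hBb := CocycleSpace.isBddCocycle B
  obtain ⟨hBK, hBA⟩ := hK B (hB.trans_le (min_le_left _ _))
  refine ⟨realLyap μ T B.1 1, ⟨hBK, fun n hn => measure_log_lt_le_of_dev le_rfl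
    (hBK.abs_realLyap_le hBb hT hp.le (hN.trans hn)) (hdev B (hB.trans_le (min_le_right _ _)) n hn),
    lyap_eq_of_dim_one hd hBb hT hp.le hBK, fun k => ?_⟩, by rwa [← hAL]⟩
  have hk : ∀ k : ℕ, 1 ≤ 2 ^ k * N := fun k => Nat.mul_pos (by positivity) hN
  rw [realLyap_eq_of_dim_one hd hBb hT hp.le hBK (hk k),
    realLyap_eq_of_dim_one hd hBb hT hp.le hBK (hk (k + 1)), zero_mul]
  simp [two_mul]

end DimOne

/-! ### Comparison of the top exponents of nearby cocycles -/

section Modulus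

variable {X : Type*} [MeasurableSpace X] {μ : Measure X} {T : X → X} {d : ℕ}

theorem lyap_one_eq_of_ae_norm_sub_le_zero (hT : MeasurePreserving T μ μ) (hd : 1 ≤ d)
    {B₁ B₂ : X → Matrix (Fin d) (Fin d) ℝ} (h₂ : IsBddCocycle μ B₂)
    (h : ∀ᵐ x ∂μ, ‖B₁ x - B₂ x‖ ≤ 0) : lyap μ T B₁ 1 = lyap μ T B₂ 1 := by
  obtain ⟨C, hC1, hC⟩ := h₂.bdd
  rw [lyap_one_eq_limsup hd, lyap_one_eq_limsup hd]
  congr 1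
  ext n
  refine eintegral_congr ?_
  filter_upwards [ae_norm_iter_sub_le hT hC1 zero_le_one hC h n] with x hx
  rw [mul_zero] at hx
  rw [logNorm, logNorm, sub_eq_zero.1 (abs_nonpos_iff.1 hx)]

variable [IsProbabilityMeasure μ]

theorem exists_dyadic_scale {N : ℕ} (hN : 1 ≤ N) {t : ℝ} (ht : 2 * N ≤ t) :
    ∃ k : ℕ, 2 * (2 ^ k * N : ℝ) ≤ t ∧ t < 4 * (2 ^ k * N) := by
  have hN0 : (0 : ℝ) < N := by exact_mod_cast hN
  obtain ⟨k, hk1, hk2⟩ := exists_nat_pow_near (x := t / (2 * N)) (y := 2)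
    (by rwa [le_div_iff₀ (by positivity), one_mul]) one_lt_two
  refine ⟨k, ?_, ?_⟩
  · rw [le_div_iff₀ (by positivity)] at hk1
    linarith
  · rw [div_lt_iff₀ (by positivity), pow_succ] at hk2
    linarith

/-- Comparison of the finite scale exponents of two cocycles at distance `h`, at a scale of the order
of `log (1/h)`. -/
theorem abs_realLyap_sub_le_of_scale (hT : MeasurePreserving T μ μ) {p : ℝ≥0∞} (hp : 1 < p)
    {K : ℝ≥0} {B₁ B₂ : X → Matrix (Fin d) (Fin d) ℝ} (h₁ : IsBddCocycle μ B₁)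
    (h₂ : IsBddCocycle μ B₂) (hK₁ : LpBounded μ T p K B₁) (hK₂ : LpBounded μ T p K B₂) {C h : ℝ}
    (hC1 : 1 ≤ C) (hC : ∀ᵐ x ∂μ, ‖B₂ x‖ ≤ C) (hh0 : 0 < h) (hh1 : h ≤ 1)
    (hh : ∀ᵐ x ∂μ, ‖B₁ x - B₂ x‖ ≤ h) {n : ℕ} (hn : 1 ≤ n) {s : ℝ} (hs : 0 ≤ s)
    (hs₁ : μ {x | Real.log ‖iter T B₁ n x‖ / n < -(K + 1)} ≤ ENNReal.ofReal s)
    (hs₂ : μ {x | Real.log ‖iter T B₂ n x‖ / n < -(K + 1)} ≤ ENNReal.ofReal s)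
    {Q : ℝ} (hQ : Q = K + Real.log (C + 1) + 2) (hnQ : 2 * Q * n ≤ Real.log (1 / h)) :
    |realLyap μ T B₁ n - realLyap μ T B₂ n|
      ≤ Real.exp (-(Real.log (1 / h) / 2)) + 2 * K * (2 * s) ^ (1 - (1 / p).toReal) := by
  have hd : 0 ≤ n * (C + 1) ^ n * h := by positivity
  refine (abs_realLyap_sub_le hT hp.le h₁ h₂ hK₁ hK₂ hn hs hs₁ hs₂ hd
    (ae_norm_iter_sub_le hT hC1 hh1 hC hh n)).trans ?_
  gcongr
  have e1 : (n : ℝ) ≤ Real.exp n := (Real.add_one_le_exp (n : ℝ)).trans' (by linarith)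
  have e2 : (C + 1) ^ n = Real.exp (n * Real.log (C + 1)) := by
    rw [Real.exp_nat_mul, Real.exp_log (by linarith)]
  have e3 : h = Real.exp (-Real.log (1 / h)) := by
    rw [one_div, Real.log_inv, neg_neg, Real.exp_log hh0]
  calc n * (C + 1) ^ n * h * Real.exp (n * (K + 1))
      ≤ Real.exp n * Real.exp (n * Real.log (C + 1)) * Real.exp (-Real.log (1 / h))
        * Real.exp (n * (K + 1)) := by
        rw [← e2, ← e3]; gcongr
    _ = Real.exp (n * Q - Real.log (1 / h)) := by
        rw [← Real.exp_add, ← Real.exp_add, ← Real.exp_add, hQ]; congr 1; ring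
    _ ≤ Real.exp (-(Real.log (1 / h) / 2)) := by
        rw [Real.exp_le_exp]; linarith

/-- The modulus of continuity: the finite scale exponents are compared at a scale `n` of the order of
`log (1/h)`, where they are close to the limits and still depend on the cocycle in a Lipschitz way,
up to a small set. -/
theorem exists_abs_sub_le_of_hasRate (hT : MeasurePreserving T μ μ) {p : ℝ≥0∞} (hp : 1 < p)
    (K : ℝ≥0) {ι : ℝ → ℝ} (hι : IsDevMeasure ι) {N : ℕ} (hN : 1 ≤ N) {D a : ℝ} (hD : 0 ≤ D)
    (ha : 0 < a) (ha1 : a ≤ 1) {C : ℝ} (hC1 : 1 ≤ C) :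
    ∃ M c h₀ : ℝ, 0 < M ∧ 0 < c ∧ 0 < h₀ ∧ h₀ < 1 ∧
      ∀ B₁ B₂ : X → Matrix (Fin d) (Fin d) ℝ, IsBddCocycle μ B₁ → IsBddCocycle μ B₂ →
      (∀ᵐ x ∂μ, ‖B₂ x‖ ≤ C) → ∀ l₁ l₂ : ℝ, HasRate μ T p K ι N D a B₁ l₁ →
      HasRate μ T p K ι N D a B₂ l₂ → ∀ h : ℝ, 0 < h → h ≤ h₀ → (∀ᵐ x ∂μ, ‖B₁ x - B₂ x‖ ≤ h) →
        |l₁ - l₂| ≤ M * ι (c * Real.log (1 / h)) ^ (1 - (1 / p).toReal) := by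
  set θ := 1 - (1 / p).toReal with hθdef
  have hθ : 0 < θ := holderExponent_pos hp
  obtain ⟨K₀, t₀, hK₀, ht₀, hexp⟩ := hι.exists_exp_le
  obtain ⟨Q, hQ⟩ : ∃ Q : ℝ, Q = K + Real.log (C + 1) + 2 := ⟨_, rfl⟩
  have hQ1 : 1 ≤ Q := by
    have h1 : 0 ≤ Real.log (C + 1) := Real.log_nonneg (by linarith)
    have h2 : (0 : ℝ) ≤ K := K.2
    linarith
  have hQ0 : 0 < Q := one_pos.trans_le hQ1
  -- `b t` is below `a n`, and `exp (-Q t)` is below `ι (b t) ^ θ`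
  obtain ⟨b, hb0, hba, hbQ⟩ : ∃ b : ℝ, 0 < b ∧ b ≤ a / 4 ∧ K₀ * b * θ ≤ Q := by
    refine ⟨min (a / 4) (Q / (K₀ * θ)), by positivity, min_le_left _ _, ?_⟩
    calc K₀ * min (a / 4) (Q / (K₀ * θ)) * θ ≤ K₀ * (Q / (K₀ * θ)) * θ := by
          gcongr; exact min_le_right _ _
      _ = Q := by field_simp
  have hN0 : (0 : ℝ) < N := by exact_mod_cast hN
  set R := 2 * Q * max (2 * (N : ℝ)) (t₀ / b)
  have hR : 0 < R := by positivity
  refine ⟨3 + 6 * K * 2 ^ θ + 2 * D, b / (2 * Q), Real.exp (-R), by positivity, by positivity,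
    Real.exp_pos _, by rw [Real.exp_lt_one_iff]; linarith,
    fun B₁ B₂ h₁ h₂ hC l₁ l₂ hr₁ hr₂ h hh0 hhR hh => ?_⟩
  obtain ⟨t, ht⟩ : ∃ t, t = Real.log (1 / h) / (2 * Q) := ⟨_, rfl⟩
  have hlog : Real.log (1 / h) = 2 * Q * t := by rw [ht]; field_simp
  have htR : max (2 * (N : ℝ)) (t₀ / b) ≤ t := by
    have h3 : R ≤ Real.log (1 / h) := by
      rw [one_div, Real.log_inv, le_neg, ← Real.log_exp (-R)]
      exact Real.log_le_log hh0 hhR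
    rw [hlog] at h3
    exact le_of_mul_le_mul_left h3 (by positivity)
  have ht2 : t₀ ≤ b * t := by
    have := (le_max_right _ _).trans htR
    rwa [div_le_iff₀' hb0] at this
  have hbt : 0 < b * t := ht₀.trans_le ht2
  obtain ⟨k, hk1, hk2⟩ := exists_dyadic_scale hN ((le_max_left _ _).trans htR)
  obtain ⟨n, hn⟩ : ∃ n, n = 2 ^ k * N := ⟨_, rfl⟩
  have en : (2 ^ k * N : ℝ) = n := by rw [hn]; push_cast; ring
  have en2 : 2 ^ (k + 1) * N = 2 * n := by rw [hn]; ring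
  rw [en] at hk1 hk2
  have hNn : N ≤ n := hn ▸ Nat.le_mul_of_pos_left _ (by positivity)
  have hn1 : 1 ≤ n := hN.trans hNn
  have hn0 : (0 : ℝ) < n := by exact_mod_cast hn1
  have hιan : ι (a * n) ≤ ι (b * t) := by
    refine hι.le_of_le hbt ?_
    have ht0 : 0 < t := by linarith
    calc b * t ≤ a / 4 * (4 * n) := by gcongr
      _ = a * n := by ring
  have hιn : ι n ≤ ι (b * t) := (hι.le_of_le (by positivity) (by nlinarith)).trans hιan
  have hh1 : h ≤ 1 := hhR.trans (Real.exp_le_one_iff.2 (by linarith))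
  have hιb := (hι.pos _ hbt).le
  have hE : Real.exp (-(Real.log (1 / h) / 2)) ≤ ι (b * t) ^ θ := by
    calc Real.exp (-(Real.log (1 / h) / 2)) ≤ Real.exp (-(K₀ * (b * t)) * θ) := by
          rw [Real.exp_le_exp, hlog]
          have ht0 : 0 < t := by linarith
          have := mul_le_mul_of_nonneg_right hbQ ht0.le
          linarith
      _ = Real.exp (-(K₀ * (b * t))) ^ θ := Real.exp_mul _ _
      _ ≤ ι (b * t) ^ θ := Real.rpow_le_rpow (Real.exp_pos _).le (hexp _ ht2) hθ.le
  have hcomp : ∀ n' : ℕ, n ≤ n' → (n' : ℝ) ≤ t → |realLyap μ T B₁ n' - realLyap μ T B₂ n'|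
      ≤ ι (b * t) ^ θ + 2 * K * (2 ^ θ * ι (b * t) ^ θ) := by
    intro n' hn' hn't
    have hιn' : ι n' ≤ ι (b * t) :=
      (hι.le_of_le hn0 (by exact_mod_cast hn')).trans hιn
    have h3 := abs_realLyap_sub_le_of_scale hT hp h₁ h₂ hr₁.lpBounded hr₂.lpBounded hC1 hC hh0 hh1 hh
      (hn1.trans hn') hιb
      ((hr₁.measure_le n' (hNn.trans hn')).trans (ENNReal.ofReal_le_ofReal hιn'))
      ((hr₂.measure_le n' (hNn.trans hn')).trans (ENNReal.ofReal_le_ofReal hιn')) hQ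
      (by rw [hlog]; gcongr)
    rw [Real.mul_rpow zero_le_two hιb] at h3
    linarith
  have hc1 := hcomp n le_rfl (by linarith)
  have hc2 := hcomp (2 * n) (by omega) (by push_cast; linarith)
  have hr1 := hr₁.abs_sub_le k
  have hr2 := hr₂.abs_sub_le k
  rw [en2, ← hn, en] at hr1 hr2
  have hD' : D * ι (a * n) ^ θ ≤ D * ι (b * t) ^ θ := by
    have := (hι.pos (a * n) (by positivity)).le
    gcongr
  have harg : b / (2 * Q) * Real.log (1 / h) = b * t := by rw [ht]; ring
  rw [harg]
  set J := ι (b * t) ^ θ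
  have hfin : |l₁ - l₂| ≤ 3 * (J + 2 * K * (2 ^ θ * J)) + 2 * (D * J) := by
    rw [abs_le] at hc1 hc2 hr1 hr2 ⊢
    constructor <;> linarith
  refine hfin.trans (le_of_eq ?_)
  ring

end Modulus

/-! ### Semicontinuity of the exponents -/

section Continuity

variable {X : Type*} [MeasurableSpace X] {μ : Measure X} [IsProbabilityMeasure μ]
  {C : CocycleSpace μ} {T : X → X} {m : ℕ}

theorem eventually_extLyap_lt (hT : MeasurePreserving T μ μ) (hm : 1 ≤ m) {k : ℕ} (hk : k ≤ m)
    {A : C.Space m} {c : EReal} (h : extLyap μ T A.1 k < c) :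
    ∀ᶠ B : C.Space m in 𝓝 A, extLyap μ T B.1 k < c := by
  rcases Nat.eq_zero_or_pos k with rfl | hk1
  · simp only [extLyap_zero] at h ⊢
    exact Eventually.of_forall fun _ => h
  obtain ⟨r, hr1, hr2⟩ := EReal.lt_iff_exists_real_btwn.1 h
  have hA := CocycleSpace.isBddCocycle A
  obtain ⟨δ', hδ', hδ⟩ := (hA.wedge hm hk).exists_lyap_lt hT (Nat.choose_pos hk) hr1
  obtain ⟨δ, hδ0, hw⟩ := CocycleSpace.exists_ae_norm_wedge_sub_le hk1 hk A hδ'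
  filter_upwards [Metric.ball_mem_nhds A hδ0] with B hB
  exact (hδ _ ((CocycleSpace.isBddCocycle B).wedge hm hk) (hw B hB)).trans hr2

/-- Lower semicontinuity of `L_1` at a cocycle with `L_1 > L_2`, or in dimension one. -/
theorem exists_lyap_near (hT : MeasurePreserving T μ μ) {Ξ : Set (X → ℝ)} {P : LDTParameters}
    {p : ℝ≥0∞} (hp : 1 < p) (hm : 1 ≤ m) {A : C.Space m}
    (compatible : 2 ≤ m → Compatible μ T Ξ fun x => wedge 2 (A.1 x))
    (base : ∀ ξ ∈ Ξ, BaseLDT T μ P ξ) (lpBounded : UniformlyLpBounded T C p A)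
    (fiber : 2 ≤ m → UniformFiberLDT T C P A) (gap : lyap μ T A.1 2 < lyap μ T A.1 1) {L : ℝ}
    (hL : lyap μ T A.1 1 = L) {η : ℝ} (hη : 0 < η) :
    ∃ δ : ℝ, 0 < δ ∧ ∀ B : C.Space m, dist B A < δ →
      ∃ l : ℝ, lyap μ T B.1 1 = l ∧ |l - L| ≤ η := by
  rcases hm.eq_or_lt with h1 | h2
  · obtain ⟨δ, hδ, K, hK⟩ := exists_abs_realLyap_sub_le_of_dim_one hT hp lpBounded hη
    have hlyap : ∀ B : C.Space m, dist B A < δ → lyap μ T B.1 1 = (realLyap μ T B.1 1 : EReal) :=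
      fun B hB => lyap_eq_of_dim_one h1.symm (CocycleSpace.isBddCocycle B) hT hp.le (hK B hB).1
    have hAL : realLyap μ T A.1 1 = L :=
      EReal.coe_injective ((hlyap A (by rwa [dist_self])).symm.trans hL)
    exact ⟨δ, hδ, fun B hB => ⟨_, hlyap B hB, hAL ▸ (hK B hB).2⟩⟩
  · obtain ⟨δ, hδ, K, ι, -, N, -, D, a, -, -, -, h⟩ := uniformRate_of_two_le hT hp h2
      (compatible h2) base lpBounded (fiber h2) gap hL hη
    exact ⟨δ, hδ, fun B hB => (h B hB).imp fun l hl => ⟨hl.1.lyap_eq, hl.2⟩⟩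

/-- `∧_k A` has the gap `L_1 > L_2` if `A` has the gap `L_k > L_{k+1}`; for `k = m` the dimension of
`∧_k A` is one. -/
theorem lyap_two_wedge_lt_of_le {A : X → Matrix (Fin m) (Fin m) ℝ} (hA : IsBddCocycle μ A)
    (hT : MeasurePreserving T μ μ) {k : ℕ} (hk : 1 ≤ k) (hkm : k ≤ m)
    (h : lyap μ T A (k + 1) < lyap μ T A k) :
    lyap μ T (fun x => wedge k (A x)) 2 < lyap μ T (fun x => wedge k (A x)) 1 := by
  rcases hkm.eq_or_lt with rfl | hlt
  · rw [lyap_eq_bot_of_lt (fun x => wedge k (A x)) (by rw [Nat.choose_self]; norm_num)]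
    exact bot_lt_extLyap hA hT hk le_rfl (bot_le.trans_lt h)
  · exact lyap_two_wedge_lt hA hT hk hlt h

theorem two_le_choose {m k : ℕ} (hk : 1 ≤ k) (hkm : k < m) : 2 ≤ m.choose k := by
  obtain ⟨n, rfl⟩ : ∃ n, m = n + 1 := ⟨m - 1, by omega⟩
  obtain ⟨j, rfl⟩ : ∃ j, k = j + 1 := ⟨k - 1, by omega⟩
  rw [Nat.choose_succ_succ']
  have h1 := Nat.choose_pos (show j ≤ n by omega)
  have h2 := Nat.choose_pos (show j + 1 ≤ n by omega)
  omega

/-- Lower semicontinuity of the block `L_1 + ⋯ + L_k` at a cocycle with a gap `L_k > L_{k+1}`. -/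
theorem eventually_lt_extLyap (hT : MeasurePreserving T μ μ) {Ξ : Set (X → ℝ)} {P : LDTParameters}
    {p : ℝ≥0∞} (hp : 1 < p)
    (compatible : ∀ m, 1 ≤ m → ∀ A ∈ C.carrier m, Compatible μ T Ξ A)
    (base : ∀ ξ ∈ Ξ, BaseLDT T μ P ξ)
    (lpBounded : ∀ m, 1 ≤ m → ∀ A : C.Space m, ⊥ < lyap μ T A.1 1 → UniformlyLpBounded T C p A)
    (fiber : ∀ m, 2 ≤ m → ∀ A : C.Space m, lyap μ T A.1 2 < lyap μ T A.1 1 →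
      UniformFiberLDT T C P A)
    {k : ℕ} (hk : 1 ≤ k) (hkm : k ≤ m) {A : C.Space m}
    (gap : lyap μ T A.1 (k + 1) < lyap μ T A.1 k) {c : EReal} (hc : c < extLyap μ T A.1 k) :
    ∀ᶠ B : C.Space m in 𝓝 A, c < extLyap μ T B.1 k := by
  have hA := CocycleSpace.isBddCocycle A
  have hbot := bot_lt_extLyap hA hT (hk.trans hkm) hkm (bot_le.trans_lt gap)
  obtain ⟨L, hL⟩ := EReal_exists_coe hbot (extLyap_lt_top hA hT (hk.trans hkm) hkm)
  obtain ⟨r, hr1, hr2⟩ := EReal.lt_iff_exists_real_btwn.1 hc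
  rw [hL, EReal.coe_lt_coe_iff] at hr2
  have hd := Nat.choose_pos hkm
  have gapW := lyap_two_wedge_lt_of_le hA hT hk hkm gap
  obtain ⟨δ', hδ', h⟩ := exists_lyap_near (A := C.wedgeMap hk hkm A) hT hp hd
    (fun h2 => compatible _ (Nat.choose_pos h2) _
      (C.wedge_mem _ 2 one_le_two h2 _ (C.wedgeMap hk hkm A).2)) base
    (lpBounded _ hd _ hbot) (fun h2 => fiber _ h2 _ gapW) gapW hL (half_pos (sub_pos.2 hr2))
  obtain ⟨δ, hδ, hw⟩ := CocycleSpace.exists_dist_wedgeMap_lt hk hkm A hδ'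
  filter_upwards [Metric.ball_mem_nhds A hδ] with B hB
  obtain ⟨l, hl, hlL⟩ := h _ (hw B hB)
  have e : extLyap μ T B.1 k = l := hl
  rw [e]
  refine hr1.trans (EReal.coe_lt_coe_iff.2 ?_)
  rw [abs_le] at hlL
  linarith

/-- Upper semicontinuity of `L_k`: without a gap at `k - 1` it follows from that of `L_{k-1} ≥ L_k`,
and with a gap `L_k` is the difference of an upper semicontinuous function and a continuous one. -/
theorem eventually_lyap_lt (hT : MeasurePreserving T μ μ) (hm : 1 ≤ m) {A : C.Space m}
    (hlsc : ∀ k, 1 ≤ k → k ≤ m → lyap μ T A.1 (k + 1) < lyap μ T A.1 k →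
      ∀ c < extLyap μ T A.1 k, ∀ᶠ B : C.Space m in 𝓝 A, c < extLyap μ T B.1 k)
    {k : ℕ} (hk : 1 ≤ k) (hkm : k ≤ m) {c : EReal} (hc : lyap μ T A.1 k < c) :
    ∀ᶠ B : C.Space m in 𝓝 A, lyap μ T B.1 k < c := by
  have hA := CocycleSpace.isBddCocycle A
  induction k, hk using Nat.le_induction with
  | base =>
    rw [← extLyap_one hm] at hc
    filter_upwards [eventually_extLyap_lt hT hm hkm hc] with B hB
    rwa [extLyap_one hm] at hB
  | succ k hk ih =>
    rcases (lyap_antitone (μ := μ) (T := T) A.1 (Nat.le_succ k)).eq_or_lt with heq | hgap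
    · filter_upwards [ih (by omega) (heq ▸ hc)] with B hB
      exact (lyap_antitone B.1 (Nat.le_succ k)).trans_lt hB
    have hk' : k ≤ m := by omega
    have hbot := bot_lt_extLyap hA hT hm hk' (bot_le.trans_lt hgap)
    obtain ⟨e, he⟩ := EReal_exists_coe hbot (extLyap_lt_top hA hT hm hk')
    rw [lyap_succ_eq_sub hA hT hm hkm hbot, he] at hc
    obtain ⟨r, hr1, hr2⟩ := EReal.lt_iff_exists_real_btwn.1 hc
    rw [EReal.sub_lt_iff (Or.inl (EReal.coe_ne_bot e)) (Or.inl (EReal.coe_ne_top e)),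
      ← EReal.coe_add] at hr1
    obtain ⟨s, hs1, hs2⟩ := EReal.lt_iff_exists_real_btwn.1 hr1
    rw [EReal.coe_lt_coe_iff] at hs2
    have hlow : ((s - r : ℝ) : EReal) < extLyap μ T A.1 k := by
      rw [he, EReal.coe_lt_coe_iff]; linarith
    filter_upwards [hlsc k hk hk' hgap _ hlow, eventually_extLyap_lt hT hm hkm hs1] with B hB1 hB2
    have hB := CocycleSpace.isBddCocycle B
    have hBbot := bot_le.trans_lt hB1
    obtain ⟨b, hb⟩ := EReal_exists_coe hBbot (extLyap_lt_top hB hT hm hk')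
    rw [hb, EReal.coe_lt_coe_iff] at hB1
    rw [lyap_succ_eq_sub hB hT hm hkm hBbot, hb]
    refine lt_trans ?_ hr2
    rw [EReal.sub_lt_iff (Or.inl (EReal.coe_ne_bot b)) (Or.inl (EReal.coe_ne_top b)),
      ← EReal.coe_add]
    exact hB2.trans (EReal.coe_lt_coe_iff.2 (by linarith))

/-- Lower semicontinuity of `L_k`: without a gap at `k` it follows from that of `L_{k+1} ≤ L_k`, and
with a gap `L_k` is the difference of a continuous function and an upper semicontinuous one. -/
theorem eventually_lt_lyap (hT : MeasurePreserving T μ μ) (hm : 1 ≤ m) {A : C.Space m}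
    (hlsc : ∀ k, 1 ≤ k → k ≤ m → lyap μ T A.1 (k + 1) < lyap μ T A.1 k →
      ∀ c < extLyap μ T A.1 k, ∀ᶠ B : C.Space m in 𝓝 A, c < extLyap μ T B.1 k)
    {k : ℕ} (hk : 1 ≤ k) (hkm : k ≤ m) {c : EReal} (hc : c < lyap μ T A.1 k) :
    ∀ᶠ B : C.Space m in 𝓝 A, c < lyap μ T B.1 k := by
  have hA := CocycleSpace.isBddCocycle A
  have hgap : ∀ k, 1 ≤ k → k ≤ m → lyap μ T A.1 (k + 1) < lyap μ T A.1 k → c < lyap μ T A.1 k →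
      ∀ᶠ B : C.Space m in 𝓝 A, c < lyap μ T B.1 k := by
    intro k hk hkm hgap hc
    have hlsck := hlsc k hk hkm hgap
    obtain ⟨i, rfl⟩ : ∃ i, k = i + 1 := ⟨k - 1, by omega⟩
    have hi : i ≤ m := by omega
    have hbot := bot_lt_extLyap hA hT hm hkm (bot_le.trans_lt hgap)
    have hbot' := bot_lt_extLyap_of_succ hA hT hm hkm hbot
    obtain ⟨E, hE⟩ := EReal_exists_coe hbot (extLyap_lt_top hA hT hm hkm)
    obtain ⟨e, he⟩ := EReal_exists_coe hbot' (extLyap_lt_top hA hT hm hi)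
    rw [lyap_succ_eq_sub hA hT hm hkm hbot', hE, he, ← EReal.coe_sub] at hc
    obtain ⟨r, hr1, hr2⟩ := EReal.lt_iff_exists_real_btwn.1 hc
    rw [EReal.coe_lt_coe_iff] at hr2
    obtain ⟨s, hs1, hs2⟩ := exists_between (show e < E - r by linarith)
    have h1 : ((r + s : ℝ) : EReal) < extLyap μ T A.1 (i + 1) := by
      rw [hE, EReal.coe_lt_coe_iff]; linarith
    have h2 : extLyap μ T A.1 i < (s : EReal) := by rwa [he, EReal.coe_lt_coe_iff]
    filter_upwards [hlsck _ h1, eventually_extLyap_lt hT hm hi h2] with B hB1 hB2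
    have hB := CocycleSpace.isBddCocycle B
    have hBbot := bot_le.trans_lt hB1
    have hBbot' := bot_lt_extLyap_of_succ hB hT hm hkm hBbot
    obtain ⟨E', hE'⟩ := EReal_exists_coe hBbot (extLyap_lt_top hB hT hm hkm)
    obtain ⟨e', he'⟩ := EReal_exists_coe hBbot' (extLyap_lt_top hB hT hm hi)
    rw [hE', EReal.coe_lt_coe_iff] at hB1
    rw [he', EReal.coe_lt_coe_iff] at hB2
    rw [lyap_succ_eq_sub hB hT hm hkm hBbot', hE', he', ← EReal.coe_sub]
    exact hr1.trans (EReal.coe_lt_coe_iff.2 (by linarith))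
  obtain ⟨j, hj⟩ : ∃ j, j = m - k := ⟨_, rfl⟩
  induction j generalizing k with
  | zero =>
    refine hgap k hk hkm ?_ hc
    rw [lyap_eq_bot_of_lt A.1 (by omega)]
    exact bot_le.trans_lt hc
  | succ j ih =>
    rcases (lyap_antitone (μ := μ) (T := T) A.1 (Nat.le_succ k)).eq_or_lt with heq | hlt
    · filter_upwards [ih (k := k + 1) (by omega) (by omega) (heq.symm ▸ hc) (by omega)] with B hB
      exact hB.trans_le (lyap_antitone B.1 (Nat.le_succ k))
    · exact hgap k hk hkm hlt hc

end Continuity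

/-! ### The modulus of continuity of the blocks -/

section Blocks

variable {X : Type*} [MeasurableSpace X] {μ : Measure X} {C : CocycleSpace μ} {T : X → X} {m : ℕ}
  {P : LDTParameters} {p : ℝ≥0∞}

/-- The hypothesis on cocycles of dimension one, for a dimension that is only propositionally equal to
one, such as `m.choose m`. -/
theorem uniformFiberLDT_of_dim_one
    (fiber : ∀ A : C.Space 1, lyap μ T A.1 2 < lyap μ T A.1 1 → UniformFiberLDT T C P A)
    {d : ℕ} (hd : d = 1) (A : C.Space d) (gap : lyap μ T A.1 2 < lyap μ T A.1 1) :
    UniformFiberLDT T C P A := by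
  subst hd
  exact fiber A gap

variable [IsProbabilityMeasure μ]

/-- An estimate with a multiplicative constant and up to a Lipschitz map is an estimate by a modulus
of continuity. -/
theorem rpow_log_le_modulus {ι : ℝ → ℝ} (hι : IsDevMeasure ι) (hp : 1 < p) {M c Q h : ℝ}
    (hM : 0 < M) (hc : 0 < c) (hQ : 1 ≤ Q) (h0 : 0 < h) (h1 : h < 1) (hhQ : h ≤ 1 / Q ^ 2) :
    M * ι (c * Real.log (1 / (Q * h))) ^ (1 - (1 / p).toReal)
      ≤ modulus (fun t => M ^ (1 / (1 - (1 / p).toReal)) * ι t) (c / 2) p h := by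
  have hθ := holderExponent_pos hp
  have hQ0 : 0 < Q := one_pos.trans_le hQ
  have hl : 0 < Real.log (1 / h) := Real.log_pos (by rw [lt_div_iff₀ h0]; linarith)
  have harg : c / 2 * Real.log (1 / h) ≤ c * Real.log (1 / (Q * h)) := by
    have h2 : Real.log h ≤ -(2 * Real.log Q) := by
      have := Real.log_le_log h0 hhQ
      rwa [one_div, Real.log_inv, Real.log_pow, Nat.cast_two] at this
    rw [one_div, one_div, Real.log_inv, Real.log_inv, Real.log_mul hQ0.ne' h0.ne']
    nlinarith
  have hpos : 0 < c / 2 * Real.log (1 / h) := by positivity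
  rw [modulus, if_neg h0.ne', Real.mul_rpow (by positivity) (hι.pos _ hpos).le, ← Real.rpow_mul hM.le,
    one_div_mul_cancel hθ.ne', Real.rpow_one]
  gcongr
  · exact (hι.pos _ (hpos.trans_le harg)).le
  · exact hι.le_of_le hpos harg

/-- The modulus of continuity of `L_1 + ⋯ + L_k`, from the rate of convergence for `∧_k A`. -/
theorem exists_modulus_of_uniformRate (hT : MeasurePreserving T μ μ) (hp : 1 < p) {k : ℕ}
    (hk : 1 ≤ k) (hkm : k ≤ m) {A : C.Space m} {L η : ℝ}
    (h : UniformRate T P p (C.wedgeMap hk hkm A) L η) :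
    ∃ δ : ℝ, 0 < δ ∧ ∃ ι ∈ P.devMeasures, ∃ c : ℝ, 0 < c ∧
      ∀ B₁ B₂ : C.Space m, dist B₁ A < δ → dist B₂ A < δ →
        (lyapBlock μ T B₁.1 k - lyapBlock μ T B₂.1 k).abs ≤
          ENNReal.ofReal (modulus ι c p (dist B₁ B₂)) := by
  obtain ⟨δ', hδ', K, ι, hι, N, hN, D, a, hD, ha, ha1, hrate⟩ := h
  have hιm := P.isDevMeasure ι hι
  have hd := Nat.choose_pos hkm
  obtain ⟨δ₁, hδ₁, hw⟩ := CocycleSpace.exists_dist_wedgeMap_lt hk hkm A (lt_min hδ' one_pos)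
  obtain ⟨Q, δ₂, hQ, hδ₂, hlip⟩ := CocycleSpace.exists_dist_wedgeMap_le hk hkm A
  have hQ0 : 0 < Q := one_pos.trans_le hQ
  obtain ⟨C₀, hC₀, hC⟩ := (CocycleSpace.isBddCocycle (C.wedgeMap hk hkm A)).bdd
  obtain ⟨M, c, h₀, hM, hc, hh₀, hh₁, hmod⟩ := exists_abs_sub_le_of_hasRate (d := m.choose k)
    hT hp K hιm hN hD ha ha1 (C := C₀ + 1) (by linarith)
  refine ⟨min (min δ₁ δ₂) (min (h₀ / Q / 2) (1 / Q ^ 2 / 2)), by positivity, _,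
    P.smul_mem ι hι (M ^ (1 / (1 - (1 / p).toReal))) (by positivity), c / 2, by positivity,
    fun B₁ B₂ h₁ h₂ => ?_⟩
  simp only [lt_min_iff] at h₁ h₂
  obtain ⟨⟨h₁a, h₁b⟩, h₁c, h₁d⟩ := h₁
  obtain ⟨⟨h₂a, h₂b⟩, h₂c, h₂d⟩ := h₂
  have hdist := dist_triangle_right B₁ B₂ A
  obtain ⟨l₁, hr₁, -⟩ := hrate _ ((hw B₁ h₁a).trans_le (min_le_left _ _))
  obtain ⟨l₂, hr₂, -⟩ := hrate _ ((hw B₂ h₂a).trans_le (min_le_left _ _))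
  have hW := hlip B₁ B₂ h₁b h₂b
  have hb₁ := CocycleSpace.isBddCocycle (C.wedgeMap hk hkm B₁)
  have hb₂ := CocycleSpace.isBddCocycle (C.wedgeMap hk hkm B₂)
  have e₁ : lyapBlock μ T B₁.1 k = l₁ :=
    (lyapBlock_eq_extLyap (CocycleSpace.isBddCocycle B₁) hT (hk.trans hkm) hkm).trans hr₁.lyap_eq
  have e₂ : lyapBlock μ T B₂.1 k = l₂ :=
    (lyapBlock_eq_extLyap (CocycleSpace.isBddCocycle B₂) hT (hk.trans hkm) hkm).trans hr₂.lyap_eq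
  rw [e₁, e₂, ← EReal.coe_sub, EReal.abs_def]
  refine ENNReal.ofReal_le_ofReal ?_
  rcases (dist_nonneg (x := B₁) (y := B₂)).eq_or_lt with h0 | h0
  · rw [← h0, mul_zero] at hW
    have h3 := lyap_one_eq_of_ae_norm_sub_le_zero hT hd hb₂ (CocycleSpace.ae_norm_sub_le_of_le hW)
    rw [hr₁.lyap_eq, hr₂.lyap_eq, EReal.coe_eq_coe_iff] at h3
    rw [h3, sub_self, abs_zero, modulus, if_pos h0.symm]
  have hC₂ : ∀ᵐ x ∂μ, ‖(C.wedgeMap hk hkm B₂).1 x‖ ≤ C₀ + 1 := by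
    filter_upwards [hC, CocycleSpace.ae_norm_sub_le_of_le
      ((hw B₂ h₂a).le.trans (min_le_right _ _))] with x hx1 hx2
    have := norm_le_norm_add_norm_sub' ((C.wedgeMap hk hkm B₂).1 x) ((C.wedgeMap hk hkm A).1 x)
    linarith
  have hQh : Q * dist B₁ B₂ ≤ h₀ := by
    have : dist B₁ B₂ ≤ h₀ / Q := by linarith
    rwa [le_div_iff₀' hQ0] at this
  refine (hmod _ _ hb₁ hb₂ hC₂ l₁ l₂ hr₁ hr₂ (Q * dist B₁ B₂) (by positivity) hQh
    (CocycleSpace.ae_norm_sub_le_of_le hW)).trans ?_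
  refine rpow_log_le_modulus hιm hp hM hc hQ h0 ?_ (by linarith)
  calc dist B₁ B₂ ≤ Q * dist B₁ B₂ := le_mul_of_one_le_left h0.le hQ
    _ < 1 := hQh.trans_lt hh₁

/-- The rate of convergence for `∧_k A`, where `A` has a gap `L_k > L_{k+1}`. -/
theorem uniformRate_wedgeMap (hT : MeasurePreserving T μ μ) {Ξ : Set (X → ℝ)} (hp : 1 < p)
    (compatible : ∀ m, 1 ≤ m → ∀ A ∈ C.carrier m, Compatible μ T Ξ A)
    (base : ∀ ξ ∈ Ξ, BaseLDT T μ P ξ)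
    (lpBounded : ∀ m, 1 ≤ m → ∀ A : C.Space m, ⊥ < lyap μ T A.1 1 → UniformlyLpBounded T C p A)
    (fiber : ∀ m, 2 ≤ m → ∀ A : C.Space m, lyap μ T A.1 2 < lyap μ T A.1 1 →
      UniformFiberLDT T C P A)
    {k : ℕ} (hk : 1 ≤ k) (hkm : k ≤ m)
    (fiberOne : k = m → ∀ A : C.Space 1, lyap μ T A.1 2 < lyap μ T A.1 1 →
      UniformFiberLDT T C P A) {A : C.Space m}
    (gap : lyap μ T A.1 (k + 1) < lyap μ T A.1 k) :
    ∃ L : ℝ, UniformRate T P p (C.wedgeMap hk hkm A) L 1 := by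
  have hA := CocycleSpace.isBddCocycle A
  have hbot := bot_lt_extLyap hA hT (hk.trans hkm) hkm (bot_le.trans_lt gap)
  obtain ⟨L, hL⟩ := EReal_exists_coe hbot (extLyap_lt_top hA hT (hk.trans hkm) hkm)
  have hd := Nat.choose_pos hkm
  have gapW := lyap_two_wedge_lt_of_le hA hT hk hkm gap
  have hlp := lpBounded _ hd (C.wedgeMap hk hkm A) hbot
  refine ⟨L, ?_⟩
  rcases hkm.eq_or_lt with heq | hlt
  · have hd1 : m.choose k = 1 := by rw [heq, Nat.choose_self]
    exact uniformRate_of_dim_one hd1 hT hp hlp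
      (uniformFiberLDT_of_dim_one (fiberOne heq) hd1 _ gapW) hL one_pos
  · have hd2 := two_le_choose hk hlt
    exact uniformRate_of_two_le hT hp hd2 (compatible _ (Nat.choose_pos hd2) _
      (C.wedge_mem _ 2 one_le_two hd2 _ (C.wedgeMap hk hkm A).2)) base hlp (fiber _ hd2 _ gapW) gapW
      hL one_pos

end Blocks

end ACT

theorem theorem1p1 {X : Type*} [MeasurableSpace X] (μ : Measure X) [IsProbabilityMeasure μ]
    (T : X → X) (hT : Ergodic T μ)
    (C : ACT.CocycleSpace μ) (Ξ : Set (X → ℝ)) (hΞ : ∀ ξ ∈ Ξ, Measurable ξ)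
    (P : ACT.LDTParameters) (p : ℝ≥0∞) (hp : 1 < p)
    (compatible : ∀ m, 1 ≤ m → ∀ A ∈ C.carrier m, ACT.Compatible μ T Ξ A)
    (base : ∀ ξ ∈ Ξ, ACT.BaseLDT T μ P ξ)
    (lpBounded : ∀ m, 1 ≤ m → ∀ A : C.Space m, ⊥ < ACT.lyap μ T A.1 1 →
      ACT.UniformlyLpBounded T C p A)
    (fiber : ∀ m, 2 ≤ m → ∀ A : C.Space m, ACT.lyap μ T A.1 2 < ACT.lyap μ T A.1 1 →
      ACT.UniformFiberLDT T C P A) :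
    (∀ m k, 1 ≤ k → k ≤ m →
      (∀ A : C.Space m, ACT.lyap μ T A.1 k < ⊤) ∧
      Continuous fun A : C.Space m => ACT.lyap μ T A.1 k) ∧
    -- For `k = m` (where `L_{m+1} = -∞`) the assumption `fiber` is also needed in dimension one,
    -- where the gap `L_1 > L_2` means `L_1 > -∞`.
    (∀ m k, 1 ≤ k → k ≤ m →
      (k = m → ∀ A : C.Space 1, ACT.lyap μ T A.1 2 < ACT.lyap μ T A.1 1 →
        ACT.UniformFiberLDT T C P A) →
      ∀ A : C.Space m, ACT.lyap μ T A.1 (k + 1) < ACT.lyap μ T A.1 k →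
        ∃ δ : ℝ, 0 < δ ∧ ∃ ι ∈ P.devMeasures, ∃ c : ℝ, 0 < c ∧
          ∀ B₁ B₂ : C.Space m, dist B₁ A < δ → dist B₂ A < δ →
            (ACT.lyapBlock μ T B₁.1 k - ACT.lyapBlock μ T B₂.1 k).abs ≤
              ENNReal.ofReal (ACT.modulus ι c p (dist B₁ B₂))) := by
  have hT' := hT.toMeasurePreserving
  refine ⟨fun m k hk hkm => ?_, fun m k hk hkm fiberOne A gap => ?_⟩
  · have hm := hk.trans hkm
    refine ⟨fun A => ACT.lyap_lt_top (ACT.CocycleSpace.isBddCocycle A) hT' hm hk,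
      continuous_iff_continuousAt.2 fun A => ?_⟩
    have hlsc : ∀ k, 1 ≤ k → k ≤ m → ACT.lyap μ T A.1 (k + 1) < ACT.lyap μ T A.1 k →
        ∀ c < ACT.extLyap μ T A.1 k, ∀ᶠ B : C.Space m in 𝓝 A, c < ACT.extLyap μ T B.1 k :=
      fun k hk hkm gap c hc =>
        ACT.eventually_lt_extLyap hT' hp compatible base lpBounded fiber hk hkm gap hc
    exact tendsto_order.2 ⟨fun c hc => ACT.eventually_lt_lyap hT' hm hlsc hk hkm hc,
      fun c hc => ACT.eventually_lyap_lt hT' hm hlsc hk hkm hc⟩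
  · obtain ⟨L, hL⟩ := ACT.uniformRate_wedgeMap hT' hp compatible base lpBounded fiber hk hkm
      fiberOne gap
    exact ACT.exists_modulus_of_uniformRate hT' hp hk hkm hL
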